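/- Let $k$ be a field. Let $\mathrm{dgcat}$ be the category of small DG-categories over $k$ (categories enriched over cochain complexes of $k$-modules) and DG-functors, and let $L\colon \mathrm{dgcat}\to \mathrm{Hqe}$ be its localization at the quasi-equivalences. For a small DG-category $\mathcal A$ let $\mathcal C(\mathcal A)$ be the DG-category of left $\mathcal A$-modules, i.e. of DG-functors $\mathcal A\to\mathcal C(k)$ to the DG-category of complexes, and let $i^{\mathcal A}\colon \mathcal D_{cf}(\mathcal A)\hookrightarrow \mathcal C(\mathcal A)$ be the full DG-subcategory of those modules $M$ that are cofibrant in the projective model structure and for which every $M(a)$, $a\in\mathcal A$, has finite-dimensional total cohomology. There is a small set of objects of $\mathcal D_{cf}(\mathcal A)$ meeting every homotopy equivalence class; fix one for each $\mathcal A$ and regard $\mathcal D_{cf}(\mathcal A)$ as a small DG-category by passing to the full DG-subcategory on it. If $\Phi\colon \mathcal X\to \mathcal C(\mathcal A)$ is a DG-functor, with $\mathcal X$ small, then a natural cofibrant replacement of $\Phi$ is a DG-functor $P$ from $\mathcal X$ to cofibrant cohomologically finite modules with a closed degree $0$ natural transformation $P\to\Phi$ whose components are quasi-isomorphisms (for instance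 $P=Q\Phi$, $Q$ a cofibrant replacement DG-functor on $\mathcal C(\mathcal A)$, if the values of $\Phi$ are cohomologically finite). Such a $P$ defines a morphism $[\Phi]\colon \mathcal X\to \mathcal D_{cf}(\mathcal A)$ in $\mathrm{Hqe}$. Then the following hold. 1. There is a functor $\mathcal D_{cf}(-)\colon \mathrm{Hqe}\to\mathrm{Hqe}^{op}$ which is $\mathcal A\mapsto\mathcal D_{cf}(\mathcal A)$ on objects (up to chosen isomorphisms) and sends the class of a DG-functor $F\colon\mathcal A\to\mathcal B$ to $[\mathrm{Res}(F)\, i^{\mathcal B}]\colon \mathcal D_{cf}(\mathcal B)\to\mathcal D_{cf}(\mathcal A)$, where $\mathrm{Res}(F)$ is precomposition with $F$; a natural cofibrant replacement of $\mathrm{Res}(F)\,i^{\mathcal B}$ exists and its class does not depend on the choice. 2. There is a natural transformation $\mathrm{ev}\colon 1_{\mathrm{Hqe}}\to \mathcal D_{cf}\mathcal D_{cf}(-)$ whose component at $\mathcal A$ is the class $\mathrm{ev}_{\mathcal A}\colon\mathcal A\to\mathcal D_{cf}\mathcal D_{cf}(\mathcal A)$ of the DG-functor $\mathcal A\to\mathcal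 C(\mathcal D_{cf}(\mathcal A))$, $a\mapsto (M\mapsto M(a))$; again a natural cofibrant replacement exists and its class does not depend on the choice. 3. $\mathcal D_{cf}(-)$ is self-adjoint on the right: there is an adjunction $$\mathcal D_{cf}(-)\colon \mathrm{Hqe}\rightleftarrows\mathrm{Hqe}^{op}\colon \mathcal D_{cf}(-)$$ with $\mathcal D_{cf}(-)\colon\mathrm{Hqe}\to\mathrm{Hqe}^{op}$ as the left adjoint, whose unit is $\mathrm{ev}$ and whose counit at $\mathcal B$ is $\mathrm{ev}_{\mathcal B}\colon\mathcal B\to\mathcal D_{cf}\mathcal D_{cf}(\mathcal B)$, read as a morphism $\mathcal D_{cf}\mathcal D_{cf}(\mathcal B)\to\mathcal B$ of $\mathrm{Hqe}^{op}$. -/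

import Mathlib

open CategoryTheory Opposite

universe v w v₁ w₁ v₂ w₂ u

/-- A differential graded category over `k`: a category enriched over cochain complexes of
`k`-modules (cohomological grading).  `Hom x y n` is the degree `n` part of the complex of
morphisms, and composition is written in diagrammatic order: `comp f g` is `g ∘ f`. The equations
`p + q = n` between degrees are arguments, so that no transport between degrees is needed. -/
structure DGCat (k : Type u) [CommRing k] where
  Obj : Type w
  Hom : Obj → Obj → ℤ → Type v
  [addCommGroup : ∀ x y n, AddCommGroup (Hom x y n)]
  [module : ∀ x y n, Module k (Hom x y n)]
  d : ∀ {x y : Obj} {m n : ℤ}, m + 1 = n → Hom x y m →ₗ[k] Hom x y n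
  d_d : ∀ {x y : Obj} {l m n : ℤ} (h : l + 1 = m) (h' : m + 1 = n) (f : Hom x y l),
    d h' (d h f) = 0
  one : ∀ x : Obj, Hom x x 0
  comp : ∀ {x y z : Obj} {p q n : ℤ}, p + q = n → Hom x y p →ₗ[k] Hom y z q →ₗ[k] Hom x z n
  one_comp : ∀ {x y : Obj} {n : ℤ} (f : Hom x y n), comp (zero_add n) (one x) f = f
  comp_one : ∀ {x y : Obj} {n : ℤ} (f : Hom x y n), comp (add_zero n) f (one y) = f
  assoc : ∀ {x y z t : Obj} {p q r pq qr n : ℤ} (h₁ : p + q = pq) (h₂ : pq + r = n)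
    (h₃ : q + r = qr) (h₄ : p + qr = n) (f : Hom x y p) (g : Hom y z q) (h : Hom z t r),
    comp h₂ (comp h₁ f g) h = comp h₄ f (comp h₃ g h)
  /-- The graded Leibniz rule `d (g ∘ f) = d g ∘ f + (-1) ^ |g| g ∘ d f`. -/
  d_comp : ∀ {x y z : Obj} {p q n p' q' n' : ℤ} (h : p + q = n) (hp : p + 1 = p')
    (hq : q + 1 = q') (hn : n + 1 = n') (h₁ : p + q' = n') (h₂ : p' + q = n')
    (f : Hom x y p) (g : Hom y z q),
    d hn (comp h f g) = comp h₁ f (d hq g) + q.negOnePow • comp h₂ (d hp f) g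

attribute [instance] DGCat.addCommGroup DGCat.module

namespace DGCat

variable {k : Type u} [CommRing k]

/-- The closed morphisms of degree `0`. -/
def IsClosed (A : DGCat.{v, w} k) {x y : A.Obj} (f : A.Hom x y 0) : Prop :=
  A.d (zero_add 1) f = 0

/-- `x` and `y` are isomorphic in the homotopy category `H⁰(A)`. -/
def HtpyEquiv (A : DGCat.{v, w} k) (x y : A.Obj) : Prop :=
  ∃ (f : A.Hom x y 0) (g : A.Hom y x 0) (h : A.Hom x x (-1)) (h' : A.Hom y y (-1)),
    A.IsClosed f ∧ A.IsClosed g ∧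
    A.comp (add_zero 0) f g - A.one x = A.d (neg_add_cancel 1) h ∧
    A.comp (add_zero 0) g f - A.one y = A.d (neg_add_cancel 1) h'

/-- The full DG-subcategory of `A` on a family of objects of `A`. -/
def full (A : DGCat.{v, w} k) {ι : Type w₁} (f : ι → A.Obj) : DGCat.{v, w₁} k where
  Obj := ι
  Hom i j n := A.Hom (f i) (f j) n
  d h := A.d h
  d_d h h' t := A.d_d h h' t
  one i := A.one (f i)
  comp h := A.comp h
  one_comp t := A.one_comp t
  comp_one t := A.comp_one t
  assoc h₁ h₂ h₃ h₄ r s t := A.assoc h₁ h₂ h₃ h₄ r s t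
  d_comp h hp hq hn h₁ h₂ s t := A.d_comp h hp hq hn h₁ h₂ s t

end DGCat

/-- A DG-functor. -/
structure DGFunctor {k : Type u} [CommRing k] (A : DGCat.{v, w} k) (B : DGCat.{v₁, w₁} k) where
  obj : A.Obj → B.Obj
  map : ∀ {x y : A.Obj} {n : ℤ}, A.Hom x y n →ₗ[k] B.Hom (obj x) (obj y) n
  map_d : ∀ {x y : A.Obj} {m n : ℤ} (h : m + 1 = n) (f : A.Hom x y m),
    map (A.d h f) = B.d h (map f)
  map_one : ∀ x : A.Obj, map (A.one x) = B.one (obj x)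
  map_comp : ∀ {x y z : A.Obj} {p q n : ℤ} (h : p + q = n) (f : A.Hom x y p) (g : A.Hom y z q),
    map (A.comp h f g) = B.comp h (map f) (map g)

namespace DGFunctor

variable {k : Type u} [CommRing k] {A : DGCat.{v, w} k} {B : DGCat.{v₁, w₁} k}
  {E : DGCat.{v₂, w₂} k}

/-- The identity DG-functor. -/
def idFunctor (A : DGCat.{v, w} k) : DGFunctor A A where
  obj x := x
  map := LinearMap.id
  map_d _ _ := rfl
  map_one _ := rfl
  map_comp _ _ _ := rfl

/-- Composition of DG-functors, first `F` and then `G`. -/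
def comp (F : DGFunctor A B) (G : DGFunctor B E) : DGFunctor A E where
  obj x := G.obj (F.obj x)
  map := G.map ∘ₗ F.map
  map_d h f := by simp [F.map_d, G.map_d]
  map_one x := by simp [F.map_one, G.map_one]
  map_comp h f g := by simp [F.map_comp, G.map_comp]

/-- The inclusion of a full DG-subcategory. -/
def incl (A : DGCat.{v, w} k) {ι : Type w₁} (f : ι → A.Obj) : DGFunctor (A.full f) A where
  obj := f
  map := LinearMap.id
  map_d _ _ := rfl
  map_one _ := rfl
  map_comp _ _ _ := rfl

/-- A DG-functor is a quasi-equivalence if it induces isomorphisms on the cohomology of all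
complexes of morphisms, and an essentially surjective functor between the categories `H⁰`. -/
structure IsQuasiEquiv (F : DGFunctor A B) : Prop where
  injective_cohomology : ∀ {x y : A.Obj} {m n : ℤ} (h : m + 1 = n) (f : A.Hom x y n),
    A.d rfl f = 0 → (∃ g : B.Hom (F.obj x) (F.obj y) m, B.d h g = F.map f) →
      ∃ f' : A.Hom x y m, A.d h f' = f
  surjective_cohomology : ∀ {x y : A.Obj} {m n : ℤ} (h : m + 1 = n)
    (g : B.Hom (F.obj x) (F.obj y) n), B.d rfl g = 0 →
      ∃ f : A.Hom x y n, A.d rfl f = 0 ∧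
        ∃ g' : B.Hom (F.obj x) (F.obj y) m, B.d h g' = F.map f - g
  essSurj : ∀ b : B.Obj, ∃ a : A.Obj, B.HtpyEquiv (F.obj a) b

/-- The graded natural transformations of degree `n` between two DG-functors: families
`t x : F x → G x` of degree `n` such that `t y ∘ F f = (-1) ^ (|f| n) G f ∘ t x`. -/
def natTrans (F G : DGFunctor A B) (n : ℤ) :
    Submodule k (∀ x : A.Obj, B.Hom (F.obj x) (G.obj x) n) where
  carrier := {t | ∀ ⦃x y : A.Obj⦄ ⦃p m : ℤ⦄ (h : p + n = m) (h' : n + p = m) (f : A.Hom x y p),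
    B.comp h (F.map f) (t y) = (p * n).negOnePow • B.comp h' (t x) (G.map f)}
  zero_mem' := by
    intro x y p m h h' f
    simp
  add_mem' := by
    intro s t hs ht x y p m h h' f
    simp [hs h h' f, ht h h' f, smul_add]
  smul_mem' := by
    intro c t ht x y p m h h' f
    simp [ht h h' f, smul_comm c]

end DGFunctor

namespace DGCat

variable {k : Type u} [CommRing k]

/-- The DG-category of DG-functors from `A` to `B`; its complexes of morphisms consist of the
graded natural transformations, with the pointwise differential. -/
def functors (A : DGCat.{v, w} k) (B : DGCat.{v₁, w₁} k) :
    DGCat.{max w v₁, max v w v₁ w₁} k where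
  Obj := DGFunctor A B
  Hom F G n := DGFunctor.natTrans F G n
  d {F G m n} h :=
    LinearMap.restrict (LinearMap.pi fun x => B.d h ∘ₗ LinearMap.proj x) (by
      intro t ht x y p l h₁ h₁' f
      subst h h₁
      have e := congrArg (B.d (by ring : p + m + 1 = p + (m + 1))) (ht rfl (add_comm m p) f)
      have e' := ht (p := p + 1) (m := p + (m + 1)) (by ring) (by ring) (A.d rfl f)
      rw [B.d_comp rfl rfl rfl _ rfl (by ring)] at e
      rw [F.map_d, G.map_d] at e'
      rw [e', map_zsmul_unit, B.d_comp (add_comm m p) rfl rfl _ (by ring) (by ring)] at e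
      simp only [LinearMap.pi_apply, LinearMap.comp_apply, LinearMap.proj_apply]
      rw [eq_sub_of_add_eq e, smul_add, smul_smul, smul_smul, ← Int.negOnePow_add,
        ← Int.negOnePow_add, show m + (p + 1) * m = p * m + 2 * m by ring,
        Int.negOnePow_add _ (2 * m), Int.negOnePow_two_mul, mul_one, add_sub_cancel_left,
        show p * m + p = p * (m + 1) by ring])
  d_d h h' t := by
    ext x
    exact B.d_d h h' _
  one F := ⟨fun x => B.one (F.obj x), by
    intro x y p m h h' f
    obtain rfl : p = m := by omega
    simp [B.one_comp, B.comp_one]⟩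
  comp {F G H p q n} h :=
    LinearMap.mk₂ k (fun s t => ⟨fun x => B.comp h (s.1 x) (t.1 x), by
      intro x y r m h₁ h₁' f
      subst h h₁
      rw [← B.assoc (pq := r + p) rfl (by ring) _ _, s.2 rfl (add_comm p r) f,
        LinearMap.map_smul_of_tower, LinearMap.smul_apply,
        B.assoc (qr := r + q) _ _ (by ring) (by ring), t.2 rfl (add_comm q r) f,
        LinearMap.map_smul_of_tower, smul_smul, ← Int.negOnePow_add, ← mul_add,
        B.assoc _ _ _ _]⟩)
      (by intro s s' t; ext x; simp)
      (by intro c s t; ext x; simp)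
      (by intro s t t'; ext x; simp)
      (by intro c s t; ext x; simp)
  one_comp t := by
    ext x
    exact B.one_comp _
  comp_one t := by
    ext x
    exact B.comp_one _
  assoc h₁ h₂ h₃ h₄ r s t := by
    ext x
    exact B.assoc h₁ h₂ h₃ h₄ _ _ _
  d_comp h hp hq hn h₁ h₂ s t := by
    ext x
    exact B.d_comp h hp hq hn h₁ h₂ _ _

/-- The DG-category `C(k)` of cochain complexes of `k`-modules, with Mathlib's
complexes of morphisms. -/
def complexes (k : Type u) [CommRing k] : DGCat.{u, u + 1} k where
  Obj := CochainComplex (ModuleCat.{u} k) ℤ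
  Hom K L n := CochainComplex.HomComplex.Cochain K L n
  d {K L m n} _ := CochainComplex.HomComplex.δ_hom k K L m n
  d_d _ _ f := CochainComplex.HomComplex.δ_δ _ _ _ f
  one K := CochainComplex.HomComplex.Cochain.ofHom (𝟙 K)
  comp h := LinearMap.mk₂ k (fun f g => f.comp g h) (by simp) (by simp) (by simp) (by simp)
  one_comp f := f.id_comp
  comp_one f := f.comp_id
  assoc h₁ h₂ h₃ _ f g t := CochainComplex.HomComplex.Cochain.comp_assoc f g t h₁ h₃ (by omega)
  d_comp h hp hq hn _ _ f g := CochainComplex.HomComplex.δ_comp f g h _ _ _ hn hp hq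

/-- The category `dgcat` of small DG-categories and DG-functors. -/
instance : Category (DGCat.{u, u} k) where
  Hom A B := DGFunctor A B
  id A := DGFunctor.idFunctor A
  comp F G := F.comp G

/-- The class of quasi-equivalences in `dgcat`. -/
def quasiEquiv (k : Type u) [CommRing k] : MorphismProperty (DGCat.{u, u} k) :=
  fun _ _ F => DGFunctor.IsQuasiEquiv F

end DGCat

/-- `Hqe`: the localization of `dgcat` at the quasi-equivalences. -/
abbrev Hqe (k : Type u) [CommRing k] := (DGCat.quasiEquiv k).Localization

/-- The localization functor `dgcat ⥤ Hqe`. -/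
abbrev toHqe (k : Type u) [CommRing k] : DGCat.{u, u} k ⥤ Hqe k := (DGCat.quasiEquiv k).Q

namespace DGFunctor

variable {k : Type u} [CommRing k] {A : DGCat.{v, w} k} {B : DGCat.{v₁, w₁} k}

/-- Restriction along `F`: precomposition with the DG-functor `F`. -/
def res (F : DGFunctor A B) (E : DGCat.{v₂, w₂} k) :
    DGFunctor (B.functors E) (A.functors E) where
  obj M := F.comp M
  map {M N n} :=
    LinearMap.restrict (LinearMap.pi fun x => LinearMap.proj (F.obj x)) (by
      intro t ht x y p m h h' f
      exact ht h h' (F.map f))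
  map_d _ _ := rfl
  map_one _ := rfl
  map_comp _ _ _ := rfl

/-- Evaluation at an object `a`: the DG-functor `M ↦ M a`, `β ↦ β a`. -/
def evalObj (A : DGCat.{v, w} k) (E : DGCat.{v₂, w₂} k) (a : A.Obj) :
    ((A.functors E).functors E).Obj :=
  { obj := fun M => DGFunctor.obj M a
    map := fun {M N n} => LinearMap.proj a ∘ₗ (DGFunctor.natTrans M N n).subtype
    map_d := fun _ _ => rfl
    map_one := fun _ => rfl
    map_comp := fun _ _ _ => rfl : DGFunctor (A.functors E) E }

/-- Evaluation: the DG-functor sending `a` to evaluation at `a`, and `f` to the graded natural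
transformation with value `M f` at `M`. -/
def eval (A : DGCat.{v, w} k) (E : DGCat.{v₂, w₂} k) :
    DGFunctor A ((A.functors E).functors E) where
  obj := evalObj A E
  map {a b n} :=
    { toFun := fun f => ⟨fun M => DGFunctor.map M f, by
        intro M N p m h h' t
        have e := t.2 h' h f
        change E.comp h (t.1 a) (DGFunctor.map N f) =
          (p * n).negOnePow • E.comp h' (DGFunctor.map M f) (t.1 b)
        rw [e, smul_smul, ← Int.negOnePow_add, mul_comm n p, ← two_mul,
          Int.negOnePow_two_mul, one_smul]⟩
      map_add' := fun f g => Subtype.ext (funext fun M => map_add (DGFunctor.map M) f g)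
      map_smul' := fun c f => Subtype.ext (funext fun M => map_smul (DGFunctor.map M) c f) }
  map_d h f := Subtype.ext (funext fun M => DGFunctor.map_d M h f)
  map_one a := Subtype.ext (funext fun M => DGFunctor.map_one M a)
  map_comp h f g := Subtype.ext (funext fun M => DGFunctor.map_comp M h f g)

end DGFunctor

namespace DGCat

variable {k : Type u} [CommRing k]

/-- The DG-category `C(A)` of (left) `A`-modules: DG-functors from `A` to `C(k)`. -/
abbrev modules (A : DGCat.{u, u} k) : DGCat.{u, u + 1} k := A.functors (complexes k)

/-- The underlying complex `M(a)` of an `A`-module at the object `a`. -/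
def value {A : DGCat.{u, u} k} (M : A.modules.Obj) (a : A.Obj) :
    CochainComplex (ModuleCat.{u} k) ℤ := DGFunctor.obj M a

/-- The morphism of complexes `M(a) ⟶ N(a)` given by a morphism of `A`-modules, that is by a
closed morphism of degree `0` in `C(A)`. -/
def valueMap {A : DGCat.{u, u} k} {M N : A.modules.Obj} (t : A.modules.Hom M N 0)
    (ht : A.modules.IsClosed t) (a : A.Obj) : value M a ⟶ value N a :=
  CochainComplex.HomComplex.Cocycle.homOf
    (CochainComplex.HomComplex.Cocycle.mk (t.1 a) 1 (zero_add 1)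
      (congrFun (congrArg Subtype.val ht) a))

/-- The pointwise quasi-isomorphisms of `A`-modules. -/
def IsQuasiIso {A : DGCat.{u, u} k} {M N : A.modules.Obj} (t : A.modules.Hom M N 0) : Prop :=
  ∃ ht : A.modules.IsClosed t, ∀ a, QuasiIso (valueMap t ht a)

/-- The trivial fibrations of the projective model structure on `A`-modules: the quasi-isomorphisms
that are surjective at each object and in each degree. -/
def IsTrivialFibration {A : DGCat.{u, u} k} {M N : A.modules.Obj} (t : A.modules.Hom M N 0) :
    Prop :=
  ∃ ht : A.modules.IsClosed t, (∀ a, QuasiIso (valueMap t ht a)) ∧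
    ∀ a (n : ℤ), Function.Surjective ((valueMap t ht a).f n)

/-- The cofibrant `A`-modules in the projective model structure: `0 → P` has the left lifting
property with respect to the trivial fibrations. -/
def IsCofibrant {A : DGCat.{u, u} k} (P : A.modules.Obj) : Prop :=
  ∀ ⦃M N : A.modules.Obj⦄ (t : A.modules.Hom M N 0), IsTrivialFibration t →
    ∀ f : A.modules.Hom P N 0, A.modules.IsClosed f →
      ∃ g : A.modules.Hom P M 0, A.modules.IsClosed g ∧ A.modules.comp (add_zero 0) g t = f

/-- The cohomologically finite modules: every value has finite-dimensional total cohomology. -/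
def IsCohFinite {A : DGCat.{u, u} k} (M : A.modules.Obj) : Prop :=
  ∀ a, Module.Finite k (DirectSum ℤ fun n => (value M a).homology n)

/-- The (large) DG-category `D_cf(A)`: the full DG-subcategory of `C(A)` on the cofibrant
cohomologically finite modules. -/
def derivedCf (A : DGCat.{u, u} k) : DGCat.{u, u + 1} k :=
  A.modules.full (Subtype.val : {M : A.modules.Obj // IsCofibrant M ∧ IsCohFinite M} → _)

/-- The inclusion `i : D_cf(A) → C(A)`. -/
def derivedCfIncl (A : DGCat.{u, u} k) : DGFunctor A.derivedCf A.modules :=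
  DGFunctor.incl A.modules _

/-- A small model of a large DG-category `B` with small complexes of morphisms: a small family of
objects that meets every isomorphism class of `H⁰(B)`. -/
structure SmallModel (B : DGCat.{u, u + 1} k) where
  ι : Type u
  obj : ι → B.Obj
  essSurj : ∀ b : B.Obj, ∃ i, B.HtpyEquiv (obj i) b

namespace SmallModel

variable {B : DGCat.{u, u + 1} k}

/-- The small full DG-subcategory given by a small model; its inclusion is a quasi-equivalence. -/
def cat (S : SmallModel B) : DGCat.{u, u} k := B.full S.obj

/-- The inclusion of a small model. -/
def incl (S : SmallModel B) : DGFunctor S.cat B := DGFunctor.incl B S.obj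

/-- The enlargement of a small model `S` by the values of a DG-functor `P` on a small
DG-category. -/
def extend (S : SmallModel B) {X : DGCat.{u, u} k} (P : DGFunctor X B) : SmallModel B where
  ι := S.ι ⊕ X.Obj
  obj := Sum.elim S.obj P.obj
  essSurj b := (S.essSurj b).elim fun i hi => ⟨Sum.inl i, hi⟩

/-- The inclusion of `S` in its enlargement; this is a quasi-equivalence. -/
def toExtend (S : SmallModel B) {X : DGCat.{u, u} k} (P : DGFunctor X B) :
    S.cat ⟶ (S.extend P).cat where
  obj := Sum.inl
  map := LinearMap.id
  map_d _ _ := rfl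
  map_one _ := rfl
  map_comp _ _ _ := rfl

/-- The DG-functor `P`, with values in the enlargement of `S` by the values of `P`. -/
def lift (S : SmallModel B) {X : DGCat.{u, u} k} (P : DGFunctor X B) :
    X ⟶ (S.extend P).cat where
  obj := Sum.inr
  map := P.map
  map_d := P.map_d
  map_one := P.map_one
  map_comp := P.map_comp

end SmallModel

/-- Let `Φ` be a DG-functor from a small DG-category `X` to `A`-modules. A morphism
`φ : X ⟶ D_cf(A)` in `Hqe`, where `S` is the chosen small model of `D_cf(A)`, represents `Φ` if it
is the class of a DG-functor `P : X → D_cf(A)` that is a natural cofibrant replacement of `Φ`, i.e.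
comes with a closed natural transformation `P ⟶ Φ` of degree `0` consisting of quasi-isomorphisms.
For a cofibrant replacement DG-functor `Q` on `A`-modules, one can take `P = Q ∘ Φ`.
As `P` need not take values in `S`, its class in `Hqe` is formed through the quasi-equivalence from
`S` to the enlargement of `S` by the values of `P`. -/
def Represents {A X : DGCat.{u, u} k} (S : SmallModel A.derivedCf) (Φ : DGFunctor X A.modules)
    (φ : (toHqe k).obj X ⟶ (toHqe k).obj S.cat) : Prop :=
  ∃ (P : DGFunctor X A.derivedCf) (ε : (X.functors A.modules).Hom (P.comp A.derivedCfIncl) Φ 0),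
    (X.functors A.modules).IsClosed ε ∧ (∀ x, IsQuasiIso (ε.1 x)) ∧
    φ ≫ (toHqe k).map (S.toExtend P) = (toHqe k).map (S.lift P)

/-- The DG-functor `D_cf(B) → C(B) → C(A)` of restriction along `F : A → B`, on a small model of
`D_cf(B)`. -/
def resCf {A B : DGCat.{u, u} k} (F : A ⟶ B) (S : SmallModel B.derivedCf) :
    DGFunctor S.cat A.modules :=
  (S.incl.comp B.derivedCfIncl).comp (DGFunctor.res F (complexes k))

/-- The DG-functor `A → C(D_cf(A))`, `a ↦ (M ↦ M(a))`, on a small model of `D_cf(A)`. -/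
def evalCf (A : DGCat.{u, u} k) (S : SmallModel A.derivedCf) : DGFunctor A S.cat.modules :=
  (DGFunctor.eval A (complexes k)).comp
    (DGFunctor.res (S.incl.comp A.derivedCfIncl) (complexes k))

end DGCat

/-!
Write `D(A)` for the small model of `D_cf(A)`.

*Small models.* The cohomology of a cohomologically finite module at an object is
finite-dimensional, so it is the image of a set of cocycles indexed by sequences in `k`, a set that does not depend on
the module. All elements that are reached from these cocycles by the module operations, the
differential and the choice of primitives are values of formal terms. If the same equations between
terms hold in `M` and in `N`, the pairs of values of the same term form a module that is
quasi-isomorphic to both. The sets of equations form a small set, and quasi-isomorphic cofibrant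
modules are homotopy equivalent (`IsQuasiIso.isHtpyEquiv`), whence `nonempty_smallModel`.

*Cofibrant replacement.* Let `free M` be the direct sum of the `A(a, -) ⊗ M(a)`. Its counit to `M`
has a section `x ↦ 1 ⊗ x` by chain maps at every object, so that iterating the kernel of the counit
gives a functorial resolution of `M` that splits at every object. The total module `cofRep M` is a
DG-functor of `M`, it is quasi-isomorphic to `M` (`isQuasiIso_cofCounit`), and, since a trivial
fibration over a field has at every object a section with a contraction of the kernel, it is
cofibrant (`isCofibrant_cofRep`).

*Classes.* DG-functors related by a natural homotopy equivalence are equal in `Hqe`, by a path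
object (`toHqe_map_eq_of_htpyEquiv`). Hence every DG-functor `Φ` to modules with cohomologically finite
values has a class `qcls`, that of its cofibrant replacement; it is invariant under natural
quasi-isomorphisms, compatible with composition (`qcls_comp`, `qcls_comp_qcls`), and the only
morphism that represents `Φ` (`represents_iff`).

*The functor.* Restriction gives a functor `A ↦ D(A)` on `dgcat`. Along a quasi-equivalence
`F : A → B` restriction has, up to natural quasi-isomorphism, the inverse
`M ↦ Hom(Q Res B(b, -), M)` with `Q` the cofibrant replacement: this is the right adjoint of restriction, and since
`A(a, -) → Res B(F a, -)` is a quasi-isomorphism, the Yoneda lemma computes it at `F a`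
(`isIso_dcfMap`). So the functor factors through `Hqe`.

*The adjunction.* Let `Φ : X → C(A)` have cohomologically finite values, and let its transpose be
`a ↦ (x ↦ Φ(x)(a))`. The composition of `ev_A` with the image under `D` of the class of `Φ` is the
class of the transpose (`evCls_comp_dcfHom`). For `Φ` the restriction along a DG-functor this is the
naturality of `ev`; for `Φ` the evaluation, whose transpose is the inclusion of `D(A)`, it is the
triangle identity. Both triangle identities are the same statement.
-/

/-! ### Modules and their morphisms in terms of elements -/

namespace DGCat

open CochainComplex.HomComplex

variable {k : Type u} [CommRing k] {A : DGCat.{u, u} k}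

/-- The `k`-module of elements of degree `n` of the complex `M(a)`. -/
abbrev El (M : A.modules.Obj) (a : A.Obj) (n : ℤ) : Type u := (value M a).X n

/-- The differential of the complex `M(a)`; it is `0` unless `m + 1 = n`. -/
def dEl (M : A.modules.Obj) (a : A.Obj) (m n : ℤ) : El M a m →ₗ[k] El M a n :=
  ((value M a).d m n).hom

/-- The cochain `M(a) → M(b)` by which a morphism `a → b` of `A` acts on the module `M`. -/
def mapCochain (M : A.modules.Obj) {a b : A.Obj} {p : ℤ} (f : A.Hom a b p) :
    Cochain (value M a) (value M b) p := DGFunctor.map M f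

/-- The component at `a` of a graded natural transformation, as a cochain. -/
def valueCochain {M N : A.modules.Obj} {n : ℤ} (t : A.modules.Hom M N n) (a : A.Obj) :
    Cochain (value M a) (value N a) n := t.1 a

/-- The action of the morphisms of `A` on the elements of a left `A`-module. -/
def act (M : A.modules.Obj) {a b : A.Obj} {p q n : ℤ} (h : q + p = n) :
    A.Hom a b p →ₗ[k] El M a q →ₗ[k] El M b n :=
  LinearMap.mk₂ k (fun f x => ((mapCochain M f).v q n h).hom x)
    (fun f g x => by
      rw [show mapCochain M (f + g) = mapCochain M f + mapCochain M g from
        map_add (DGFunctor.map M) f g]; rfl)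
    (fun c f x => by
      rw [show mapCochain M (c • f) = c • mapCochain M f from
        map_smul (DGFunctor.map M) c f]; rfl)
    (fun f x y => map_add _ _ _) (fun c f x => map_smul _ _ _)

/-- The effect of a graded natural transformation on elements. -/
def app {M N : A.modules.Obj} {n : ℤ} (t : A.modules.Hom M N n) (a : A.Obj) {p q : ℤ}
    (h : p + n = q) : El M a p →ₗ[k] El N a q :=
  ((valueCochain t a).v p q h).hom

section

variable (M : A.modules.Obj) {N L : A.modules.Obj}

lemma mapCochain_one (a : A.Obj) : mapCochain M (A.one a) = Cochain.ofHom (𝟙 _) :=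
  DGFunctor.map_one M a

lemma mapCochain_comp {a b c : A.Obj} {p q n : ℤ} (h : p + q = n) (f : A.Hom a b p)
    (g : A.Hom b c q) :
    mapCochain M (A.comp h f g) = (mapCochain M f).comp (mapCochain M g) h :=
  DGFunctor.map_comp M h f g

lemma mapCochain_d {a b : A.Obj} {m n : ℤ} (h : m + 1 = n) (f : A.Hom a b m) :
    mapCochain M (A.d h f) = δ m n (mapCochain M f) :=
  DGFunctor.map_d M h f

variable {M}

lemma valueCochain_comp {m n l : ℤ} (h : m + n = l) (s : A.modules.Hom M N m)
    (t : A.modules.Hom N L n) (a : A.Obj) :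
    valueCochain (A.modules.comp h s t) a = (valueCochain s a).comp (valueCochain t a) h :=
  rfl

lemma valueCochain_d {m n : ℤ} (h : m + 1 = n) (t : A.modules.Hom M N m) (a : A.Obj) :
    valueCochain (A.modules.d h t) a = δ m n (valueCochain t a) :=
  rfl

lemma mapCochain_comp_valueCochain {n p m : ℤ} (t : A.modules.Hom M N n) {a b : A.Obj}
    (h : p + n = m) (h' : n + p = m) (f : A.Hom a b p) :
    (mapCochain M f).comp (valueCochain t b) h =
      (p * n).negOnePow • (valueCochain t a).comp (mapCochain N f) h' :=
  t.2 h h' f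

end

variable (M : A.modules.Obj) {N L : A.modules.Obj}

lemma dEl_dEl (a : A.Obj) (l m n : ℤ) (x : El M a l) : dEl M a m n (dEl M a l m x) = 0 := by
  rw [dEl, dEl, ← LinearMap.comp_apply, ← ModuleCat.hom_comp, (value M a).d_comp_d l m n]
  rfl

lemma act_one {a : A.Obj} {n : ℤ} (x : El M a n) : act M (add_zero n) (A.one a) x = x := by
  change ((mapCochain M (A.one a)).v n n _).hom x = x
  rw [mapCochain_one]
  simp

lemma act_comp {a b c : A.Obj} {p q r l m n : ℤ} (h : p + q = l) (h₁ : r + l = n)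
    (h₂ : r + p = m) (h₃ : m + q = n) (f : A.Hom a b p) (g : A.Hom b c q) (x : El M a r) :
    act M h₁ (A.comp h f g) x = act M h₃ g (act M h₂ f x) := by
  change ((mapCochain M (A.comp h f g)).v r n _).hom x = _
  rw [mapCochain_comp, Cochain.comp_v _ _ _ _ _ _ h₂ h₃]
  rfl

lemma negOnePow_smul_hom {k : Type u} [CommRing k] {X Y : ModuleCat.{u} k} (n : ℤˣ)
    (f : X ⟶ Y) (x : X) : (n • f).hom x = n • f.hom x := by
  obtain rfl | rfl := Int.units_eq_one_or n <;> simp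

/-- The Leibniz rule for the action. -/
lemma dEl_act {a b : A.Obj} {p q n p' q' n' : ℤ} (h : q + p = n) (hp : p + 1 = p')
    (hq : q + 1 = q') (hn : n + 1 = n') (f : A.Hom a b p) (x : El M a q) :
    dEl M b n n' (act M h f x) = act M (by omega) (A.d hp f) x +
      p.negOnePow • act M (by omega : q' + p = n') f (dEl M a q q' x) := by
  have e : act M (by omega : q + p' = n') (A.d hp f) x = dEl M b n n' (act M h f x) +
      p'.negOnePow • act M (by omega : q' + p = n') f (dEl M a q q' x) := by
    change ((mapCochain M (A.d hp f)).v q n' _).hom x = _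
    rw [mapCochain_d, δ_v p p' hp _ q n' _ n q' (by omega) hq]
    rw [ModuleCat.hom_add, LinearMap.add_apply, negOnePow_smul_hom]
    rfl
  subst hp
  rw [e, Int.negOnePow_succ]
  simp

variable {M}

@[simp] lemma app_zero {n : ℤ} (a : A.Obj) {p q : ℤ} (h : p + n = q) (x : El M a p) :
    app (0 : A.modules.Hom M N n) a h x = 0 := rfl

@[simp] lemma app_add {n : ℤ} (s t : A.modules.Hom M N n) (a : A.Obj) {p q : ℤ} (h : p + n = q)
    (x : El M a p) : app (s + t) a h x = app s a h x + app t a h x := rfl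

@[simp] lemma app_sub {n : ℤ} (s t : A.modules.Hom M N n) (a : A.Obj) {p q : ℤ} (h : p + n = q)
    (x : El M a p) : app (s - t) a h x = app s a h x - app t a h x := rfl

@[simp] lemma app_neg {n : ℤ} (s : A.modules.Hom M N n) (a : A.Obj) {p q : ℤ} (h : p + n = q)
    (x : El M a p) : app (-s) a h x = -app s a h x := rfl

@[simp] lemma app_smul {n : ℤ} (c : k) (t : A.modules.Hom M N n) (a : A.Obj) {p q : ℤ}
    (h : p + n = q) (x : El M a p) : app (c • t) a h x = c • app t a h x := rfl

@[simp] lemma app_units_smul {n : ℤ} (c : ℤˣ) (t : A.modules.Hom M N n) (a : A.Obj) {p q : ℤ}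
    (h : p + n = q) (x : El M a p) : app (c • t) a h x = c • app t a h x := by
  obtain rfl | rfl := Int.units_eq_one_or c <;> simp

@[simp] lemma app_one (a : A.Obj) {p : ℤ} (h : p + 0 = p) (x : El M a p) :
    app (A.modules.one M) a h x = x := by
  change ((Cochain.ofHom (𝟙 (value M a))).v p p _).hom x = x
  simp

@[simp] lemma app_comp {m n l : ℤ} (h : m + n = l) (s : A.modules.Hom M N m)
    (t : A.modules.Hom N L n) (a : A.Obj) {p q r : ℤ} (h₁ : p + l = q) (h₂ : p + m = r)
    (x : El M a p) :
    app (A.modules.comp h s t) a h₁ x = app t a (by omega : r + n = q) (app s a h₂ x) := by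
  change ((valueCochain (A.modules.comp h s t) a).v p q _).hom x = _
  rw [valueCochain_comp, Cochain.comp_v _ _ _ _ _ _ h₂ (by omega)]
  rfl

lemma app_d {m n : ℤ} (h : m + 1 = n) (t : A.modules.Hom M N m) (a : A.Obj) {p q p' q' : ℤ}
    (h₁ : p + n = q') (hp : p + 1 = p') (hq : p + m = q) (x : El M a p) :
    app (A.modules.d h t) a h₁ x = dEl N a q q' (app t a hq x) -
      m.negOnePow • app t a (by omega : p' + m = q') (dEl M a p p' x) := by
  change ((valueCochain (A.modules.d h t) a).v p q' _).hom x = _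
  rw [valueCochain_d, δ_v m n h _ p q' _ q p' (by omega) hp]
  rw [ModuleCat.hom_add, LinearMap.add_apply, negOnePow_smul_hom]
  subst h
  rw [Int.negOnePow_succ, Units.neg_smul, ← sub_eq_add_neg]
  rfl

lemma app_act {n : ℤ} (t : A.modules.Hom M N n) {a b : A.Obj} {p q r s l : ℤ} (h₁ : q + p = r)
    (h₂ : r + n = s) (h₃ : q + n = l) (f : A.Hom a b p) (x : El M a q) :
    app t b h₂ (act M h₁ f x) = (p * n).negOnePow • act N (by omega : l + p = s) f (app t a h₃ x) := by
  have := Cochain.congr_v (mapCochain_comp_valueCochain t rfl (add_comm n p) f) q s (by omega)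
  rw [Cochain.comp_v _ _ _ _ _ _ h₁ h₂, Cochain.units_smul_v,
    Cochain.comp_v _ _ _ _ _ _ h₃ (by omega : l + p = s)] at this
  have e := congrArg (fun g => ModuleCat.Hom.hom g x) this
  simp only [negOnePow_smul_hom] at e
  exact e

lemma hom_ext {n : ℤ} {s t : A.modules.Hom M N n}
    (h : ∀ a p q (h : p + n = q) (x : El M a p), app s a h x = app t a h x) : s = t := by
  apply Subtype.ext
  funext a
  apply Cochain.ext
  intro p q hpq
  ext x
  exact h a p q hpq x

/-- A graded natural transformation from its values on elements. -/
def mkHom {n : ℤ} (t : ∀ (a : A.Obj) (p q : ℤ), p + n = q → (El M a p →ₗ[k] El N a q))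
    (ht : ∀ {a b : A.Obj} {p q r s l : ℤ} (h₁ : q + p = r) (h₂ : r + n = s) (h₃ : q + n = l)
      (h₄ : l + p = s) (f : A.Hom a b p) (x : El M a q),
      t b r s h₂ (act M h₁ f x) = (p * n).negOnePow • act N h₄ f (t a q l h₃ x)) :
    A.modules.Hom M N n :=
  ⟨fun a => (Cochain.mk fun p q h => ModuleCat.ofHom (t a p q h) :
      Cochain (value M a) (value N a) n), by
    intro a b p m h h' f
    refine Cochain.ext (F := value M a) (G := value N b) _ _ fun q s hq => ?_
    ext x
    change (((mapCochain M f).comp (Cochain.mk fun p q h => ModuleCat.ofHom (t b p q h)) h).v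
      q s _).hom x = (((p * n).negOnePow •
        (Cochain.mk fun p q h => ModuleCat.ofHom (t a p q h)).comp (mapCochain N f) h').v
      q s _).hom x
    rw [Cochain.comp_v _ _ _ _ (q + p) _ rfl (by omega), Cochain.units_smul_v, negOnePow_smul_hom,
      Cochain.comp_v _ _ _ _ (q + n) _ rfl (by omega)]
    exact ht rfl (by omega) rfl (by omega) f x⟩

lemma isClosed_iff {t : A.modules.Hom M N 0} :
    A.modules.IsClosed t ↔ ∀ a p (x : El M a p),
      dEl N a p (p + 1) (app t a (add_zero p) x) =
        app t a (add_zero (p + 1)) (dEl M a p (p + 1) x) := by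
  constructor
  · intro h a p x
    have := app_d (zero_add 1) t a rfl rfl (add_zero p) x
    rw [show A.modules.d (zero_add 1) t = 0 from h] at this
    rw [app_zero, Int.negOnePow_zero, one_smul] at this
    exact sub_eq_zero.1 this.symm
  · intro h
    refine hom_ext fun a p q hpq x => ?_
    subst hpq
    rw [app_d (zero_add 1) t a rfl rfl (add_zero p) x, h]
    simp

/-- The data of a left `A`-module in terms of elements. The equations between degrees are arguments
of the operations, so that no transport along them is needed. -/
structure ModData (A : DGCat.{u, u} k) where
  X : A.Obj → ℤ → Type u
  [addCommGroup : ∀ a n, AddCommGroup (X a n)]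
  [module : ∀ a n, Module k (X a n)]
  d : ∀ (a : A.Obj) {m n : ℤ}, m + 1 = n → X a m →ₗ[k] X a n
  d_d : ∀ (a : A.Obj) {l m n : ℤ} (h : l + 1 = m) (h' : m + 1 = n) (x : X a l),
    d a h' (d a h x) = 0
  act : ∀ {a b : A.Obj} {p q n : ℤ}, q + p = n → A.Hom a b p →ₗ[k] X a q →ₗ[k] X b n
  act_one : ∀ {a : A.Obj} {n : ℤ} (x : X a n), act (add_zero n) (A.one a) x = x
  act_comp : ∀ {a b c : A.Obj} {p q r l m n : ℤ} (h : p + q = l) (h₁ : r + l = n)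
    (h₂ : r + p = m) (h₃ : m + q = n) (f : A.Hom a b p) (g : A.Hom b c q) (x : X a r),
    act h₁ (A.comp h f g) x = act h₃ g (act h₂ f x)
  d_act : ∀ {a b : A.Obj} {p q n p' q' n' : ℤ} (h : q + p = n) (hp : p + 1 = p')
    (hq : q + 1 = q') (hn : n + 1 = n') (h₁ : q + p' = n') (h₂ : q' + p = n')
    (f : A.Hom a b p) (x : X a q),
    d b hn (act h f x) = act h₁ (A.d hp f) x + p.negOnePow • act h₂ f (d a hq x)

attribute [instance] ModData.addCommGroup ModData.module

namespace ModData

variable (D : ModData A)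

/-- The complex of a module given by its elements. -/
def complex (a : A.Obj) : CochainComplex (ModuleCat.{u} k) ℤ where
  X n := ModuleCat.of k (D.X a n)
  d m n := if h : m + 1 = n then ModuleCat.ofHom (D.d a h) else 0
  shape m n h := dif_neg h
  d_comp_d' l m n h h' := by
    obtain rfl : l + 1 = m := h
    obtain rfl : l + 1 + 1 = n := h'
    ext x
    simpa using D.d_d a rfl rfl x

lemma complex_d_apply (a : A.Obj) {m n : ℤ} (h : m + 1 = n) (x : D.X a m) :
    ((D.complex a).d m n).hom x = D.d a h x := by
  have : (D.complex a).d m n = ModuleCat.ofHom (D.d a h) := dif_pos h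
  rw [this]
  rfl

/-- The cochains by which the morphisms of `A` act. -/
def mapL {a b : A.Obj} {n : ℤ} : A.Hom a b n →ₗ[k] Cochain (D.complex a) (D.complex b) n where
  toFun f := Cochain.mk fun p q h => ModuleCat.ofHom (D.act h f)
  map_add' f g := by
    ext p q h x
    exact congrArg (fun l => l x) (map_add (D.act h) f g)
  map_smul' c f := by
    ext p q h x
    exact congrArg (fun l => l x) (map_smul (D.act h) c f)

lemma mapL_d {a b : A.Obj} {m n : ℤ} (h : m + 1 = n) (f : A.Hom a b m) :
    D.mapL (A.d h f) = δ m n (D.mapL f) := by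
  ext p q hpq x
  rw [δ_v m n h _ p q _ (p + m) (p + 1) (by omega) rfl]
  rw [ModuleCat.hom_add, LinearMap.add_apply, negOnePow_smul_hom]
  have e₁ := D.complex_d_apply b (by omega : p + m + 1 = q) (D.act rfl f x)
  have e₂ := D.complex_d_apply a (rfl : p + 1 = _) x
  have e₃ : ∀ x : D.X a p, D.act hpq (A.d h f) x = D.d b (by omega : p + m + 1 = q) (D.act rfl f x)
      + n.negOnePow • D.act (by omega : p + 1 + m = q) f (D.d a rfl x) := by
    intro x
    rw [D.d_act rfl h rfl (by omega) hpq (by omega)]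
    subst h
    rw [Int.negOnePow_succ]
    simp
  exact (e₃ x).trans (congrArg₂ (fun (y : D.X b q) (z : D.X a (p + 1)) =>
    y + n.negOnePow • D.act (by omega : p + 1 + m = q) f z) e₁ e₂).symm

lemma mapL_one (a : A.Obj) : D.mapL (A.one a) = Cochain.ofHom (𝟙 _) := by
  ext p x
  rw [Cochain.ofHom_v]
  exact D.act_one x

lemma mapL_comp {a b c : A.Obj} {p q n : ℤ} (h : p + q = n) (f : A.Hom a b p) (g : A.Hom b c q) :
    D.mapL (A.comp h f g) = (D.mapL f).comp (D.mapL g) h := by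
  ext r s hrs x
  rw [Cochain.comp_v _ _ _ _ _ _ rfl (by omega)]
  exact D.act_comp h hrs rfl (by omega) f g x

/-- The module with given elements. -/
def toModule : A.modules.Obj :=
  { obj := D.complex
    map := D.mapL
    map_d := D.mapL_d
    map_one := D.mapL_one
    map_comp := D.mapL_comp : DGFunctor A (complexes k) }

/-- The elements of the module `D.toModule`. -/
def el {a : A.Obj} {n : ℤ} : D.X a n ≃ₗ[k] El D.toModule a n := LinearEquiv.refl k (D.X a n)

lemma dEl_el {a : A.Obj} {m n : ℤ} (h : m + 1 = n) (x : D.X a m) :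
    dEl D.toModule a m n (D.el x) = D.el (D.d a h x) :=
  D.complex_d_apply a h x

lemma act_el {a b : A.Obj} {p q n : ℤ} (h : q + p = n) (f : A.Hom a b p) (x : D.X a q) :
    DGCat.act D.toModule h f (D.el x) = D.el (D.act h f x) := rfl

variable {D} {N : A.modules.Obj}

/-- A graded natural transformation out of `D.toModule`, from its values on elements. -/
def desc {n : ℤ} (t : ∀ (a : A.Obj) (p q : ℤ), p + n = q → (D.X a p →ₗ[k] El N a q))
    (ht : ∀ {a b : A.Obj} {p q r s l : ℤ} (h₁ : q + p = r) (h₂ : r + n = s) (h₃ : q + n = l)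
      (h₄ : l + p = s) (f : A.Hom a b p) (x : D.X a q),
      t b r s h₂ (D.act h₁ f x) = (p * n).negOnePow • DGCat.act N h₄ f (t a q l h₃ x)) :
    A.modules.Hom D.toModule N n :=
  mkHom (M := D.toModule) t ht

/-- A graded natural transformation to `D.toModule`, from its values on elements. -/
def lift {n : ℤ} (t : ∀ (a : A.Obj) (p q : ℤ), p + n = q → (El N a p →ₗ[k] D.X a q))
    (ht : ∀ {a b : A.Obj} {p q r s l : ℤ} (h₁ : q + p = r) (h₂ : r + n = s) (h₃ : q + n = l)
      (h₄ : l + p = s) (f : A.Hom a b p) (x : El N a q),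
      t b r s h₂ (DGCat.act N h₁ f x) = (p * n).negOnePow • D.act h₄ f (t a q l h₃ x)) :
    A.modules.Hom N D.toModule n :=
  mkHom (N := D.toModule) t ht

lemma exists_el {a : A.Obj} {n : ℤ} (x : El D.toModule a n) : ∃ y : D.X a n, D.el y = x :=
  ⟨x, rfl⟩

end ModData

end DGCat

/-! ### Cohomology in terms of elements -/

section Cohomology

variable {k : Type u} [CommRing k] {K L : CochainComplex (ModuleCat.{u} k) ℤ}

/-- The element `z` of the cohomology of `K` is the class of the cocycle `x`. -/
def IsClass (K : CochainComplex (ModuleCat.{u} k) ℤ) (n : ℤ) (x : K.X n) (z : K.homology n) :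
    Prop :=
  ∃ c : K.cycles n, (K.iCycles n).hom c = x ∧ (K.homologyπ n).hom c = z

namespace IsClass

lemma exists_cocycle (n : ℤ) (z : K.homology n) : ∃ x, IsClass K n x z := by
  obtain ⟨c, rfl⟩ := (ModuleCat.epi_iff_surjective (K.homologyπ n)).1 inferInstance z
  exact ⟨_, c, rfl, rfl⟩

lemma exists_class {n : ℤ} {x : K.X n} (hx : (K.d n (n + 1)).hom x = 0) :
    ∃ z, IsClass K n x z := by
  let φ : ModuleCat.of k k ⟶ K.X n := ModuleCat.ofHom (LinearMap.toSpanSingleton k _ x)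
  have hφ : φ ≫ K.d n (n + 1) = 0 := by
    ext
    simpa [φ] using hx
  refine ⟨_, (K.liftCycles φ (n + 1) (by simp) hφ).hom (1 : k), ?_, rfl⟩
  have := congrArg (fun g => ModuleCat.Hom.hom g (1 : k)) (K.liftCycles_i φ (n + 1) (by simp) hφ)
  exact this.trans (one_smul k x)

lemma d_eq_zero {n : ℤ} {x : K.X n} {z : K.homology n} (h : IsClass K n x z) (m : ℤ) :
    (K.d n m).hom x = 0 := by
  obtain ⟨c, rfl, rfl⟩ := h
  rw [← LinearMap.comp_apply, ← ModuleCat.hom_comp, K.iCycles_d]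
  rfl

lemma eq_zero_iff {m n : ℤ} (hm : m + 1 = n) {x : K.X n} {z : K.homology n}
    (h : IsClass K n x z) : z = 0 ↔ ∃ y : K.X m, (K.d m n).hom y = x := by
  obtain ⟨c, rfl, rfl⟩ := h
  have e : (K.homologyι n).hom ((K.homologyπ n).hom c) = (K.pOpcycles n).hom ((K.iCycles n).hom c) := by
    rw [← LinearMap.comp_apply, ← LinearMap.comp_apply, ← ModuleCat.hom_comp,
      ← ModuleCat.hom_comp, K.homology_π_ι]
  have inj := (ModuleCat.mono_iff_injective (K.homologyι n)).1 inferInstance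
  have e₁ : (K.homologyπ n).hom c = 0 ↔ (K.pOpcycles n).hom ((K.iCycles n).hom c) = 0 := by
    rw [← e]
    exact ⟨fun h => by rw [h, map_zero], fun h => inj (by rw [map_zero]; exact h)⟩
  obtain rfl : (ComplexShape.up ℤ).prev n = m := by simp; omega
  rw [e₁]
  exact (K.sc n).moduleCat_pOpcycles_eq_zero_iff _

lemma map (f : K ⟶ L) {n : ℤ} {x : K.X n} {z : K.homology n} (h : IsClass K n x z) :
    IsClass L n ((f.f n).hom x) ((HomologicalComplex.homologyMap f n).hom z) := by
  obtain ⟨c, rfl, rfl⟩ := h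
  refine ⟨(HomologicalComplex.cyclesMap f n).hom c, ?_, ?_⟩
  · rw [← LinearMap.comp_apply, ← LinearMap.comp_apply, ← ModuleCat.hom_comp,
      ← ModuleCat.hom_comp, HomologicalComplex.cyclesMap_i]
  · rw [← LinearMap.comp_apply, ← LinearMap.comp_apply, ← ModuleCat.hom_comp,
      ← ModuleCat.hom_comp, HomologicalComplex.homologyπ_naturality]

lemma sub {n : ℤ} {x y : K.X n} {z t : K.homology n} (h : IsClass K n x z)
    (h' : IsClass K n y t) : IsClass K n (x - y) (z - t) := by
  obtain ⟨c, rfl, rfl⟩ := h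
  obtain ⟨c', rfl, rfl⟩ := h'
  exact ⟨c - c', map_sub _ _ _, map_sub _ _ _⟩

end IsClass

lemma homologyMap_injective_iff (f : K ⟶ L) {m n : ℤ} (hm : m + 1 = n) :
    Function.Injective (HomologicalComplex.homologyMap f n).hom ↔
      ∀ x : K.X n, (K.d n (n + 1)).hom x = 0 → (∃ y : L.X m, (L.d m n).hom y = (f.f n).hom x) →
        ∃ x' : K.X m, (K.d m n).hom x' = x := by
  rw [injective_iff_map_eq_zero]
  constructor
  · intro H x hx hy
    obtain ⟨z, hz⟩ := IsClass.exists_class hx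
    exact (hz.eq_zero_iff hm).1 (H z (((hz.map f).eq_zero_iff hm).2 hy))
  · intro H z hz
    obtain ⟨x, hx⟩ := IsClass.exists_cocycle n z
    exact (hx.eq_zero_iff hm).2 (H x (hx.d_eq_zero _) (((hx.map f).eq_zero_iff hm).1 hz))

lemma homologyMap_surjective_iff (f : K ⟶ L) {m n : ℤ} (hm : m + 1 = n) :
    Function.Surjective (HomologicalComplex.homologyMap f n).hom ↔
      ∀ y : L.X n, (L.d n (n + 1)).hom y = 0 →
        ∃ x : K.X n, (K.d n (n + 1)).hom x = 0 ∧
          ∃ y' : L.X m, (L.d m n).hom y' = (f.f n).hom x - y := by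
  constructor
  · intro H y hy
    obtain ⟨z, hz⟩ := IsClass.exists_class hy
    obtain ⟨t, rfl⟩ := H z
    obtain ⟨x, hx⟩ := IsClass.exists_cocycle n t
    exact ⟨x, hx.d_eq_zero _, (((hx.map f).sub hz).eq_zero_iff hm).1 (sub_self _)⟩
  · intro H z
    obtain ⟨y, hy⟩ := IsClass.exists_cocycle n z
    obtain ⟨x, hx, e⟩ := H y (hy.d_eq_zero _)
    obtain ⟨t, ht⟩ := IsClass.exists_class hx
    exact ⟨t, sub_eq_zero.1 ((((ht.map f).sub hy).eq_zero_iff hm).2 e)⟩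

lemma quasiIso_iff_elements (f : K ⟶ L) :
    QuasiIso f ↔ ∀ n, Function.Injective (HomologicalComplex.homologyMap f n).hom ∧
      Function.Surjective (HomologicalComplex.homologyMap f n).hom := by
  rw [quasiIso_iff]
  refine forall_congr' fun n => ?_
  rw [quasiIsoAt_iff_isIso_homologyMap, ConcreteCategory.isIso_iff_bijective]
  rfl

lemma finite_homology_of_surjective (f : K ⟶ L)
    (hf : ∀ n, Function.Surjective (HomologicalComplex.homologyMap f n).hom)
    (hK : Module.Finite k (DirectSum ℤ fun n => K.homology n)) :
    Module.Finite k (DirectSum ℤ fun n => L.homology n) := by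
  refine Module.Finite.of_surjective
    (DirectSum.lmap fun n => (HomologicalComplex.homologyMap f n).hom) ?_
  rw [DirectSum.lmap_surjective]
  exact hf

lemma finite_homology_of_quasiIso (f : K ⟶ L) [QuasiIso f]
    (hL : Module.Finite k (DirectSum ℤ fun n => L.homology n)) :
    Module.Finite k (DirectSum ℤ fun n => K.homology n) := by
  refine Module.Finite.of_surjective
    (DirectSum.lmap fun n => (inv (HomologicalComplex.homologyMap f n)).hom) ?_
  rw [DirectSum.lmap_surjective]
  intro n
  exact (ModuleCat.epi_iff_surjective _).1 inferInstance

lemma finite_homology_apply (hK : Module.Finite k (DirectSum ℤ fun n => K.homology n)) (n : ℤ) :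
    Module.Finite k (K.homology n) :=
  Module.Finite.of_surjective (DirectSum.component k ℤ (fun n => K.homology n) n)
    fun x => ⟨DirectSum.lof k ℤ _ n x, by simp [DirectSum.component.lof_self]⟩

end Cohomology

namespace DGCat

variable {k : Type u} [CommRing k] {A : DGCat.{u, u} k} {M N L : A.modules.Obj}

/-- The closed morphism `t` is injective on the cohomology at `a`. -/
def CohInjAt (t : A.modules.Hom M N 0) (a : A.Obj) : Prop :=
  ∀ ⦃m n : ℤ⦄ (_ : m + 1 = n) (x : El M a n), dEl M a n (n + 1) x = 0 →
    (∃ y : El N a m, dEl N a m n y = app t a (add_zero n) x) → ∃ x' : El M a m, dEl M a m n x' = x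

/-- The closed morphism `t` is surjective on the cohomology at `a`. -/
def CohSurjAt (t : A.modules.Hom M N 0) (a : A.Obj) : Prop :=
  ∀ ⦃m n : ℤ⦄ (_ : m + 1 = n) (y : El N a n), dEl N a n (n + 1) y = 0 →
    ∃ x : El M a n, dEl M a n (n + 1) x = 0 ∧
      ∃ y' : El N a m, dEl N a m n y' = app t a (add_zero n) x - y

lemma cohInjAt_iff {t : A.modules.Hom M N 0} (ht : A.modules.IsClosed t) (a : A.Obj) :
    CohInjAt t a ↔ ∀ n,
      Function.Injective (HomologicalComplex.homologyMap (valueMap t ht a) n).hom :=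
  ⟨fun h n => (homologyMap_injective_iff _ (sub_add_cancel n 1)).2 (h (sub_add_cancel n 1)),
    fun h _ n hm => (homologyMap_injective_iff _ hm).1 (h n)⟩

lemma cohSurjAt_iff {t : A.modules.Hom M N 0} (ht : A.modules.IsClosed t) (a : A.Obj) :
    CohSurjAt t a ↔ ∀ n,
      Function.Surjective (HomologicalComplex.homologyMap (valueMap t ht a) n).hom :=
  ⟨fun h n => (homologyMap_surjective_iff _ (sub_add_cancel n 1)).2 (h (sub_add_cancel n 1)),
    fun h _ n hm => (homologyMap_surjective_iff _ hm).1 (h n)⟩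

/-- The closed morphism `t` is bijective on the cohomology at `a`. -/
def QIsoAt (t : A.modules.Hom M N 0) (a : A.Obj) : Prop := CohInjAt t a ∧ CohSurjAt t a

lemma quasiIso_valueMap_iff {t : A.modules.Hom M N 0} (ht : A.modules.IsClosed t) (a : A.Obj) :
    QuasiIso (valueMap t ht a) ↔ QIsoAt t a := by
  rw [QIsoAt, quasiIso_iff_elements, cohInjAt_iff ht, cohSurjAt_iff ht, forall_and]

lemma isQuasiIso_iff {t : A.modules.Hom M N 0} :
    IsQuasiIso t ↔ A.modules.IsClosed t ∧ ∀ a, QIsoAt t a :=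
  ⟨fun ⟨ht, h⟩ => ⟨ht, fun a => (quasiIso_valueMap_iff ht a).1 (h a)⟩,
    fun ⟨ht, h⟩ => ⟨ht, fun a => (quasiIso_valueMap_iff ht a).2 (h a)⟩⟩

lemma isTrivialFibration_iff {t : A.modules.Hom M N 0} :
    IsTrivialFibration t ↔ IsQuasiIso t ∧
      ∀ a n, Function.Surjective (app t a (add_zero n)) :=
  ⟨fun ⟨ht, h, h'⟩ => ⟨⟨ht, h⟩, h'⟩, fun ⟨⟨ht, h⟩, h'⟩ => ⟨ht, h, h'⟩⟩

lemma IsClosed.comp {B : DGCat.{v, w} k} {x y z : B.Obj} {s : B.Hom x y 0} {t : B.Hom y z 0}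
    (hs : B.IsClosed s) (ht : B.IsClosed t) : B.IsClosed (B.comp (add_zero 0) s t) := by
  rw [IsClosed, B.d_comp (add_zero 0) (zero_add 1) (zero_add 1) (zero_add 1) (zero_add 1)
    (add_zero 1), show B.d (zero_add 1) s = 0 from hs, show B.d (zero_add 1) t = 0 from ht]
  simp

lemma isClosed_one (B : DGCat.{v, w} k) (x : B.Obj) : B.IsClosed (B.one x) := by
  have := B.d_comp (add_zero 0) (zero_add 1) (zero_add 1) (zero_add 1) (zero_add 1)
    (add_zero 1) (B.one x) (B.one x)
  rw [B.comp_one, B.one_comp, B.comp_one] at this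
  rw [IsClosed]; simpa using this

lemma valueMap_comp {s : A.modules.Hom M N 0} {t : A.modules.Hom N L 0}
    (hs : A.modules.IsClosed s) (ht : A.modules.IsClosed t) (a : A.Obj) :
    valueMap (A.modules.comp (add_zero 0) s t) (hs.comp ht) a =
      valueMap s hs a ≫ valueMap t ht a := by
  ext n x
  change app (A.modules.comp (add_zero 0) s t) a (add_zero n) x = _
  rw [app_comp (add_zero 0) s t a (add_zero n) (add_zero n)]
  rfl

lemma QIsoAt.comp {s : A.modules.Hom M N 0} {t : A.modules.Hom N L 0}
    (hs : A.modules.IsClosed s) (ht : A.modules.IsClosed t) {a : A.Obj} (h : QIsoAt s a)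
    (h' : QIsoAt t a) : QIsoAt (A.modules.comp (add_zero 0) s t) a := by
  rw [← quasiIso_valueMap_iff (hs.comp ht), valueMap_comp hs ht]
  have := (quasiIso_valueMap_iff hs a).2 h
  have := (quasiIso_valueMap_iff ht a).2 h'
  infer_instance

lemma QIsoAt.of_comp_left {s : A.modules.Hom M N 0} {t : A.modules.Hom N L 0}
    (hs : A.modules.IsClosed s) (ht : A.modules.IsClosed t) {a : A.Obj} (h : QIsoAt s a)
    (h' : QIsoAt (A.modules.comp (add_zero 0) s t) a) : QIsoAt t a := by
  rw [← quasiIso_valueMap_iff ht]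
  rw [← quasiIso_valueMap_iff (hs.comp ht), valueMap_comp hs ht] at h'
  have := (quasiIso_valueMap_iff hs a).2 h
  exact quasiIso_of_comp_left (valueMap s hs a) (valueMap t ht a)

lemma QIsoAt.of_comp_right {s : A.modules.Hom M N 0} {t : A.modules.Hom N L 0}
    (hs : A.modules.IsClosed s) (ht : A.modules.IsClosed t) {a : A.Obj} (h : QIsoAt t a)
    (h' : QIsoAt (A.modules.comp (add_zero 0) s t) a) : QIsoAt s a := by
  rw [← quasiIso_valueMap_iff hs]
  rw [← quasiIso_valueMap_iff (hs.comp ht), valueMap_comp hs ht] at h'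
  have := (quasiIso_valueMap_iff ht a).2 h
  exact quasiIso_of_comp_right (valueMap s hs a) (valueMap t ht a)

lemma IsQuasiIso.comp {s : A.modules.Hom M N 0} {t : A.modules.Hom N L 0} (hs : IsQuasiIso s)
    (ht : IsQuasiIso t) : IsQuasiIso (A.modules.comp (add_zero 0) s t) := by
  rw [isQuasiIso_iff] at *
  exact ⟨hs.1.comp ht.1, fun a => (hs.2 a).comp hs.1 ht.1 (ht.2 a)⟩

lemma IsQuasiIso.of_comp_left {s : A.modules.Hom M N 0} {t : A.modules.Hom N L 0}
    (hs : IsQuasiIso s) (ht : A.modules.IsClosed t)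
    (h : IsQuasiIso (A.modules.comp (add_zero 0) s t)) : IsQuasiIso t := by
  rw [isQuasiIso_iff] at *
  exact ⟨ht, fun a => (hs.2 a).of_comp_left hs.1 ht (h.2 a)⟩

lemma IsQuasiIso.of_comp_right {s : A.modules.Hom M N 0} {t : A.modules.Hom N L 0}
    (hs : A.modules.IsClosed s) (ht : IsQuasiIso t)
    (h : IsQuasiIso (A.modules.comp (add_zero 0) s t)) : IsQuasiIso s := by
  rw [isQuasiIso_iff] at *
  exact ⟨hs, fun a => (ht.2 a).of_comp_right hs ht.1 (h.2 a)⟩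

lemma IsQuasiIso.isCohFinite_source {t : A.modules.Hom M N 0} (ht : IsQuasiIso t)
    (hN : IsCohFinite N) : IsCohFinite M := fun a => by
  obtain ⟨h, h'⟩ := ht
  have := h' a
  exact finite_homology_of_quasiIso (valueMap t h a) (hN a)

lemma IsQuasiIso.isCohFinite_target {t : A.modules.Hom M N 0} (ht : IsQuasiIso t)
    (hM : IsCohFinite M) : IsCohFinite N := fun a => by
  rw [isQuasiIso_iff] at ht
  exact finite_homology_of_surjective (valueMap t ht.1 a)
    ((cohSurjAt_iff ht.1 a).1 (ht.2 a).2) (hM a)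

/-- A morphism homotopic to a quasi-isomorphism is a quasi-isomorphism. -/
lemma IsQuasiIso.of_htpy {s t : A.modules.Hom M N 0} (hs : IsQuasiIso s)
    (h : A.modules.Hom M N (-1)) (e : t - s = A.modules.d (neg_add_cancel 1) h) :
    IsQuasiIso t := by
  rw [isQuasiIso_iff] at *
  have ht : A.modules.IsClosed t := by
    rw [← sub_add_cancel t s, e, IsClosed, map_add, A.modules.d_d,
      show A.modules.d (zero_add 1) s = 0 from hs.1, add_zero]
  -- on a cocycle, the two morphisms differ by a coboundary
  have key : ∀ (a : A.Obj) (m n : ℤ) (hm : m + 1 = n) (x : El M a n), dEl M a n (n + 1) x = 0 →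
      ∃ y : El N a m, dEl N a m n y = app t a (add_zero n) x - app s a (add_zero n) x := by
    intro a m n hm x hx
    refine ⟨app h a (by omega) x, ?_⟩
    rw [← app_sub, e, app_d (neg_add_cancel 1) h a (add_zero n) rfl (by omega : n + -1 = m) x, hx]
    simp
  refine ⟨ht, fun a => ⟨fun m n hm x hx hy => ?_, fun m n hm y hy => ?_⟩⟩
  · obtain ⟨y, hy⟩ := hy
    obtain ⟨y', hy'⟩ := key a m n hm x hx
    exact (hs.2 a).1 hm x hx ⟨y - y', by rw [map_sub, hy, hy', sub_sub_cancel]⟩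
  · obtain ⟨x, hx, y', hy'⟩ := (hs.2 a).2 hm y hy
    obtain ⟨z, hz⟩ := key a m n hm x hx
    exact ⟨x, hx, z + y', by rw [map_add, hz, hy']; abel⟩

end DGCat

/-! ### Homotopies in DG-categories -/

namespace DGCat

section Homotopy

variable {k : Type u} [CommRing k] {B : DGCat.{v, w} k} {x y z : B.Obj}

/-- Morphisms of degree `0` that differ by a coboundary. -/
def Htpic (f g : B.Hom x y 0) : Prop := ∃ h : B.Hom x y (-1), f - g = B.d (neg_add_cancel 1) h

namespace Htpic

lemma refl (f : B.Hom x y 0) : Htpic f f := ⟨0, by simp⟩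

lemma of_eq {f g : B.Hom x y 0} (h : f = g) : Htpic f g := h ▸ refl f

lemma symm {f g : B.Hom x y 0} : Htpic f g → Htpic g f
  | ⟨h, e⟩ => ⟨-h, by rw [map_neg, ← e, neg_sub]⟩

lemma trans {f g l : B.Hom x y 0} : Htpic f g → Htpic g l → Htpic f l
  | ⟨h, e⟩, ⟨h', e'⟩ => ⟨h + h', by rw [map_add, ← e, ← e', sub_add_sub_cancel]⟩

lemma comp_left {g g' : B.Hom y z 0} {f : B.Hom x y 0} (hf : B.IsClosed f) :
    Htpic g g' → Htpic (B.comp (add_zero 0) f g) (B.comp (add_zero 0) f g')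
  | ⟨h, e⟩ => ⟨B.comp (zero_add (-1)) f h, by
      rw [B.d_comp (zero_add (-1)) (zero_add 1) (neg_add_cancel 1) (neg_add_cancel 1)
        (add_zero 0) (add_neg_cancel 1), show B.d (zero_add 1) f = 0 from hf, ← e]
      simp⟩

lemma comp_right {f f' : B.Hom x y 0} {g : B.Hom y z 0} (hg : B.IsClosed g) :
    Htpic f f' → Htpic (B.comp (add_zero 0) f g) (B.comp (add_zero 0) f' g)
  | ⟨h, e⟩ => ⟨B.comp (add_zero (-1)) h g, by
      rw [B.d_comp (add_zero (-1)) (neg_add_cancel 1) (zero_add 1) (neg_add_cancel 1)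
        (neg_add_cancel 1) (add_zero 0), show B.d (zero_add 1) g = 0 from hg, ← e]
      simp⟩

end Htpic

/-- `f` is a homotopy equivalence. -/
def IsHtpyEquiv (f : B.Hom x y 0) : Prop :=
  B.IsClosed f ∧ ∃ g : B.Hom y x 0, B.IsClosed g ∧
    Htpic (B.comp (add_zero 0) f g) (B.one x) ∧ Htpic (B.comp (add_zero 0) g f) (B.one y)

lemma htpyEquiv_iff : B.HtpyEquiv x y ↔ ∃ f : B.Hom x y 0, IsHtpyEquiv f :=
  ⟨fun ⟨f, g, h, h', hf, hg, e, e'⟩ => ⟨f, hf, g, hg, ⟨h, e⟩, ⟨h', e'⟩⟩,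
    fun ⟨f, hf, g, hg, ⟨h, e⟩, ⟨h', e'⟩⟩ => ⟨f, g, h, h', hf, hg, e, e'⟩⟩

lemma comp_assoc₀ {t : B.Obj} (f : B.Hom x y 0) (g : B.Hom y z 0) (h : B.Hom z t 0) :
    B.comp (add_zero 0) (B.comp (add_zero 0) f g) h =
      B.comp (add_zero 0) f (B.comp (add_zero 0) g h) :=
  B.assoc _ _ _ _ f g h

/-- If `g` is a section of `f` and `s` is a section of `g`, up to homotopy, then `f` is a homotopy
equivalence. -/
lemma IsHtpyEquiv.of_sections {f s : B.Hom x y 0} {g : B.Hom y x 0} (hf : B.IsClosed f)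
    (hg : B.IsClosed g) (hs : B.IsClosed s) (h₁ : Htpic (B.comp (add_zero 0) g f) (B.one y))
    (h₂ : Htpic (B.comp (add_zero 0) s g) (B.one x)) : IsHtpyEquiv f := by
  refine ⟨hf, g, hg, ?_, h₁⟩
  have e : Htpic f s := by
    have e₁ := (h₂.comp_right hf).symm
    rw [B.one_comp, comp_assoc₀] at e₁
    have e₂ := h₁.comp_left hs
    rw [B.comp_one] at e₂
    exact e₁.trans e₂
  exact (e.comp_right hg).trans h₂

lemma isHtpyEquiv_one (x : B.Obj) : IsHtpyEquiv (B.one x) :=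
  ⟨isClosed_one B x, B.one x, isClosed_one B x, .of_eq (B.one_comp _), .of_eq (B.one_comp _)⟩

lemma IsHtpyEquiv.comp {f : B.Hom x y 0} {g : B.Hom y z 0} (hf : IsHtpyEquiv f)
    (hg : IsHtpyEquiv g) : IsHtpyEquiv (B.comp (add_zero 0) f g) := by
  obtain ⟨hf, f', hf', h₁, h₂⟩ := hf
  obtain ⟨hg, g', hg', h₃, h₄⟩ := hg
  refine ⟨hf.comp hg, B.comp (add_zero 0) g' f', hg'.comp hf', ?_, ?_⟩
  · rw [comp_assoc₀, ← comp_assoc₀ g]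
    have := (h₃.comp_right hf').comp_left hf
    rw [B.one_comp] at this
    exact this.trans h₁
  · rw [comp_assoc₀, ← comp_assoc₀ f']
    have := (h₂.comp_right hg).comp_left hg'
    rw [B.one_comp] at this
    exact this.trans h₄

lemma HtpyEquiv.symm (h : B.HtpyEquiv x y) : B.HtpyEquiv y x := by
  rw [htpyEquiv_iff] at *
  obtain ⟨f, hf, g, hg, h₁, h₂⟩ := h
  exact ⟨g, hg, f, hf, h₂, h₁⟩

lemma HtpyEquiv.trans (h : B.HtpyEquiv x y) (h' : B.HtpyEquiv y z) : B.HtpyEquiv x z := by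
  rw [htpyEquiv_iff] at *
  exact ⟨_, h.choose_spec.comp h'.choose_spec⟩

end Homotopy

section DGFunctor

variable {k : Type u} [CommRing k] {B : DGCat.{v, w} k} {C : DGCat.{v₁, w₁} k}

lemma IsClosed.map {x y : B.Obj} {f : B.Hom x y 0} (hf : B.IsClosed f) (F : DGFunctor B C) :
    C.IsClosed (F.map f) := by
  rw [IsClosed, ← F.map_d, show B.d (zero_add 1) f = 0 from hf, map_zero]

end DGFunctor

/-! ### Cofibrant modules -/

variable {k : Type u} [CommRing k] {A : DGCat.{u, u} k} {M N P : A.modules.Obj}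

lemma dEl_app {n : ℤ} {t : A.modules.Hom M N n} (ht : A.modules.d rfl t = 0) (a : A.Obj)
    {p q p' q' : ℤ} (h : p + n = q) (h' : p' + n = q') (hp : p + 1 = p') (x : El M a p) :
    dEl N a q q' (app t a h x) = n.negOnePow • app t a h' (dEl M a p p' x) := by
  have := app_d (n := n + 1) rfl t a (by omega : p + (n + 1) = q') hp h x
  rw [ht, app_zero] at this
  exact sub_eq_zero.1 this.symm

lemma IsClosed.dEl_app {t : A.modules.Hom M N 0} (ht : A.modules.IsClosed t) (a : A.Obj)
    {p q p' q' : ℤ} (h : p + 0 = q) (h' : p' + 0 = q') (hp : p + 1 = p') (x : El M a p) :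
    dEl N a q q' (app t a h x) = app t a h' (dEl M a p p' x) := by
  rw [DGCat.dEl_app (n := 0) ht a h h' hp, Int.negOnePow_zero, one_smul]

lemma app_act₀ (t : A.modules.Hom M N 0) {a b : A.Obj} {p q r s l : ℤ} (h₁ : q + p = r)
    (h₂ : r + 0 = s) (h₃ : q + 0 = l) (h₄ : l + p = s) (f : A.Hom a b p) (x : El M a q) :
    app t b h₂ (act M h₁ f x) = act N h₄ f (app t a h₃ x) := by
  rw [app_act t h₁ h₂ h₃, mul_zero, Int.negOnePow_zero, one_smul]

/-- The homotopy pullback of `t : M → N` along the identity of `N`: triples `(x, y, z)` with the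
differential `(d x, d y, t x - y - d z)`. The projection to `M` is a quasi-isomorphism, and the one
to `N` is surjective. In the third component `t` and the identity are applied through an equation
`m + 0 = n - 1` between degrees. -/
abbrev htpyPullbackData (t : A.modules.Hom M N 0) (ht : A.modules.IsClosed t) : ModData A where
  X a n := El M a n × El N a n × El N a (n - 1)
  d a m n h :=
    { toFun := fun x => (dEl M a m n x.1, dEl N a m n x.2.1,
        app t a (by omega : m + 0 = n - 1) x.1 -
          app (A.modules.one N) a (by omega : m + 0 = n - 1) x.2.1 -
          dEl N a (m - 1) (n - 1) x.2.2)
      map_add' := fun x y => by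
        ext
        · simp
        · simp
        · simp only [Prod.fst_add, Prod.snd_add, map_add]
          abel
      map_smul' := fun c x => by
        simp only [Prod.smul_fst, Prod.smul_snd, map_smul, ← smul_sub]
        rfl }
  d_d a l m n h h' x := by
    have e₁ := ht.dEl_app a (by omega : l + 0 = m - 1) (by omega : m + 0 = n - 1) h x.1
    have e₂ := (isClosed_one _ N).dEl_app a (by omega : l + 0 = m - 1)
      (by omega : m + 0 = n - 1) h x.2.1
    simp only [LinearMap.coe_mk, AddHom.coe_mk, map_sub, dEl_dEl, e₁, e₂, sub_zero, sub_self]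
    rfl
  act {a b p q n} h := LinearMap.mk₂ k
    (fun f x => (act M h f x.1, act N h f x.2.1,
      p.negOnePow • act N (by omega : q - 1 + p = n - 1) f x.2.2))
    (by intros; simp)
    (by intro c f x; simp only [map_smul, LinearMap.smul_apply, smul_comm p.negOnePow c]; rfl)
    (by intros; simp)
    (by intro c f x; simp only [map_smul, Prod.smul_fst, Prod.smul_snd, smul_comm p.negOnePow c]; rfl)
  act_one x := by simp [act_one]
  act_comp {a b c p q r l m n} h h₁ h₂ h₃ f g x := by
    simp only [LinearMap.mk₂_apply, act_comp M h h₁ h₂ h₃, act_comp N h h₁ h₂ h₃,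
      act_comp N h (by omega : r - 1 + l = n - 1) (by omega : r - 1 + p = m - 1)
        (by omega : m - 1 + q = n - 1), LinearMap.map_smul_of_tower, smul_smul,
      ← Int.negOnePow_add, add_comm q p, h]
  d_act {a b p q n p' q' n'} h hp hq hn h₁ h₂ f x := by
    have e₁ := app_act₀ t h (by omega : n + 0 = n' - 1) (by omega : q + 0 = q' - 1)
      (by omega) f x.1
    have e₂ := app_act₀ (A.modules.one N) h (by omega : n + 0 = n' - 1)
      (by omega : q + 0 = q' - 1) (by omega) f x.2.1
    have e₃ := dEl_act N (by omega : q - 1 + p = n - 1) hp (by omega : q - 1 + 1 = q' - 1)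
      (by omega : n - 1 + 1 = n' - 1) f x.2.2
    simp only [LinearMap.coe_mk, AddHom.coe_mk, LinearMap.mk₂_apply, dEl_act M h hp hq hn,
      dEl_act N h hp hq hn, e₁, e₂, e₃, map_sub, LinearMap.map_smul_of_tower, smul_sub, smul_add,
      smul_smul, ← Int.negOnePow_add, ← two_mul, Int.negOnePow_two_mul, one_smul, ← hp,
      Int.negOnePow_succ, Units.neg_smul]
    refine Prod.ext rfl (Prod.ext rfl ?_)
    simp only [Prod.smul_mk, smul_sub, smul_smul, ← Int.negOnePow_add, ← two_mul,
      Int.negOnePow_two_mul, one_smul, Prod.snd_add]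
    abel

section

variable (t : A.modules.Hom M N 0) (ht : A.modules.IsClosed t)

/-- The projection of the homotopy pullback to `M`. -/
def htpyPullbackFst : A.modules.Hom (htpyPullbackData t ht).toModule M 0 :=
  ModData.desc (fun a p q h => app (A.modules.one M) a h ∘ₗ LinearMap.fst k (El M a p) _) (by
    intro a b p q r s l h₁ h₂ h₃ h₄ f x
    rw [mul_zero, Int.negOnePow_zero, one_smul]
    exact app_act₀ (A.modules.one M) h₁ h₂ h₃ h₄ f x.1)

/-- The projection of the homotopy pullback to `N`. -/
def htpyPullbackSnd : A.modules.Hom (htpyPullbackData t ht).toModule N 0 :=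
  ModData.desc (fun a p q h => app (A.modules.one N) a h ∘ₗ
      LinearMap.fst k (El N a p) _ ∘ₗ LinearMap.snd k (El M a p) _) (by
    intro a b p q r s l h₁ h₂ h₃ h₄ f x
    rw [mul_zero, Int.negOnePow_zero, one_smul]
    exact app_act₀ (A.modules.one N) h₁ h₂ h₃ h₄ f x.2.1)

/-- The homotopy `(x, y, z) ↦ z` between the two morphisms from the homotopy pullback to `N`. -/
def htpyPullbackHtpy : A.modules.Hom (htpyPullbackData t ht).toModule N (-1) :=
  ModData.desc (fun a p q h => app (A.modules.one N) a (by omega : p - 1 + 0 = q) ∘ₗ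
      LinearMap.snd k (El N a p) _ ∘ₗ LinearMap.snd k (El M a p) _) (by
    intro a b p q r s l h₁ h₂ h₃ h₄ f x
    have := app_act₀ (A.modules.one N) (by omega : q - 1 + p = r - 1) (by omega : r - 1 + 0 = s)
      (by omega : q - 1 + 0 = l) h₄ f x.2.2
    rw [mul_neg_one, Int.negOnePow_neg]
    change app (A.modules.one N) b (by omega : r - 1 + 0 = s) (p.negOnePow •
      act N (by omega : q - 1 + p = r - 1) f x.2.2) = _
    rw [LinearMap.map_smul_of_tower, this]
    rfl)

variable {a : A.Obj} {p : ℤ} (x : (htpyPullbackData t ht).X a p)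

lemma htpyPullbackFst_apply :
    app (htpyPullbackFst t ht) a (add_zero p) ((htpyPullbackData t ht).el x) = x.1 :=
  app_one a (add_zero p) x.1

lemma htpyPullbackSnd_apply :
    app (htpyPullbackSnd t ht) a (add_zero p) ((htpyPullbackData t ht).el x) = x.2.1 :=
  app_one a (add_zero p) x.2.1

lemma isClosed_htpyPullbackFst : A.modules.IsClosed (htpyPullbackFst t ht) := by
  rw [isClosed_iff]
  intro a p x
  obtain ⟨x, rfl⟩ := ModData.exists_el x
  rw [ModData.dEl_el _ rfl, htpyPullbackFst_apply, htpyPullbackFst_apply]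
  rfl

lemma app_eq_of_eq (s : A.modules.Hom M N 0) {n : ℤ} (h : p + 0 = n) (h' : n + 0 = p)
    (y : El M a p) : app (A.modules.one N) a h' (app s a h y) = app s a (add_zero p) y := by
  obtain rfl : p = n := by omega
  rw [app_one]

lemma app_one_dEl {m n : ℤ} (h' : n + 0 = p) (y : El M a m) :
    app (A.modules.one M) a h' (dEl M a m n y) = dEl M a m p y := by
  obtain rfl : p = n := by omega
  rw [app_one]

lemma htpyPullback_htpy :
    A.modules.comp (add_zero 0) (htpyPullbackFst t ht) t - htpyPullbackSnd t ht =
      A.modules.d (neg_add_cancel 1) (htpyPullbackHtpy t ht) := by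
  refine hom_ext fun a p q h x => ?_
  obtain rfl : p = q := by omega
  obtain ⟨x, rfl⟩ := ModData.exists_el x
  rw [app_d (neg_add_cancel 1) _ a h rfl (rfl : p + -1 = _), app_sub,
    app_comp _ _ _ _ _ h, htpyPullbackFst_apply, htpyPullbackSnd_apply, ModData.dEl_el _ rfl]
  change _ = dEl N a _ _ (app (A.modules.one N) a (by omega : p - 1 + 0 = p + -1) x.2.2) -
    (-1 : ℤ).negOnePow • app (A.modules.one N) a (by omega : p + 1 - 1 + 0 = p)
      (app t a (by omega : p + 0 = p + 1 - 1) x.1 -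
        app (A.modules.one N) a (by omega : p + 0 = p + 1 - 1) x.2.1 -
        dEl N a (p - 1) (p + 1 - 1) x.2.2)
  rw [map_sub, map_sub, (isClosed_one _ N).dEl_app a (by omega : p - 1 + 0 = p + -1) h
    (by omega) x.2.2, app_eq_of_eq, app_eq_of_eq, app_one, app_one, app_one_dEl, Int.negOnePow_neg,
    Int.negOnePow_one, Units.neg_smul, one_smul]
  abel

/-- The projection of the homotopy pullback to `M` has the section `x ↦ (x, t x, 0)`, and its kernel
is the cone of an identity. -/
lemma isQuasiIso_htpyPullbackFst : IsQuasiIso (htpyPullbackFst t ht) := by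
  rw [isQuasiIso_iff]
  refine ⟨isClosed_htpyPullbackFst t ht, fun a => ⟨fun m n hm x hx hy => ?_, fun m n hm y hy => ?_⟩⟩
  · obtain ⟨x, rfl⟩ := ModData.exists_el x
    obtain ⟨y, hy⟩ := hy
    rw [htpyPullbackFst_apply] at hy
    rw [ModData.dEl_el _ rfl, LinearEquiv.map_eq_zero_iff] at hx
    have h₃ : app t a (by omega : n + 0 = n + 1 - 1) x.1 -
        app (A.modules.one N) a (by omega : n + 0 = n + 1 - 1) x.2.1 -
        dEl N a (n - 1) (n + 1 - 1) x.2.2 = 0 := congrArg (fun z => z.2.2) hx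
    have h₄ := congrArg (app (A.modules.one N) a (by omega : n + 1 - 1 + 0 = n)) h₃
    rw [map_sub, map_sub, app_eq_of_eq, app_eq_of_eq, app_one_dEl, app_one, map_zero] at h₄
    have h₅ := (isClosed_one _ N).dEl_app a (by omega : n - 1 + 0 = m) (add_zero n)
      (by omega) x.2.2
    rw [app_one] at h₅
    -- if `(x, y', z)` is a cocycle and `x = d y`, it is the boundary of `(y, t y - z, 0)`
    refine ⟨(htpyPullbackData t ht).el (y, app t a (add_zero m) y -
      app (A.modules.one N) a (by omega : n - 1 + 0 = m) x.2.2, 0), ?_⟩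
    rw [ModData.dEl_el _ hm]
    congr 1
    refine Prod.ext hy (Prod.ext ?_ ?_)
    · change dEl N a m n (_ - _) = x.2.1
      rw [map_sub, h₅, ht.dEl_app a (add_zero m) (add_zero n) hm, hy]
      rw [sub_right_comm] at h₄
      exact sub_eq_zero.1 h₄
    · change app t a _ y - app (A.modules.one N) a _ (_ - _) - dEl N a (m - 1) (n - 1) 0 = _
      obtain rfl : n - 1 = m := by omega
      simp
  · refine ⟨(htpyPullbackData t ht).el (y, app t a (add_zero n) y, 0), ?_, 0, ?_⟩
    · rw [ModData.dEl_el _ rfl, LinearEquiv.map_eq_zero_iff]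
      refine Prod.ext hy (Prod.ext ?_ ?_)
      · change dEl N a n (n + 1) (app t a _ y) = 0
        rw [ht.dEl_app a (add_zero n) (add_zero _) rfl, hy, map_zero]
      · change app t a (by omega : n + 0 = n + 1 - 1) y - app (A.modules.one N) a
          (by omega : n + 0 = n + 1 - 1) (app t a (add_zero n) y) - dEl N a (n - 1) (n + 1 - 1) 0 = 0
        have : ∀ l (h : n + 0 = l), app t a h y =
            app (A.modules.one N) a h (app t a (add_zero n) y) := by
          intro l h
          obtain rfl : n = l := by omega
          rw [app_one]
        rw [← this, map_zero, sub_self, sub_zero]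
    · rw [htpyPullbackFst_apply, map_zero, sub_self]

/-- The projection of the homotopy pullback to `N` is a trivial fibration if `t` is a
quasi-isomorphism, since it is homotopic to the composition of the other projection with `t`. -/
lemma isTrivialFibration_htpyPullbackSnd (h : IsQuasiIso t) :
    IsTrivialFibration (htpyPullbackSnd t ht) := by
  rw [isTrivialFibration_iff]
  refine ⟨((isQuasiIso_htpyPullbackFst t ht).comp h).of_htpy (-htpyPullbackHtpy t ht) ?_,
    fun a n y => ⟨(htpyPullbackData t ht).el (0, y, 0), htpyPullbackSnd_apply t ht _⟩⟩
  rw [map_neg, ← htpyPullback_htpy, neg_sub]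

end

/-- A closed morphism from a cofibrant module lifts along a quasi-isomorphism, up to homotopy. -/
lemma IsCofibrant.exists_htpic_lift (hP : IsCofibrant P) {t : A.modules.Hom M N 0}
    (ht : IsQuasiIso t) (f : A.modules.Hom P N 0) (hf : A.modules.IsClosed f) :
    ∃ g : A.modules.Hom P M 0, A.modules.IsClosed g ∧ Htpic (A.modules.comp (add_zero 0) g t)
      f := by
  obtain ⟨g, hg, e⟩ := hP _ (isTrivialFibration_htpyPullbackSnd t ht.choose ht) f hf
  refine ⟨_, hg.comp (isClosed_htpyPullbackFst t ht.choose), ?_⟩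
  have := Htpic.comp_left hg ⟨_, htpyPullback_htpy t ht.choose⟩
  rwa [e, ← comp_assoc₀] at this

/-- A quasi-isomorphism between cofibrant modules is a homotopy equivalence. -/
lemma IsQuasiIso.isHtpyEquiv {t : A.modules.Hom M N 0} (ht : IsQuasiIso t) (hM : IsCofibrant M)
    (hN : IsCofibrant N) : IsHtpyEquiv t := by
  obtain ⟨g, hg, e⟩ := hN.exists_htpic_lift ht _ (isClosed_one _ N)
  have hg' : IsQuasiIso g := by
    refine IsQuasiIso.of_comp_right hg ht ?_
    obtain ⟨h, e⟩ := e.symm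
    have one : IsQuasiIso (A.modules.one N) := by
      rw [isQuasiIso_iff]
      refine ⟨isClosed_one _ N, fun a => ⟨fun m n hm x hx hy => ?_, fun m n hm x hx => ?_⟩⟩
      · simpa using hy
      · exact ⟨x, hx, 0, by simp⟩
    exact one.of_htpy (-h) (by rw [map_neg, ← e, neg_sub])
  obtain ⟨s, hs, e'⟩ := hM.exists_htpic_lift hg' _ (isClosed_one _ M)
  exact .of_sections ht.choose hg hs e e'

end DGCat

namespace DGCat

/-! ### Free modules -/

section Free

open scoped TensorProduct

variable {k : Type u} [CommRing k] {A : DGCat.{u, u} k} {M N L : A.modules.Obj}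

/-- The index set of the direct sum of the `A(a, b)ᵖ ⊗ M(a)^q` over all `a` and `q + p = n`. -/
structure FreeIdx (A : DGCat.{u, u} k) (n : ℤ) where
  a : A.Obj
  p : ℤ
  q : ℤ
  h : q + p = n

/-- The elements of degree `n` at `b` of the free module on the complexes `M(a)`. -/
abbrev FreeX (M : A.modules.Obj) (b : A.Obj) (n : ℤ) : Type u :=
  DirectSum (FreeIdx A n) fun i => A.Hom i.a b i.p ⊗[k] El M i.a i.q

open scoped Classical in
/-- The element `f ⊗ x` of the free module. -/
noncomputable def freeMk (M : A.modules.Obj) {a b : A.Obj} {p q n : ℤ} (h : q + p = n) :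
    A.Hom a b p →ₗ[k] El M a q →ₗ[k] FreeX M b n :=
  (TensorProduct.mk k (A.Hom a b p) (El M a q)).compr₂
    (DirectSum.lof k (FreeIdx A n) (fun i => A.Hom i.a b i.p ⊗[k] El M i.a i.q) ⟨a, p, q, h⟩)

lemma freeMk_units_smul {a b : A.Obj} {p q n : ℤ} (h : q + p = n) (c : ℤˣ) (f : A.Hom a b p)
    (x : El M a q) : freeMk M h (c • f) x = c • freeMk M h f x := by
  obtain rfl | rfl := Int.units_eq_one_or c <;> simp

open scoped Classical in
/-- The linear map out of the free module given by its values on the elements `f ⊗ x`. -/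
noncomputable def freeLift {b : A.Obj} {n : ℤ} {Z : Type*} [AddCommGroup Z] [Module k Z]
    (φ : ∀ (a : A.Obj) (p q : ℤ), q + p = n → A.Hom a b p →ₗ[k] El M a q →ₗ[k] Z) :
    FreeX M b n →ₗ[k] Z :=
  DirectSum.toModule k _ _ fun i => TensorProduct.lift (φ i.a i.p i.q i.h)

@[simp] lemma freeLift_freeMk {b : A.Obj} {n : ℤ} {Z : Type*} [AddCommGroup Z] [Module k Z]
    (φ : ∀ (a : A.Obj) (p q : ℤ), q + p = n → A.Hom a b p →ₗ[k] El M a q →ₗ[k] Z)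
    {a : A.Obj} {p q : ℤ} (h : q + p = n) (f : A.Hom a b p) (x : El M a q) :
    freeLift φ (freeMk M h f x) = φ a p q h f x := by
  simp [freeLift, freeMk]

lemma free_induction {b : A.Obj} {n : ℤ} {P : FreeX M b n → Prop} (y : FreeX M b n) (zero : P 0)
    (add : ∀ x y, P x → P y → P (x + y))
    (mk : ∀ (a : A.Obj) (p q : ℤ) (h : q + p = n) (f : A.Hom a b p) (x : El M a q),
      P (freeMk M h f x)) : P y := by
  classical
  induction y using DirectSum.induction_on with
  | zero => exact zero
  | of i x =>
    induction x using TensorProduct.induction_on with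
    | zero => rw [map_zero]; exact zero
    | tmul f x => exact mk i.a i.p i.q i.h f x
    | add x y hx hy => rw [map_add]; exact add _ _ hx hy
  | add x y hx hy => exact add _ _ hx hy

lemma negOnePow_smul_congr {X : Type*} [AddCommGroup X] {m n : ℤ} (h : Even (m - n)) (x : X) :
    m.negOnePow • x = n.negOnePow • x := by
  rw [(Int.negOnePow_eq_iff m n).2 h]

lemma d_one (a : A.Obj) {n : ℤ} (h : 0 + 1 = n) : A.d h (A.one a) = 0 := by
  subst h
  exact isClosed_one A a

/-- The differential of the free module: `d(f ⊗ x) = d f ⊗ x + (-1)^|f| f ⊗ d x`. -/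
noncomputable def freeD (M : A.modules.Obj) (b : A.Obj) {m n : ℤ} (hmn : m + 1 = n) :
    FreeX M b m →ₗ[k] FreeX M b n :=
  freeLift fun a p q h => (freeMk M (by omega : q + (p + 1) = n)) ∘ₗ A.d rfl +
    p.negOnePow • (freeMk M (by omega : q + 1 + p = n)).compl₂ (dEl M a q (q + 1))

lemma freeD_freeMk {a b : A.Obj} {m n p q p' q' : ℤ} (hmn : m + 1 = n) (h : q + p = m)
    (hp : p + 1 = p') (hq : q + 1 = q') (f : A.Hom a b p) (x : El M a q) :
    freeD M b hmn (freeMk M h f x) = freeMk M (by omega) (A.d hp f) x +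
      p.negOnePow • freeMk M (by omega) f (dEl M a q q' x) := by
  subst hp hq
  simp [freeD]

/-- The action of the morphisms of `A` on the free module, by composition with the first factor. -/
noncomputable def freeAct (M : A.modules.Obj) {b c : A.Obj} {r q n : ℤ} (h : q + r = n) :
    A.Hom b c r →ₗ[k] FreeX M b q →ₗ[k] FreeX M c n :=
  LinearMap.flip (freeLift fun a p s hs =>
    LinearMap.mk₂ k (fun f x => (freeMk M (by omega : s + (p + r) = n)).flip x ∘ₗ A.comp rfl f)
      (by intros; ext; simp) (by intros; ext; simp) (by intros; ext; simp) (by intros; ext; simp))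

lemma freeAct_freeMk {a b c : A.Obj} {r q n p s l : ℤ} (h : q + r = n) (hs : s + p = q)
    (hl : p + r = l) (g : A.Hom b c r) (f : A.Hom a b p) (x : El M a s) :
    freeAct M h g (freeMk M hs f x) = freeMk M (by omega) (A.comp hl f g) x := by
  subst hl
  simp [freeAct]

/-- The data of the free module on the complexes `M(a)`, `a ∈ A`. -/
noncomputable abbrev freeData (M : A.modules.Obj) : ModData A where
  X b n := FreeX M b n
  d b m n h := freeD M b h
  d_d b l m n h h' x := by
    induction x using free_induction with
    | zero => simp
    | add x y hx hy => simp only [map_add, hx, hy, add_zero]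
    | mk a p q h₁ f x =>
      rw [freeD_freeMk h h₁ rfl rfl, map_add, LinearMap.map_smul_of_tower,
        freeD_freeMk h' _ rfl rfl, freeD_freeMk h' _ rfl rfl, A.d_d, dEl_dEl, Int.negOnePow_succ]
      simp
  act h := freeAct M h
  act_one {b n} x := by
    induction x using free_induction with
    | zero => simp
    | add x y hx hy => simp only [map_add, hx, hy]
    | mk a p q h₁ f x => rw [freeAct_freeMk _ _ (add_zero p), A.comp_one]
  act_comp {b c e p q r l m n} h h₁ h₂ h₃ f g x := by
    induction x using free_induction with
    | zero => simp
    | add x y hx hy => simp only [map_add, hx, hy]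
    | mk a s t hs u x =>
      rw [freeAct_freeMk _ _ rfl, freeAct_freeMk _ _ rfl,
        freeAct_freeMk _ _ (by omega : s + p + q = s + l), A.assoc rfl _ h rfl]
  d_act {b c p q n p' q' n'} h hp hq hn h₁ h₂ f x := by
    induction x using free_induction with
    | zero => simp
    | add x y hx hy =>
      simp only [map_add, hx, hy, smul_add]
      abel
    | mk a s t hs u x =>
      rw [freeAct_freeMk h hs rfl f, freeAct_freeMk h₁ hs (by omega : s + p' = s + p + 1) (A.d hp f),
        freeD_freeMk _ _ rfl rfl,
        freeD_freeMk hq hs rfl rfl, map_add, LinearMap.map_smul_of_tower,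
        freeAct_freeMk _ _ (by omega : s + 1 + p = s + p + 1), freeAct_freeMk _ _ rfl,
        A.d_comp rfl rfl hp rfl (by omega) (by omega : s + 1 + p = s + p + 1), map_add,
        LinearMap.add_apply, freeMk_units_smul, smul_add, smul_smul, ← Int.negOnePow_add,
        add_comm p s, add_assoc]

/-- The free module on the complexes `M(a)`, `a ∈ A`. -/
noncomputable def free (M : A.modules.Obj) : A.modules.Obj := (freeData M).toModule

/-- The inclusion `x ↦ 1 ⊗ x` of the generators. -/
noncomputable def gen (M : A.modules.Obj) (a : A.Obj) (n : ℤ) : El M a n →ₗ[k] El (free M) a n :=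
  (freeData M).el.toLinearMap ∘ₗ freeMk M (add_zero n) (A.one a)

lemma gen_apply (a : A.Obj) {n : ℤ} (x : El M a n) :
    gen M a n x = (freeData M).el (freeMk M (add_zero n) (A.one a) x) := rfl

lemma dEl_gen (a : A.Obj) (m n : ℤ) (h : m + 1 = n) (x : El M a m) :
    dEl (free M) a m n (gen M a m x) = gen M a n (dEl M a m n x) := by
  rw [gen_apply]
  refine (ModData.dEl_el (freeData M) h _).trans ?_
  rw [freeD_freeMk h _ (zero_add 1) h, d_one]
  simp [gen_apply]

lemma act_gen {a b : A.Obj} {p q n : ℤ} (h : q + p = n) (f : A.Hom a b p) (x : El M a q) :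
    act (free M) h f (gen M a q x) = (freeData M).el (freeMk M h f x) := by
  rw [gen_apply]
  refine (ModData.act_el (freeData M) h f _).trans ?_
  rw [freeAct_freeMk _ _ (zero_add p), A.one_comp]

/-- The elements of the free module are generated by the elements `f ⊗ x`. -/
lemma free_el_induction {b : A.Obj} {n : ℤ} {P : El (free M) b n → Prop} (y : El (free M) b n)
    (zero : P 0) (add : ∀ x y, P x → P y → P (x + y))
    (mk : ∀ (a : A.Obj) (p q : ℤ) (h : q + p = n) (f : A.Hom a b p) (x : El M a q),
      P (act (free M) h f (gen M a q x))) : P y := by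
  obtain ⟨y, rfl⟩ := (freeData M).exists_el y
  induction y using free_induction with
  | zero => rw [map_zero]; exact zero
  | add x y hx hy => rw [map_add]; exact add _ _ hx hy
  | mk a p q h f x => rw [← act_gen]; exact mk a p q h f x

lemma free_hom_ext {n : ℤ} {s t : A.modules.Hom (free M) N n}
    (h : ∀ a p q (h : p + n = q) (x : El M a p), app s a h (gen M a p x) = app t a h (gen M a p x)) :
    s = t := by
  refine hom_ext fun b p q hpq y => ?_
  induction y using free_el_induction with
  | zero => simp
  | add x y hx hy => simp only [map_add, hx, hy]
  | mk a r l hl f x => rw [app_act s hl hpq rfl, app_act t hl hpq rfl, h]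

/-- The graded natural transformation out of a free module given by its values on generators. -/
noncomputable def freeDesc {n : ℤ}
    (γ : ∀ (a : A.Obj) (p q : ℤ), p + n = q → El M a p →ₗ[k] El N a q) :
    A.modules.Hom (free M) N n :=
  ModData.desc (D := freeData M) (fun b p q hpq => freeLift fun a r l hl =>
      (r * n).negOnePow • (act N (by omega : l + n + r = q)).compl₂ (γ a l (l + n) rfl)) (by
    intro a b p q r s l h₁ h₂ h₃ h₄ f x
    induction x using free_induction with
    | zero => simp
    | add x y hx hy => simp only [map_add, hx, hy, smul_add]
    | mk c t v hv g x =>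
      rw [freeAct_freeMk _ _ rfl, freeLift_freeMk, freeLift_freeMk]
      simp only [LinearMap.smul_apply, LinearMap.compl₂_apply, LinearMap.map_smul_of_tower]
      rw [act_comp N rfl _ (by omega) h₄, smul_smul, ← Int.negOnePow_add, ← add_mul, add_comm p t])

@[simp] lemma app_freeDesc_gen {n : ℤ}
    (γ : ∀ (a : A.Obj) (p q : ℤ), p + n = q → El M a p →ₗ[k] El N a q) (a : A.Obj) {p q : ℤ}
    (h : p + n = q) (x : El M a p) : app (freeDesc γ) a h (gen M a p x) = γ a p q h x := by
  rw [gen_apply]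
  change (freeLift fun c r l hl => (r * n).negOnePow •
    (act N (by omega : l + n + r = q)).compl₂ (γ c l (l + n) rfl))
      (freeMk M (add_zero p) (A.one a) x) = _
  subst h
  rw [freeLift_freeMk]
  simp only [LinearMap.smul_apply, LinearMap.compl₂_apply]
  rw [zero_mul, Int.negOnePow_zero, one_smul, act_one]

/-- The counit from the free module on `M` to `M`. -/
noncomputable def freeCounit (M : A.modules.Obj) : A.modules.Hom (free M) M 0 :=
  freeDesc fun a _ _ h => app (A.modules.one M) a h

@[simp] lemma app_freeCounit_gen (a : A.Obj) {p q : ℤ} (h : p + 0 = q) (x : El M a p) :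
    app (freeCounit M) a h (gen M a p x) = app (A.modules.one M) a h x := by
  simp [freeCounit]

lemma isClosed_freeDesc {γ : ∀ (a : A.Obj) (p q : ℤ), p + 0 = q → El M a p →ₗ[k] El N a q}
    (hγ : ∀ (a : A.Obj) (p : ℤ) (x : El M a p), dEl N a p (p + 1) (γ a p p (add_zero p) x) =
      γ a (p + 1) (p + 1) (add_zero _) (dEl M a p (p + 1) x)) :
    A.modules.IsClosed (freeDesc γ) := by
  refine free_hom_ext fun a p q h x => ?_
  obtain rfl : p + 1 = q := h
  rw [app_d (zero_add 1) _ a rfl rfl (add_zero p), dEl_gen _ _ _ rfl, app_freeDesc_gen,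
    app_freeDesc_gen, hγ]
  simp

lemma isClosed_freeCounit (M : A.modules.Obj) : A.modules.IsClosed (freeCounit M) :=
  isClosed_freeDesc fun a p x => by rw [app_one, app_one]

/-- The effect of the free module construction on graded natural transformations. -/
noncomputable def freeMap {n : ℤ} (t : A.modules.Hom M N n) : A.modules.Hom (free M) (free N) n :=
  freeDesc fun a _ q h => gen N a q ∘ₗ app t a h

@[simp] lemma app_freeMap_gen {n : ℤ} (t : A.modules.Hom M N n) (a : A.Obj) {p q : ℤ}
    (h : p + n = q) (x : El M a p) :
    app (freeMap t) a h (gen M a p x) = gen N a q (app t a h x) :=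
  app_freeDesc_gen _ a h x

/-- The free module as a DG-functor. -/
noncomputable def freeFunctor (A : DGCat.{u, u} k) : DGFunctor A.modules A.modules where
  obj := free
  map {M N n} :=
    { toFun := freeMap
      map_add' := fun s t => free_hom_ext fun a p q h x => by simp
      map_smul' := fun c t => free_hom_ext fun a p q h x => by simp }
  map_d {M N m n} h t := free_hom_ext fun a p q hpq x => by
    simp only [LinearMap.coe_mk, AddHom.coe_mk, app_freeMap_gen]
    rw [app_d h _ a hpq rfl rfl, app_d h _ a hpq rfl rfl, dEl_gen _ _ _ rfl, app_freeMap_gen,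
      app_freeMap_gen, dEl_gen _ _ _ (by omega)]
    simp [LinearMap.map_smul_of_tower]
  map_one M := free_hom_ext fun a p q hpq x => by
    obtain rfl : p = q := by omega
    simp
  map_comp {M N L m n l} h s t := free_hom_ext fun a p q hpq x => by
    simp only [LinearMap.coe_mk, AddHom.coe_mk]
    rw [app_comp h _ _ a hpq rfl, app_freeMap_gen, app_freeMap_gen, app_freeMap_gen,
      app_comp h _ _ a hpq rfl]

lemma freeCounit_naturality {n : ℤ} (t : A.modules.Hom M N n) :
    A.modules.comp (zero_add n) (freeCounit M) t =
      A.modules.comp (add_zero n) (freeMap t) (freeCounit N) := by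
  refine free_hom_ext fun a p q h x => ?_
  rw [app_comp (zero_add n) _ _ a h (add_zero p)]
  rw [app_comp (add_zero n) _ _ a h h]
  simp

-- only the lemmas above are used from here on; unfolding would compare large direct sums
attribute [irreducible] free gen freeDesc freeMap freeCounit

/-! ### The kernel of the counit -/

/-- The data of the kernel of the counit from the free module on `M` to `M`. -/
noncomputable abbrev syzygyData (M : A.modules.Obj) : ModData A where
  X a n := LinearMap.ker (app (freeCounit M) a (add_zero n))
  d a m n h := (dEl (free M) a m n).restrict fun x hx => by
    rw [LinearMap.mem_ker] at hx ⊢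
    rw [← (isClosed_freeCounit M).dEl_app a (add_zero m) (add_zero n) h, hx, map_zero]
  d_d a l m n h h' x := Subtype.ext (dEl_dEl _ a l m n _)
  act {a b p q n} h := LinearMap.mk₂ k
    (fun f x => ⟨act (free M) h f x.1, by
      rw [LinearMap.mem_ker, app_act₀ _ h (add_zero n) (add_zero q) h, LinearMap.mem_ker.1 x.2,
        map_zero]⟩)
    (by intros; ext; simp) (by intros; ext; simp) (by intros; ext; simp) (by intros; ext; simp)
  act_one x := Subtype.ext (act_one _ _)
  act_comp h h₁ h₂ h₃ f g x := Subtype.ext (act_comp _ h h₁ h₂ h₃ f g _)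
  d_act h hp hq hn h₁ h₂ f x := Subtype.ext (by
    have := dEl_act (free M) h hp hq hn f x.1
    exact this)

/-- The kernel of the counit from the free module on `M` to `M`. -/
noncomputable def syzygy (M : A.modules.Obj) : A.modules.Obj := (syzygyData M).toModule

/-- The inclusion of the kernel of the counit. -/
noncomputable def syzygyIncl (M : A.modules.Obj) : A.modules.Hom (syzygy M) (free M) 0 :=
  ModData.desc (D := syzygyData M)
    (fun a _ _ h => app (A.modules.one (free M)) a h ∘ₗ Submodule.subtype _)
    (by
      intro a b p q r s l h₁ h₂ h₃ h₄ f x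
      rw [mul_zero, Int.negOnePow_zero, one_smul]
      exact app_act₀ (A.modules.one (free M)) h₁ h₂ h₃ h₄ f x.1)

lemma app_syzygyIncl_el (a : A.Obj) {p : ℤ} (x : (syzygyData M).X a p) :
    app (syzygyIncl M) a (add_zero p) ((syzygyData M).el x) = x.1 :=
  app_one a (add_zero p) x.1

lemma isClosed_syzygyIncl (M : A.modules.Obj) : A.modules.IsClosed (syzygyIncl M) := by
  rw [isClosed_iff]
  intro a p x
  obtain ⟨x, rfl⟩ := (syzygyData M).exists_el x
  have : dEl (syzygy M) a p (p + 1) ((syzygyData M).el x) = _ := ModData.dEl_el _ rfl x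
  rw [this, app_syzygyIncl_el, app_syzygyIncl_el]
  rfl

lemma syzygyIncl_injective (a : A.Obj) (p : ℤ) :
    Function.Injective (app (syzygyIncl M) a (add_zero p)) := by
  intro x y h
  obtain ⟨x, rfl⟩ := (syzygyData M).exists_el x
  obtain ⟨y, rfl⟩ := (syzygyData M).exists_el y
  rw [app_syzygyIncl_el, app_syzygyIncl_el] at h
  rw [Subtype.ext h]

lemma app_freeCounit_syzygyIncl (a : A.Obj) {p : ℤ} (x : El (syzygy M) a p) :
    app (freeCounit M) a (add_zero p) (app (syzygyIncl M) a (add_zero p) x) = 0 := by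
  obtain ⟨x, rfl⟩ := (syzygyData M).exists_el x
  rw [app_syzygyIncl_el]
  exact x.2

lemma exists_syzygy {a : A.Obj} {p : ℤ} (y : El (free M) a p)
    (hy : app (freeCounit M) a (add_zero p) y = 0) :
    ∃ x : El (syzygy M) a p, app (syzygyIncl M) a (add_zero p) x = y :=
  ⟨(syzygyData M).el ⟨y, hy⟩, app_syzygyIncl_el a _⟩

end Free

section Syzygy

variable {k : Type u} [CommRing k] {A : DGCat.{u, u} k} {M N L : A.modules.Obj}

lemma syzygy_hom_ext {n : ℤ} {s t : A.modules.Hom L (syzygy M) n}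
    (h : A.modules.comp (add_zero n) s (syzygyIncl M) =
      A.modules.comp (add_zero n) t (syzygyIncl M)) : s = t := by
  refine hom_ext fun a p q hpq x => syzygyIncl_injective a q ?_
  have := congrArg (fun f => app f a hpq x) h
  rwa [app_comp (add_zero n) _ _ a hpq hpq, app_comp (add_zero n) _ _ a hpq hpq] at this

lemma app_freeMap_mem_ker {n : ℤ} (t : A.modules.Hom M N n) (a : A.Obj) {p q : ℤ} (h : p + n = q)
    {x : El (free M) a p} (hx : x ∈ LinearMap.ker (app (freeCounit M) a (add_zero p))) :
    app (freeMap t) a h x ∈ LinearMap.ker (app (freeCounit N) a (add_zero q)) := by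
  have := congrArg (fun f => app f a h x) (freeCounit_naturality t)
  rw [app_comp _ _ _ _ h (add_zero p), app_comp _ _ _ _ h h] at this
  rw [LinearMap.mem_ker] at hx ⊢
  rw [← this, hx, map_zero]

/-- The effect of the kernel of the counit on graded natural transformations. -/
noncomputable def syzygyMap {n : ℤ} (t : A.modules.Hom M N n) :
    A.modules.Hom (syzygy M) (syzygy N) n :=
  ModData.desc (D := syzygyData M) (N := syzygy N)
    (fun a p q h => (syzygyData N).el.toLinearMap ∘ₗ (app (freeMap t) a h).restrict fun _ hx =>
      app_freeMap_mem_ker t a h hx)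
    (by
      intro a b p q r s l h₁ h₂ h₃ h₄ f x
      exact congrArg (syzygyData N).el (Subtype.ext (app_act (freeMap t) h₁ h₂ h₃ f x.1)))

lemma app_syzygyMap_el {n : ℤ} (t : A.modules.Hom M N n) (a : A.Obj) {p q : ℤ} (h : p + n = q)
    (x : (syzygyData M).X a p) :
    app (syzygyMap t) a h ((syzygyData M).el x) =
      (syzygyData N).el ⟨app (freeMap t) a h x.1, app_freeMap_mem_ker t a h x.2⟩ := rfl

lemma syzygyMap_incl {n : ℤ} (t : A.modules.Hom M N n) :
    A.modules.comp (add_zero n) (syzygyMap t) (syzygyIncl N) =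
      A.modules.comp (zero_add n) (syzygyIncl M) (freeMap t) := by
  refine hom_ext fun a p q h x => ?_
  rw [app_comp (add_zero n) _ _ a h h, app_comp (zero_add n) _ _ a h (add_zero p)]
  obtain ⟨x, rfl⟩ := (syzygyData M).exists_el x
  rw [app_syzygyIncl_el, app_syzygyMap_el, app_syzygyIncl_el]

/-- The kernel of the counit as a DG-functor. -/
noncomputable def syzygyFunctor (A : DGCat.{u, u} k) : DGFunctor A.modules A.modules where
  obj := syzygy
  map {M N n} :=
    { toFun := syzygyMap
      map_add' := fun s t => syzygy_hom_ext (by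
        have := map_add (freeFunctor A).map s t
        rw [syzygyMap_incl, show freeMap (s + t) = freeMap s + freeMap t from this, map_add, map_add,
          LinearMap.add_apply, syzygyMap_incl, syzygyMap_incl])
      map_smul' := fun c t => syzygy_hom_ext (by
        have := map_smul (freeFunctor A).map c t
        rw [syzygyMap_incl, show freeMap (c • t) = c • freeMap t from this, map_smul, map_smul,
          LinearMap.smul_apply, syzygyMap_incl]
        rfl) }
  map_d {M N m n} h t := syzygy_hom_ext (by
    have := (freeFunctor A).map_d h t
    have e := congrArg (A.modules.d h) (syzygyMap_incl t)
    rw [A.modules.d_comp (add_zero m) h (zero_add 1) h h (add_zero n),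
      A.modules.d_comp (zero_add m) (zero_add 1) h h (zero_add n) (by omega),
      show A.modules.d (zero_add 1) (syzygyIncl M) = 0 from isClosed_syzygyIncl M,
      show A.modules.d (zero_add 1) (syzygyIncl N) = 0 from isClosed_syzygyIncl N] at e
    simp only [map_zero, zero_add, LinearMap.zero_apply, smul_zero, add_zero, Int.negOnePow_zero,
      one_smul] at e
    refine (syzygyMap_incl (A.modules.d h t)).trans (Eq.trans ?_ e.symm)
    exact congrArg _ this)
  map_one M := syzygy_hom_ext (by
    have := (freeFunctor A).map_one M
    refine (syzygyMap_incl (A.modules.one M)).trans ?_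
    rw [show freeMap (A.modules.one M) = A.modules.one _ from this, A.modules.comp_one,
      A.modules.one_comp])
  map_comp {M N L p q n} h s t := syzygy_hom_ext (by
    have := (freeFunctor A).map_comp h s t
    refine (syzygyMap_incl (A.modules.comp h s t)).trans ?_
    rw [show freeMap (A.modules.comp h s t) = A.modules.comp h (freeMap s) (freeMap t) from this]
    refine Eq.trans ?_ (A.modules.assoc h (add_zero n) (add_zero q) h (syzygyMap s) (syzygyMap t)
      (syzygyIncl L)).symm
    rw [syzygyMap_incl, ← A.modules.assoc (add_zero p) h (zero_add q) h, syzygyMap_incl,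
      A.modules.assoc])

end Syzygy

attribute [irreducible] syzygy syzygyMap syzygyIncl

end DGCat

/-! ### The resolution by free modules -/

namespace DGCat

section Bar

variable {k : Type u} [CommRing k] {A : DGCat.{u, u} k} {M N L : A.modules.Obj}

lemma syzygyIncl_freeCounit (M : A.modules.Obj) :
    A.modules.comp (add_zero 0) (syzygyIncl M) (freeCounit M) = 0 := by
  refine hom_ext fun a p q h x => ?_
  obtain rfl : p = q := by omega
  rw [app_comp (add_zero 0) _ _ a h h, app_freeCounit_syzygyIncl, app_zero]

/-- One step of the resolution by free modules: the counit onto the kernel of the previous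
counit. -/
noncomputable def barStep (M : A.modules.Obj) : A.modules.Hom (free (syzygy M)) (free M) 0 :=
  A.modules.comp (add_zero 0) (freeCounit (syzygy M)) (syzygyIncl M)

lemma isClosed_barStep (M : A.modules.Obj) : A.modules.IsClosed (barStep M) :=
  (isClosed_freeCounit _).comp (isClosed_syzygyIncl _)

lemma barStep_barStep (M : A.modules.Obj) :
    A.modules.comp (add_zero 0) (barStep (syzygy M)) (barStep M) = 0 := by
  rw [barStep, barStep, comp_assoc₀, ← comp_assoc₀ (syzygyIncl _), syzygyIncl_freeCounit]
  simp

lemma barStep_naturality {n : ℤ} (t : A.modules.Hom M N n) :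
    A.modules.comp (add_zero n) (freeMap (syzygyMap t)) (barStep N) =
      A.modules.comp (zero_add n) (barStep M) (freeMap t) := by
  rw [barStep, barStep, A.modules.assoc (add_zero 0) (zero_add n) (zero_add n) (zero_add n),
    ← syzygyMap_incl, ← A.modules.assoc (zero_add n) (add_zero n) (add_zero n) (zero_add n),
    freeCounit_naturality (syzygyMap t),
    A.modules.assoc (add_zero n) (add_zero n) (add_zero 0) (add_zero n)]

lemma barStep_freeCounit (M : A.modules.Obj) :
    A.modules.comp (add_zero 0) (barStep M) (freeCounit M) = 0 := by
  rw [barStep, comp_assoc₀, syzygyIncl_freeCounit]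
  simp

/-- The iterated kernels of the counits. -/
noncomputable def syzygyPow (M : A.modules.Obj) : ℕ → A.modules.Obj
  | 0 => M
  | i + 1 => syzygy (syzygyPow M i)

/-- The effect of the iterated kernels of the counits on graded natural transformations. -/
noncomputable def syzygyPowMap {n : ℤ} (t : A.modules.Hom M N n) :
    ∀ i : ℕ, A.modules.Hom (syzygyPow M i) (syzygyPow N i) n
  | 0 => t
  | i + 1 => syzygyMap (syzygyPowMap t i)

/-- The terms of the resolution of `M` by free modules; the `i`-th term is free on the `i`-th
iterated kernel. -/
noncomputable def bar (M : A.modules.Obj) (i : ℕ) : A.modules.Obj := free (syzygyPow M i)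

/-- The effect of the terms of the resolution by free modules on graded natural transformations. -/
noncomputable def barMap {n : ℤ} (t : A.modules.Hom M N n) (i : ℕ) :
    A.modules.Hom (bar M i) (bar N i) n :=
  freeMap (syzygyPowMap t i)

lemma barMap_add {n : ℤ} (s t : A.modules.Hom M N n) (i : ℕ) :
    barMap (s + t) i = barMap s i + barMap t i := by
  have : syzygyPowMap (s + t) i = syzygyPowMap s i + syzygyPowMap t i := by
    induction i with
    | zero => rfl
    | succ i ih => exact (congrArg syzygyMap ih).trans (map_add (syzygyFunctor A).map _ _)
  exact (congrArg freeMap this).trans (map_add (freeFunctor A).map _ _)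

lemma barMap_smul {n : ℤ} (c : k) (t : A.modules.Hom M N n) (i : ℕ) :
    barMap (c • t) i = c • barMap t i := by
  have : syzygyPowMap (c • t) i = c • syzygyPowMap t i := by
    induction i with
    | zero => rfl
    | succ i ih => exact (congrArg syzygyMap ih).trans (map_smul (syzygyFunctor A).map _ _)
  exact (congrArg freeMap this).trans (map_smul (freeFunctor A).map _ _)

lemma barMap_d {m n : ℤ} (h : m + 1 = n) (t : A.modules.Hom M N m) (i : ℕ) :
    barMap (A.modules.d h t) i = A.modules.d h (barMap t i) := by
  have : syzygyPowMap (A.modules.d h t) i = A.modules.d h (syzygyPowMap t i) := by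
    induction i with
    | zero => rfl
    | succ i ih => exact (congrArg syzygyMap ih).trans ((syzygyFunctor A).map_d h _)
  exact (congrArg freeMap this).trans ((freeFunctor A).map_d h _)

lemma barMap_one (M : A.modules.Obj) (i : ℕ) :
    barMap (A.modules.one M) i = A.modules.one (bar M i) := by
  have : syzygyPowMap (A.modules.one M) i = A.modules.one _ := by
    induction i with
    | zero => rfl
    | succ i ih => exact (congrArg syzygyMap ih).trans ((syzygyFunctor A).map_one _)
  exact (congrArg freeMap this).trans ((freeFunctor A).map_one _)

lemma barMap_comp {p q n : ℤ} (h : p + q = n) (s : A.modules.Hom M N p)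
    (t : A.modules.Hom N L q) (i : ℕ) :
    barMap (A.modules.comp h s t) i = A.modules.comp h (barMap s i) (barMap t i) := by
  have : syzygyPowMap (A.modules.comp h s t) i =
      A.modules.comp h (syzygyPowMap s i) (syzygyPowMap t i) := by
    induction i with
    | zero => rfl
    | succ i ih => exact (congrArg syzygyMap ih).trans ((syzygyFunctor A).map_comp h _ _)
  exact (congrArg freeMap this).trans ((freeFunctor A).map_comp h _ _)

/-- The differential of the resolution of `M` by free modules. -/
noncomputable def barD (M : A.modules.Obj) (i : ℕ) :
    A.modules.Hom (bar M (i + 1)) (bar M i) 0 :=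
  barStep (syzygyPow M i)

lemma isClosed_barD (M : A.modules.Obj) (i : ℕ) : A.modules.IsClosed (barD M i) :=
  isClosed_barStep _

lemma barD_barD (M : A.modules.Obj) (i : ℕ) :
    A.modules.comp (add_zero 0) (barD M (i + 1)) (barD M i) = 0 :=
  barStep_barStep (syzygyPow M i)

lemma barMap_succ {n : ℤ} (t : A.modules.Hom M N n) (i : ℕ) :
    barMap t (i + 1) = freeMap (syzygyMap (syzygyPowMap t i)) := rfl

lemma barD_naturality {n : ℤ} (t : A.modules.Hom M N n) (i : ℕ) :
    A.modules.comp (add_zero n) (barMap t (i + 1)) (barD N i) =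
      A.modules.comp (zero_add n) (barD M i) (barMap t i) :=
  (congrArg (fun f => A.modules.comp (add_zero n) f (barD N i)) (barMap_succ t i)).trans
    (barStep_naturality (syzygyPowMap t i))

end Bar

/-! ### The total module of a complex of modules -/

section Tot

variable {k : Type u} [CommRing k] {A : DGCat.{u, u} k} {N : A.modules.Obj}

/-- The index set of the direct sum of the `L_i(a)^q` over all `i` and `q` with `q - i = n`. -/
structure TotIdx (n : ℤ) where
  i : ℕ
  q : ℤ
  h : q - i = n

variable (L : ℕ → A.modules.Obj) (δ : ∀ i, A.modules.Hom (L (i + 1)) (L i) 0)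

/-- The elements of degree `n` at `a` of the total module of the complex `L`. -/
abbrev TotX (a : A.Obj) (n : ℤ) : Type u :=
  DirectSum (TotIdx n) fun i => El (L i.i) a i.q

open scoped Classical in
/-- The inclusion of the elements of `L_i`. -/
noncomputable def totMk {a : A.Obj} (i : ℕ) {q n : ℤ} (h : q - i = n) :
    El (L i) a q →ₗ[k] TotX L a n :=
  DirectSum.lof k (TotIdx n) (fun i => El (L i.i) a i.q) ⟨i, q, h⟩

variable {L}

open scoped Classical in
/-- The linear map out of the total module with given values on the elements of the `L_i`. -/
noncomputable def totLift {a : A.Obj} {n : ℤ} {Z : Type*} [AddCommGroup Z] [Module k Z]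
    (φ : ∀ (i : ℕ) (q : ℤ), q - i = n → El (L i) a q →ₗ[k] Z) : TotX L a n →ₗ[k] Z :=
  DirectSum.toModule k _ _ fun i => φ i.i i.q i.h

@[simp] lemma totLift_totMk {a : A.Obj} {n : ℤ} {Z : Type*} [AddCommGroup Z] [Module k Z]
    (φ : ∀ (i : ℕ) (q : ℤ), q - i = n → El (L i) a q →ₗ[k] Z) (i : ℕ) {q : ℤ} (h : q - i = n)
    (x : El (L i) a q) : totLift φ (totMk L i h x) = φ i q h x := by
  simp [totLift, totMk]

lemma tot_induction {a : A.Obj} {n : ℤ} {P : TotX L a n → Prop} (y : TotX L a n) (zero : P 0)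
    (add : ∀ x y, P x → P y → P (x + y))
    (mk : ∀ (i : ℕ) (q : ℤ) (h : q - i = n) (x : El (L i) a q), P (totMk L i h x)) : P y := by
  classical
  induction y using DirectSum.induction_on with
  | zero => exact zero
  | of i x => exact mk i.i i.q i.h x
  | add x y hx hy => exact add _ _ hx hy

/-- The part of the differential of the total module that comes from the morphisms
`L_(i + 1) → L_i`. -/
noncomputable def totLow (a : A.Obj) : ∀ (i : ℕ) {q n : ℤ}, q - i + 1 = n →
    El (L i) a q →ₗ[k] TotX L a n
  | 0, _, _, _ => 0
  | i + 1, q, n, h => totMk L i (by push_cast at h; omega : q - i = n) ∘ₗ app (δ i) a (add_zero q)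

/-- The differential of the total module: on `L_i` it is `(-1)^i d` plus the morphism to
`L_(i - 1)`. -/
noncomputable def totD (a : A.Obj) {m n : ℤ} (hmn : m + 1 = n) : TotX L a m →ₗ[k] TotX L a n :=
  totLift fun i q h => (i : ℤ).negOnePow • (totMk L i (by omega : q + 1 - i = n)) ∘ₗ
    dEl (L i) a q (q + 1) + totLow δ a i (by omega)

lemma totD_totMk {a : A.Obj} {m n q q' : ℤ} (i : ℕ) (hmn : m + 1 = n) (h : q - i = m)
    (hq : q + 1 = q') (x : El (L i) a q) :
    totD δ a hmn (totMk L i h x) = (i : ℤ).negOnePow • totMk L i (by omega) (dEl (L i) a q q' x) +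
      totLow δ a i (by omega) x := by
  subst hq
  simp [totD]

/-- The action of the morphisms of `A` on the total module: on `L_i` a morphism of degree `p` acts
with the additional sign `(-1)^(p i)`. -/
noncomputable def totAct {a b : A.Obj} {p q n : ℤ} (h : q + p = n) :
    A.Hom a b p →ₗ[k] TotX L a q →ₗ[k] TotX L b n :=
  LinearMap.flip (totLift fun i r hr => LinearMap.flip
    ((p * i).negOnePow • (act (L i) (rfl : r + p = _)).compr₂
      (totMk L i (by omega : r + p - i = n))))

lemma totAct_totMk {a b : A.Obj} {p q n r s : ℤ} (h : q + p = n) (i : ℕ) (hr : r - i = q)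
    (hs : r + p = s) (f : A.Hom a b p) (x : El (L i) a r) :
    totAct h f (totMk L i hr x) =
      (p * i).negOnePow • totMk L i (by omega) (act (L i) hs f x) := by
  subst hs
  simp [totAct]

/-- The data of the total module of a complex `… → L₂ → L₁ → L₀` of modules. -/
noncomputable abbrev totData (hδ : ∀ i, A.modules.IsClosed (δ i))
    (hδδ : ∀ i, A.modules.comp (add_zero 0) (δ (i + 1)) (δ i) = 0) : ModData A where
  X a n := TotX L a n
  d a m n h := totD δ a h
  d_d a l m n h h' x := by
    induction x using tot_induction with
    | zero => simp
    | add x y hx hy => simp only [map_add, hx, hy, add_zero]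
    | mk i q hi x =>
      rw [totD_totMk δ i h hi rfl, map_add, LinearMap.map_smul_of_tower, totD_totMk δ i h' _ rfl,
        dEl_dEl, map_zero, smul_zero, zero_add]
      cases i with
      | zero => simp [totLow]
      | succ i =>
        simp only [totLow, LinearMap.comp_apply]
        rw [totD_totMk δ i h' _ rfl, (hδ i).dEl_app a (add_zero q) (add_zero _) rfl]
        push_cast
        rw [Int.negOnePow_succ, Units.neg_smul, neg_add_cancel_left]
        cases i with
        | zero => rfl
        | succ i =>
          simp only [totLow, LinearMap.comp_apply]
          rw [← app_comp (add_zero 0) (δ (i + 1)) (δ i) a (add_zero q) (add_zero q), hδδ]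
          simp
  act h := totAct h
  act_one x := by
    induction x using tot_induction with
    | zero => simp
    | add x y hx hy => simp only [map_add, hx, hy]
    | mk i q hi x => rw [totAct_totMk _ _ _ (add_zero q), act_one]; simp
  act_comp {a b c p q r l m n} h h₁ h₂ h₃ f g x := by
    induction x using tot_induction with
    | zero => simp
    | add x y hx hy => simp only [map_add, hx, hy]
    | mk i s hi x =>
      rw [totAct_totMk _ _ _ (by omega : s + l = s + p + q), totAct_totMk _ _ _ rfl,
        LinearMap.map_smul_of_tower, totAct_totMk _ _ _ rfl, smul_smul, ← Int.negOnePow_add,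
        ← add_mul, h, act_comp (L i) h _ rfl rfl]
  d_act {a b p q n p' q' n'} h hp hq hn h₁ h₂ f x := by
    induction x using tot_induction with
    | zero => simp
    | add x y hx hy =>
      simp only [map_add, hx, hy, smul_add]
      abel
    | mk i s hi x =>
      have low : totLow δ b i (by omega : s + p - i + 1 = n') (act (L i) rfl f x) =
          (p * (i + 1)).negOnePow • totAct h₂ f (totLow δ a i (by omega) x) := by
        cases i with
        | zero => simp [totLow]
        | succ i =>
          simp only [totLow, LinearMap.comp_apply]
          rw [totAct_totMk _ _ _ rfl, app_act₀ (δ i) rfl (add_zero _) (add_zero _) rfl, smul_smul,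
            ← Int.negOnePow_add]
          push_cast
          rw [negOnePow_smul_congr (n := 0), Int.negOnePow_zero, one_smul]
          exact ⟨p * (i + 1), by ring⟩
      rw [totAct_totMk h i hi rfl, totAct_totMk h₁ i hi (by omega : s + p' = s + p + 1),
        LinearMap.map_smul_of_tower, totD_totMk δ i _ _ rfl, totD_totMk δ i _ _ rfl,
        map_add, LinearMap.map_smul_of_tower, totAct_totMk h₂ i _ (by omega : s + 1 + p = s + p + 1),
        dEl_act (L i) rfl hp rfl rfl, low]
      simp only [map_add, smul_add, smul_smul, LinearMap.map_smul_of_tower, ← Int.negOnePow_add]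
      have e₁ : ∀ y : TotX L b n', (p * i + i).negOnePow • y = (p' * i).negOnePow • y :=
        fun y => negOnePow_smul_congr ⟨0, by rw [← hp]; ring⟩ y
      have e₂ : ∀ y : TotX L b n', (p * i + (i + p)).negOnePow • y = (p + (i + p * i)).negOnePow • y :=
        fun y => negOnePow_smul_congr ⟨0, by ring⟩ y
      have e₃ : ∀ y : TotX L b n', (p * i + p * (i + 1)).negOnePow • y = p.negOnePow • y :=
        fun y => negOnePow_smul_congr ⟨p * i, by ring⟩ y
      rw [e₁, e₂, e₃, add_assoc]

variable {δ} (hδ : ∀ i, A.modules.IsClosed (δ i))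
  (hδδ : ∀ i, A.modules.comp (add_zero 0) (δ (i + 1)) (δ i) = 0)

/-- The total module of a complex `… → L₂ → L₁ → L₀` of modules. -/
noncomputable def tot : A.modules.Obj := (totData δ hδ hδδ).toModule

/-- The elements of the total module. -/
noncomputable def totEl (a : A.Obj) (n : ℤ) : TotX L a n ≃ₗ[k] El (tot hδ hδδ) a n :=
  (totData δ hδ hδδ).el

lemma totEl_units_smul {a : A.Obj} {n : ℤ} (c : ℤˣ) (x : TotX L a n) :
    totEl hδ hδδ a n (c • x) = c • totEl hδ hδδ a n x := by
  obtain rfl | rfl := Int.units_eq_one_or c <;> simp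

/-- The inclusion of `L_i` in the total module, of degree `-i`. -/
noncomputable def totIncl (i : ℕ) : A.modules.Hom (L i) (tot hδ hδδ) (-i) :=
  ModData.lift (D := totData δ hδ hδδ)
    (fun a p q h => totMk L i (by omega : p - i = q)) (by
      intro a b p q r s l h₁ h₂ h₃ h₄ f x
      rw [totAct_totMk h₄ i _ h₁, smul_smul, ← Int.negOnePow_add, negOnePow_smul_congr (n := 0)]
      · simp
      · exact ⟨0, by ring⟩)

lemma app_totIncl (i : ℕ) (a : A.Obj) {p q : ℤ} (h : p + -i = q) (x : El (L i) a p) :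
    app (totIncl hδ hδδ i) a h x = totEl hδ hδδ a q (totMk L i (by omega) x) := rfl

lemma dEl_totIncl (a : A.Obj) (i : ℕ) {m n p : ℤ} (h : m + 1 = n) (hp : p + -i = m)
    (x : El (L i) a p) :
    dEl (tot hδ hδδ) a m n (app (totIncl hδ hδδ i) a hp x) = totEl hδ hδδ a n
      (totD δ a h (totMk L i (by omega) x)) := by
  rw [app_totIncl]
  exact ModData.dEl_el _ h _

lemma d_totIncl_zero : A.modules.d (by simp : -((0 : ℕ) : ℤ) + 1 = 1) (totIncl hδ hδδ 0) = 0 := by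
  refine hom_ext fun a p q h x => ?_
  rw [app_d _ _ a h rfl rfl, dEl_totIncl hδ hδδ a 0 (by omega), app_totIncl,
    totD_totMk δ 0 _ _ rfl, map_add, totEl_units_smul, Int.negOnePow_neg, add_sub_right_comm,
    sub_self, zero_add]
  exact map_zero _

lemma d_totIncl_succ (i : ℕ) :
    A.modules.d (by push_cast; ring : -((i + 1 : ℕ) : ℤ) + 1 = -i) (totIncl hδ hδδ (i + 1)) =
      A.modules.comp (zero_add (-(i : ℤ))) (δ i) (totIncl hδ hδδ i) := by
  refine hom_ext fun a p q h x => ?_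
  rw [app_d _ _ a h rfl rfl, dEl_totIncl hδ hδδ a (i + 1) (by push_cast; omega), app_totIncl,
    totD_totMk δ (i + 1) _ _ rfl, app_comp _ _ _ _ h (add_zero p), app_totIncl, map_add,
    totEl_units_smul, Int.negOnePow_neg, add_sub_cancel_left]
  rfl

lemma tot_el_induction {a : A.Obj} {n : ℤ} {P : El (tot hδ hδδ) a n → Prop}
    (y : El (tot hδ hδδ) a n) (zero : P 0) (add : ∀ x y, P x → P y → P (x + y))
    (mk : ∀ (i : ℕ) (q : ℤ) (h : q + -i = n) (x : El (L i) a q),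
      P (app (totIncl hδ hδδ i) a h x)) : P y := by
  obtain ⟨y, rfl⟩ := (totData δ hδ hδδ).exists_el y
  induction y using tot_induction with
  | zero => rw [map_zero]; exact zero
  | add x y hx hy => rw [map_add]; exact add _ _ hx hy
  | mk i q h x => exact mk i q (by omega) x

/-- A linear map out of the elements of the total module. -/
noncomputable def totElLift {a : A.Obj} {n : ℤ} {Z : Type*} [AddCommGroup Z] [Module k Z]
    (φ : ∀ (i : ℕ) (q : ℤ), q + -i = n → El (L i) a q →ₗ[k] Z) : El (tot hδ hδδ) a n →ₗ[k] Z :=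
  (totLift fun i q h => φ i q (by omega)) ∘ₗ ((totData δ hδ hδδ).el (a := a) (n := n)).symm.toLinearMap

lemma totElLift_incl {a : A.Obj} {n : ℤ} {Z : Type*} [AddCommGroup Z] [Module k Z]
    (φ : ∀ (i : ℕ) (q : ℤ), q + -i = n → El (L i) a q →ₗ[k] Z) (i : ℕ) {q : ℤ} (h : q + -i = n)
    (x : El (L i) a q) : totElLift hδ hδδ φ (app (totIncl hδ hδδ i) a h x) = φ i q h x :=
  totLift_totMk _ i _ x

lemma tot_hom_ext {n : ℤ} {s t : A.modules.Hom (tot hδ hδδ) N n}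
    (h : ∀ i : ℕ, A.modules.comp (by ring : -(i : ℤ) + n = n - i) (totIncl hδ hδδ i) s =
      A.modules.comp (by ring : -(i : ℤ) + n = n - i) (totIncl hδ hδδ i) t) : s = t := by
  refine hom_ext fun a p q hpq x => ?_
  induction x using tot_el_induction with
  | zero => simp
  | add x y hx hy => simp only [map_add, hx, hy]
  | mk i r hr x =>
    have := congrArg (fun f => app f a (by omega : r + (n - i) = q) x) (h i)
    rwa [app_comp _ _ _ _ _ hr, app_comp _ _ _ _ _ hr] at this

/-- The graded natural transformation out of the total module given by its restrictions to the
`L_i`. -/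
noncomputable def totDesc {n : ℤ} (g : ∀ i : ℕ, A.modules.Hom (L i) N (n - i)) :
    A.modules.Hom (tot hδ hδδ) N n :=
  mkHom (M := tot hδ hδδ) (fun a p q hpq => totElLift hδ hδδ fun i r hr =>
      app (g i) a (by omega : r + (n - i) = q)) (by
    intro a b p q r s l h₁ h₂ h₃ h₄ f x
    induction x using tot_el_induction with
    | zero => simp
    | add x y hx hy => simp only [map_add, hx, hy, smul_add]
    | mk i t ht x =>
      have e := app_act (totIncl hδ hδδ i) (rfl : t + p = _) (by omega : t + p + -i = r) ht f x
      have e' := app_act (g i) (rfl : t + p = _) (by omega : t + p + (n - i) = s)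
        (by omega : t + (n - i) = l) f x
      have e'' : act (tot hδ hδδ) h₁ f (app (totIncl hδ hδδ i) a ht x) =
          (p * -i).negOnePow • app (totIncl hδ hδδ i) b (by omega) (act (L i) rfl f x) := by
        rw [e, smul_smul, ← Int.negOnePow_add, negOnePow_smul_congr (n := 0)]
        · simp
        · exact ⟨-p * i, by ring⟩
      rw [e'', LinearMap.map_smul_of_tower, totElLift_incl, totElLift_incl, e', smul_smul,
        ← Int.negOnePow_add]
      exact negOnePow_smul_congr ⟨-p * i, by ring⟩ _)

lemma app_totDesc_incl {n : ℤ} (g : ∀ i : ℕ, A.modules.Hom (L i) N (n - i)) (i : ℕ) (a : A.Obj)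
    {p q r : ℤ} (h : p + -i = q) (h' : q + n = r) (h'' : p + (n - i) = r) (x : El (L i) a p) :
    app (totDesc hδ hδδ g) a h' (app (totIncl hδ hδδ i) a h x) = app (g i) a h'' x := by
  exact totElLift_incl hδ hδδ (fun i r hr => app (g i) a (by omega)) i h x

lemma totIncl_desc {n : ℤ} (g : ∀ i : ℕ, A.modules.Hom (L i) N (n - i)) (i : ℕ) :
    A.modules.comp (by ring : -(i : ℤ) + n = n - i) (totIncl hδ hδδ i) (totDesc hδ hδδ g) =
      g i := by
  refine hom_ext fun a p q hpq x => ?_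
  rw [app_comp _ _ _ _ _ (rfl : p + -i = _), app_totDesc_incl _ _ _ _ _ _ _ hpq]

end Tot

attribute [irreducible] tot totIncl totDesc totElLift

end DGCat

/-! ### The cofibrant replacement functor -/

namespace DGCat

section CofRep

variable {k : Type u} [CommRing k] {A : DGCat.{u, u} k} {M N L : A.modules.Obj}

lemma negOnePow_smul_left {B : DGCat.{v, w} k} {x y z : B.Obj} {p q n : ℤ} (h : p + q = n) (c : ℤ)
    (f : B.Hom x y p) (g : B.Hom y z q) :
    B.comp h (c.negOnePow • f) g = c.negOnePow • B.comp h f g := by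
  obtain e | e := Int.units_eq_one_or c.negOnePow <;> simp [e]

lemma negOnePow_smul_right {B : DGCat.{v, w} k} {x y z : B.Obj} {p q n : ℤ} (h : p + q = n) (c : ℤ)
    (f : B.Hom x y p) (g : B.Hom y z q) :
    B.comp h f (c.negOnePow • g) = c.negOnePow • B.comp h f g := by
  obtain e | e := Int.units_eq_one_or c.negOnePow <;> simp [e]

lemma d_negOnePow_smul {B : DGCat.{v, w} k} {x y : B.Obj} {p q : ℤ} (h : p + 1 = q) (c : ℤ)
    (f : B.Hom x y p) : B.d h (c.negOnePow • f) = c.negOnePow • B.d h f := by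
  obtain e | e := Int.units_eq_one_or c.negOnePow <;> simp [e]

/-- The cofibrant replacement of a module: the total module of its resolution by free modules. -/
noncomputable def cofRep (M : A.modules.Obj) : A.modules.Obj := tot (isClosed_barD M) (barD_barD M)

/-- The inclusion in the cofibrant replacement of the terms of the resolution. -/
noncomputable def cofIncl (M : A.modules.Obj) (i : ℕ) : A.modules.Hom (bar M i) (cofRep M) (-i) :=
  totIncl (isClosed_barD M) (barD_barD M) i

lemma cofRep_hom_ext {n : ℤ} {s t : A.modules.Hom (cofRep M) N n}
    (h : ∀ (i : ℕ) (l : ℤ) (hl : -(i : ℤ) + n = l), A.modules.comp hl (cofIncl M i) s =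
      A.modules.comp hl (cofIncl M i) t) : s = t :=
  tot_hom_ext _ _ fun i => h i _ _

lemma d_cofIncl_zero {n : ℤ} (h : -((0 : ℕ) : ℤ) + 1 = n) : A.modules.d h (cofIncl M 0) = 0 := by
  subst h
  exact d_totIncl_zero _ _

lemma d_cofIncl_succ (i : ℕ) (h : -((i + 1 : ℕ) : ℤ) + 1 = -i) :
    A.modules.d h (cofIncl M (i + 1)) =
      A.modules.comp (zero_add (-(i : ℤ))) (barD M i) (cofIncl M i) :=
  d_totIncl_succ _ _ i

/-- The morphism out of the cofibrant replacement with given values on the terms of the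
resolution. -/
noncomputable def cofDesc {n : ℤ} (g : ∀ i : ℕ, A.modules.Hom (bar M i) N (n - i)) :
    A.modules.Hom (cofRep M) N n := totDesc (isClosed_barD M) (barD_barD M) g

lemma cofIncl_desc {n : ℤ} (g : ∀ i : ℕ, A.modules.Hom (bar M i) N (n - i)) (i : ℕ)
    (h : -(i : ℤ) + n = n - i) :
    A.modules.comp h (cofIncl M i) (cofDesc g) = g i :=
  totIncl_desc _ _ g i

/-- The linear map out of the elements of the cofibrant replacement with given values on the terms
of the resolution. -/
noncomputable def cofElLift {a : A.Obj} {n : ℤ} {Z : Type*} [AddCommGroup Z] [Module k Z]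
    (φ : ∀ (i : ℕ) (q : ℤ), q + -i = n → El (bar M i) a q →ₗ[k] Z) :
    El (cofRep M) a n →ₗ[k] Z :=
  totElLift (isClosed_barD M) (barD_barD M) φ

lemma cofElLift_incl {a : A.Obj} {n : ℤ} {Z : Type*} [AddCommGroup Z] [Module k Z]
    (φ : ∀ (i : ℕ) (q : ℤ), q + -i = n → El (bar M i) a q →ₗ[k] Z) (i : ℕ) {q : ℤ}
    (h : q + -i = n) (x : El (bar M i) a q) :
    cofElLift φ (app (cofIncl M i) a h x) = φ i q h x :=
  totElLift_incl _ _ φ i h x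

lemma cofRep_el_induction {a : A.Obj} {n : ℤ} {P : El (cofRep M) a n → Prop}
    (y : El (cofRep M) a n) (zero : P 0) (add : ∀ x y, P x → P y → P (x + y))
    (mk : ∀ (i : ℕ) (q : ℤ) (h : q + -i = n) (x : El (bar M i) a q),
      P (app (cofIncl M i) a h x)) : P y :=
  tot_el_induction _ _ y zero add mk

attribute [irreducible] cofRep cofIncl cofDesc cofElLift

/-- The effect of the cofibrant replacement on graded natural transformations. The sign compensates
for the degree `-i` of the inclusion of the `i`-th term. -/
noncomputable def cofMap {n : ℤ} (t : A.modules.Hom M N n) :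
    A.modules.Hom (cofRep M) (cofRep N) n :=
  cofDesc fun i => (i * n).negOnePow • A.modules.comp (by ring) (barMap t i) (cofIncl N i)

lemma cofIncl_map {n l : ℤ} (t : A.modules.Hom M N n) (i : ℕ) (h : -(i : ℤ) + n = l)
    (h' : n + -(i : ℤ) = l) :
    A.modules.comp h (cofIncl M i) (cofMap t) =
      (i * n).negOnePow • A.modules.comp h' (barMap t i) (cofIncl N i) := by
  obtain rfl : n - i = l := by omega
  exact cofIncl_desc _ i _

lemma cofMap_d {m n : ℤ} (h : m + 1 = n) (t : A.modules.Hom M N m) :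
    cofMap (A.modules.d h t) = A.modules.d h (cofMap t) := by
  refine cofRep_hom_ext fun i l hl => ?_
  rw [cofIncl_map _ i _ (by omega)]
  have e := congrArg (A.modules.d (by omega : m - i + 1 = l))
    (cofIncl_map t i (by omega : -(i : ℤ) + m = m - i) (by omega))
  cases i with
  | zero =>
    rw [A.modules.d_comp _ (rfl : -((0 : ℕ) : ℤ) + 1 = _) h _ (by omega) (by omega),
      d_negOnePow_smul, A.modules.d_comp _ h (rfl : -((0 : ℕ) : ℤ) + 1 = _) _ (by omega) (by omega),
      ← barMap_d h, d_cofIncl_zero, d_cofIncl_zero] at e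
    simpa using e.symm
  | succ i =>
    have e₁ : -((i + 1 : ℕ) : ℤ) + 1 = -i := by push_cast; ring
    rw [A.modules.d_comp _ e₁ h _ (by omega) (by push_cast at hl; omega),
      d_negOnePow_smul, A.modules.d_comp _ h e₁ _ (by push_cast at hl; omega) (by omega),
      ← barMap_d h, d_cofIncl_succ, d_cofIncl_succ,
      A.modules.assoc _ _ rfl (by push_cast at hl; omega),
      cofIncl_map t i rfl (by omega), negOnePow_smul_right,
      ← A.modules.assoc (add_zero m) (by push_cast at hl; omega) _ _, barD_naturality,
      A.modules.assoc (zero_add m) _ (by omega : m + -(i : ℤ) = -i + m)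
        (by push_cast at hl; omega), smul_add, smul_smul,
      smul_smul, ← Int.negOnePow_add, ← Int.negOnePow_add,
      negOnePow_smul_congr (m := m + i * m) (n := ((i + 1 : ℕ) : ℤ) * m)
        ⟨0, by push_cast; ring⟩] at e
    rw [add_left_cancel ((add_comm _ _).trans e)]
    exact negOnePow_smul_congr ⟨i + 1, by rw [← h]; push_cast; ring⟩ _

lemma cofMap_one (M : A.modules.Obj) : cofMap (A.modules.one M) = A.modules.one (cofRep M) := by
  refine cofRep_hom_ext fun i l hl => ?_
  rw [cofIncl_map _ i _ (by omega), barMap_one]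
  obtain rfl : -(i : ℤ) = l := by omega
  rw [A.modules.one_comp, A.modules.comp_one]
  simp

lemma cofMap_comp {p q n : ℤ} (h : p + q = n) (s : A.modules.Hom M N p) (t : A.modules.Hom N L q) :
    cofMap (A.modules.comp h s t) = A.modules.comp h (cofMap s) (cofMap t) := by
  refine cofRep_hom_ext fun i l hl => ?_
  rw [cofIncl_map _ i _ (by omega), barMap_comp, ← A.modules.assoc (rfl : -(i : ℤ) + p = _) (by omega),
    cofIncl_map s i rfl (by omega), negOnePow_smul_left,
    A.modules.assoc _ (by omega) (rfl : -(i : ℤ) + q = _) (by omega), cofIncl_map t i rfl (by omega),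
    negOnePow_smul_right, smul_smul, ← Int.negOnePow_add, ← mul_add, h,
    A.modules.assoc h _ (by omega : q + -(i : ℤ) = -i + q) _]

/-- The cofibrant replacement as a DG-functor. -/
noncomputable def cofFunctor (A : DGCat.{u, u} k) : DGFunctor A.modules A.modules where
  obj := cofRep
  map {M N n} :=
    { toFun := cofMap
      map_add' := fun s t => cofRep_hom_ext fun i l hl => by
        rw [cofIncl_map _ i _ (by omega), map_add, cofIncl_map _ i _ (by omega),
          cofIncl_map _ i _ (by omega), barMap_add, map_add, LinearMap.add_apply, smul_add]
      map_smul' := fun c t => cofRep_hom_ext fun i l hl => by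
        rw [cofIncl_map _ i _ (by omega), map_smul, cofIncl_map _ i _ (by omega),
          barMap_smul, map_smul, LinearMap.smul_apply, smul_comm]
        rfl }
  map_d h t := cofMap_d h t
  map_one M := cofMap_one M
  map_comp h s t := cofMap_comp h s t

/-- The augmentation of the resolution of `M` by free modules. -/
noncomputable def barCounit (M : A.modules.Obj) : A.modules.Hom (bar M 0) M 0 := freeCounit M

/-- The natural morphism from the cofibrant replacement of `M` to `M`. -/
noncomputable def cofCounit (M : A.modules.Obj) : A.modules.Hom (cofRep M) M 0 :=
  cofDesc fun i => match i with
    -- composing with the identity moves `barCounit M` to the degree `0 - ((0 : ℕ) : ℤ)`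
    | 0 => A.modules.comp (by simp) (barCounit M) (A.modules.one M)
    | _ + 1 => 0

lemma cofIncl_zero_counit {l : ℤ} (h : -((0 : ℕ) : ℤ) + 0 = l) :
    A.modules.comp h (cofIncl M 0) (cofCounit M) =
      A.modules.comp (by simpa using h : (0 : ℤ) + 0 = l) (barCounit M) (A.modules.one M) := by
  obtain rfl : (0 : ℤ) - (0 : ℕ) = l := by simpa using h
  exact cofIncl_desc _ 0 _

lemma cofIncl_succ_counit (i : ℕ) {l : ℤ} (h : -((i + 1 : ℕ) : ℤ) + 0 = l) :
    A.modules.comp h (cofIncl M (i + 1)) (cofCounit M) = 0 := by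
  obtain rfl : (0 : ℤ) - (i + 1 : ℕ) = l := by omega
  exact cofIncl_desc _ (i + 1) _

lemma barCounit_naturality {n : ℤ} (t : A.modules.Hom M N n) :
    A.modules.comp (zero_add n) (barCounit M) t =
      A.modules.comp (add_zero n) (barMap t 0) (barCounit N) :=
  freeCounit_naturality t

lemma barD_barCounit (M : A.modules.Obj) :
    A.modules.comp (add_zero 0) (barD M 0) (barCounit M) = 0 :=
  barStep_freeCounit M

lemma isClosed_barCounit (M : A.modules.Obj) : A.modules.IsClosed (barCounit M) :=
  isClosed_freeCounit M

lemma cofCounit_naturality {n : ℤ} (t : A.modules.Hom M N n) :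
    A.modules.comp (zero_add n) (cofCounit M) t =
      A.modules.comp (add_zero n) (cofMap t) (cofCounit N) := by
  refine cofRep_hom_ext fun i l hl => ?_
  rw [← A.modules.assoc (add_zero (-(i : ℤ))) (by omega), ← A.modules.assoc rfl (by omega),
    cofIncl_map t i rfl (by omega), negOnePow_smul_left,
    A.modules.assoc _ _ (add_zero (-(i : ℤ))) (by omega)]
  cases i with
  | zero =>
    rw [cofIncl_zero_counit, cofIncl_zero_counit]
    obtain rfl : n = l := by simpa using hl
    rw [A.modules.assoc _ _ (zero_add n) (by simp), A.modules.one_comp]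
    simp only [Nat.cast_zero, neg_zero, zero_mul, Int.negOnePow_zero, one_smul]
    rw [barCounit_naturality]
    exact congrArg _ (A.modules.comp_one _).symm
  | succ i =>
    rw [cofIncl_succ_counit, cofIncl_succ_counit]
    simp

lemma isClosed_cofCounit (M : A.modules.Obj) : A.modules.IsClosed (cofCounit M) := by
  refine cofRep_hom_ext fun i l hl => ?_
  rw [map_zero]
  cases i with
  | zero =>
    have e := congrArg (A.modules.d (by omega : -((0 : ℕ) : ℤ) + 1 = l))
      (cofIncl_zero_counit (M := M) (add_zero _))
    rw [A.modules.d_comp _ rfl (zero_add 1) _ hl (by omega),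
      A.modules.d_comp _ (zero_add 1) (zero_add 1) _ (by omega) (by omega),
      show A.modules.d (zero_add 1) (barCounit M) = 0 from isClosed_barCounit M,
      show A.modules.d (zero_add 1) (A.modules.one M) = 0 from isClosed_one _ M,
      d_cofIncl_zero] at e
    simpa using e
  | succ i =>
    have e₁ : -((i + 1 : ℕ) : ℤ) + 1 = -i := by push_cast; ring
    have e := congrArg (A.modules.d (by omega : -((i + 1 : ℕ) : ℤ) + 1 = l))
      (cofIncl_succ_counit (M := M) i (add_zero _))
    rw [A.modules.d_comp _ e₁ (zero_add 1) _ hl (by omega), d_cofIncl_succ, map_zero,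
      A.modules.assoc _ _ (add_zero (-(i : ℤ))) (by omega)] at e
    have e₂ : A.modules.comp (by omega : 0 + -(i : ℤ) = l) (barD M i)
        (A.modules.comp (add_zero (-(i : ℤ))) (cofIncl M i) (cofCounit M)) = 0 := by
      cases i with
      | zero =>
        rw [cofIncl_zero_counit, ← A.modules.assoc (add_zero 0) (by omega) _ _, barD_barCounit]
        simp
      | succ i => rw [cofIncl_succ_counit, map_zero]
    rwa [e₂, smul_zero, add_zero] at e

/-! ### The cofibrant replacement is a resolution -/

lemma app_cofCounit_zero (a : A.Obj) {p q : ℤ} (h : p + -((0 : ℕ) : ℤ) = q) (h' : q + 0 = p)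
    (x : El (bar M 0) a p) :
    app (cofCounit M) a h' (app (cofIncl M 0) a h x) = app (barCounit M) a (add_zero p) x := by
  have e := congrArg (fun f => app f a (by omega : p + 0 = p) x)
    (cofIncl_zero_counit (M := M) (by simp : -((0 : ℕ) : ℤ) + 0 = 0))
  rw [app_comp _ _ _ a _ h, app_comp (add_zero 0) _ _ a (add_zero p) (add_zero p), app_one] at e
  exact e

lemma app_cofCounit_succ (i : ℕ) (a : A.Obj) {p q r : ℤ} (h : p + -((i + 1 : ℕ) : ℤ) = q)
    (h' : q + 0 = r) (x : El (bar M (i + 1)) a p) :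
    app (cofCounit M) a h' (app (cofIncl M (i + 1)) a h x) = 0 := by
  have e := congrArg (fun f => app f a (by omega : p + -((i + 1 : ℕ) : ℤ) = r) x)
    (cofIncl_succ_counit (M := M) i (add_zero _))
  rwa [app_comp _ _ _ a _ h] at e

lemma dEl_cofIncl_zero (a : A.Obj) {p p' q q' : ℤ} (h : p + -((0 : ℕ) : ℤ) = q)
    (hp : p + 1 = p') (h' : p' + -((0 : ℕ) : ℤ) = q') (x : El (bar M 0) a p) :
    dEl (cofRep M) a q q' (app (cofIncl M 0) a h x) =
      app (cofIncl M 0) a h' (dEl (bar M 0) a p p' x) := by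
  rw [dEl_app (d_cofIncl_zero _) a h h' hp]
  simp

lemma dEl_cofIncl_succ (i : ℕ) (a : A.Obj) {p p' q q' : ℤ} (h : p + -((i + 1 : ℕ) : ℤ) = q)
    (hp : p + 1 = p') (h' : p' + -((i + 1 : ℕ) : ℤ) = q') (h'' : p + -(i : ℤ) = q')
    (x : El (bar M (i + 1)) a p) :
    dEl (cofRep M) a q q' (app (cofIncl M (i + 1)) a h x) =
      app (cofIncl M i) a h'' (app (barD M i) a (add_zero p) x) +
        ((i + 1 : ℕ) : ℤ).negOnePow •
          app (cofIncl M (i + 1)) a h' (dEl (bar M (i + 1)) a p p' x) := by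
  have e := congrArg (fun f => app f a h'' x) (d_cofIncl_succ (M := M) i (by push_cast; ring))
  rw [app_d _ _ a h'' hp h, app_comp _ _ _ a h'' (add_zero p), Int.negOnePow_neg] at e
  rw [← e, sub_add_cancel]

/-- The map sending `x` to the element of the kernel of the counit that is `x - 1 ⊗ ε x`. -/
noncomputable def toSyzygy (M : A.modules.Obj) (a : A.Obj) (p : ℤ) :
    El (free M) a p →ₗ[k] El (syzygy M) a p :=
  (LinearEquiv.ofInjective _ (syzygyIncl_injective (M := M) a p)).symm.toLinearMap ∘ₗ
    (LinearMap.id - gen M a p ∘ₗ app (freeCounit M) a (add_zero p)).codRestrict _ (by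
      intro x
      obtain ⟨z, hz⟩ := exists_syzygy (x - gen M a p (app (freeCounit M) a (add_zero p) x)) (by
        simp)
      exact ⟨z, hz⟩)

lemma app_syzygyIncl_toSyzygy (a : A.Obj) (p : ℤ) (x : El (free M) a p) :
    app (syzygyIncl M) a (add_zero p) (toSyzygy M a p x) =
      x - gen M a p (app (freeCounit M) a (add_zero p) x) := by
  have e := (LinearEquiv.ofInjective _ (syzygyIncl_injective (M := M) a p)).apply_symm_apply
    ((LinearMap.id - gen M a p ∘ₗ app (freeCounit M) a (add_zero p)).codRestrict _ (by
      intro x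
      obtain ⟨z, hz⟩ := exists_syzygy (x - gen M a p (app (freeCounit M) a (add_zero p) x)) (by
        simp)
      exact ⟨z, hz⟩) x)
  exact congrArg Subtype.val e

lemma toSyzygy_incl (a : A.Obj) (p : ℤ) (x : El (syzygy M) a p) :
    toSyzygy M a p (app (syzygyIncl M) a (add_zero p) x) = x := by
  apply syzygyIncl_injective a p
  rw [app_syzygyIncl_toSyzygy, app_freeCounit_syzygyIncl, map_zero, sub_zero]

lemma dEl_toSyzygy (a : A.Obj) {p q : ℤ} (h : p + 1 = q) (x : El (free M) a p) :
    dEl (syzygy M) a p q (toSyzygy M a p x) = toSyzygy M a q (dEl (free M) a p q x) := by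
  apply syzygyIncl_injective a q
  rw [← (isClosed_syzygyIncl M).dEl_app a (add_zero p) (add_zero q) h, app_syzygyIncl_toSyzygy,
    app_syzygyIncl_toSyzygy, map_sub, dEl_gen _ _ _ h,
    (isClosed_freeCounit M).dEl_app a (add_zero p) (add_zero q) h]

/-- The idempotent `x ↦ 1 ⊗ ε x` of a term of the resolution, where `ε` is the counit. -/
noncomputable def barSplit (M : A.modules.Obj) (i : ℕ) (a : A.Obj) (p : ℤ) :
    El (bar M i) a p →ₗ[k] El (bar M i) a p :=
  gen (syzygyPow M i) a p ∘ₗ app (freeCounit (syzygyPow M i)) a (add_zero p)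

/-- The contraction `x ↦ 1 ⊗ (x - 1 ⊗ ε x)` of the resolution at an object; it is not compatible
with the action of `A`. -/
noncomputable def barContr (M : A.modules.Obj) (i : ℕ) (a : A.Obj) (p : ℤ) :
    El (bar M i) a p →ₗ[k] El (bar M (i + 1)) a p :=
  gen (syzygyPow M (i + 1)) a p ∘ₗ toSyzygy (syzygyPow M i) a p

lemma dEl_barContr (i : ℕ) (a : A.Obj) {p q : ℤ} (h : p + 1 = q) (x : El (bar M i) a p) :
    dEl (bar M (i + 1)) a p q (barContr M i a p x) = barContr M i a q (dEl (bar M i) a p q x) :=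
  (dEl_gen a p q h _).trans (congrArg _ (dEl_toSyzygy a h x))

lemma app_barStep (a : A.Obj) {p : ℤ} (x : El (free (syzygy M)) a p) :
    app (barStep M) a (add_zero p) x =
      app (syzygyIncl M) a (add_zero p) (app (freeCounit (syzygy M)) a (add_zero p) x) :=
  app_comp (add_zero 0) _ _ a (add_zero p) (add_zero p) x

lemma barD_barContr (i : ℕ) (a : A.Obj) {p : ℤ} (x : El (bar M i) a p) :
    app (barD M i) a (add_zero p) (barContr M i a p x) = x - barSplit M i a p x := by
  refine (app_barStep a _).trans ?_
  refine Eq.trans (congrArg _ ?_) (app_syzygyIncl_toSyzygy a p x)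
  exact (app_freeCounit_gen a (add_zero p) _).trans (app_one a _ _)

lemma barContr_barD (i : ℕ) (a : A.Obj) {p : ℤ} (x : El (bar M (i + 1)) a p) :
    barContr M i a p (app (barD M i) a (add_zero p) x) = barSplit M (i + 1) a p x :=
  congrArg (gen (syzygyPow M (i + 1)) a p)
    ((congrArg _ (app_barStep a x)).trans (toSyzygy_incl a p _))

/-- The inclusion of the generators of the first term of the resolution. -/
noncomputable def barGen (M : A.modules.Obj) (a : A.Obj) (p : ℤ) :
    El M a p →ₗ[k] El (bar M 0) a p := gen M a p

lemma barCounit_barGen (a : A.Obj) {p : ℤ} (x : El M a p) :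
    app (barCounit M) a (add_zero p) (barGen M a p x) = x :=
  (app_freeCounit_gen a (add_zero p) x).trans (app_one a _ x)

lemma dEl_barGen (a : A.Obj) {p q : ℤ} (h : p + 1 = q) (x : El M a p) :
    dEl (bar M 0) a p q (barGen M a p x) = barGen M a q (dEl M a p q x) :=
  dEl_gen a p q h x

lemma barSplit_zero (a : A.Obj) {p : ℤ} (x : El (bar M 0) a p) :
    barSplit M 0 a p x = barGen M a p (app (barCounit M) a (add_zero p) x) := rfl

attribute [irreducible] barCounit barGen barContr barSplit

lemma app_cofCounit_cofIncl_barGen (a : A.Obj) {p q : ℤ} (h : p + -((0 : ℕ) : ℤ) = q)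
    (h' : q + 0 = p) (x : El M a p) :
    app (cofCounit M) a h' (app (cofIncl M 0) a h (barGen M a p x)) = x := by
  rw [app_cofCounit_zero, barCounit_barGen]

/-- The contraction of the resolution as a map of degree `-1` of the cofibrant replacement. -/
noncomputable def cofContr (M : A.modules.Obj) (a : A.Obj) {m n : ℤ} (h : m + 1 = n) :
    El (cofRep M) a n →ₗ[k] El (cofRep M) a m :=
  cofElLift fun i q hq => app (cofIncl M (i + 1)) a (by push_cast; omega) ∘ₗ barContr M i a q

/-- The identity of the cofibrant replacement is homotopic, at every object, to the counit followed
by the inclusion of `M` in the first term of the resolution. -/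
lemma cofContr_htpy (a : A.Obj) {m n r : ℤ} (h : m + 1 = n) (hr : n + 1 = r)
    (x : El (cofRep M) a n) :
    dEl (cofRep M) a m n (cofContr M a h x) + cofContr M a hr (dEl (cofRep M) a n r x) =
      x - app (cofIncl M 0) a (by simp) (barGen M a n (app (cofCounit M) a (add_zero n) x)) := by
  induction x using cofRep_el_induction with
  | zero => simp
  | add x y hx hy =>
    simp only [map_add]
    rw [add_add_add_comm, hx, hy]
    abel
  | mk i q hq x =>
    rw [cofContr, cofElLift_incl]
    simp only [LinearMap.comp_apply]
    rw [dEl_cofIncl_succ i a _ rfl (by push_cast; omega) hq, barD_barContr, dEl_barContr i a rfl]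
    cases i with
    | zero =>
      obtain rfl : q = n := by simpa using hq
      rw [dEl_cofIncl_zero a hq rfl (by omega), cofContr, cofElLift_incl, app_cofCounit_zero,
        barSplit_zero]
      simp
    | succ i =>
      rw [dEl_cofIncl_succ i a hq rfl (by omega) (by push_cast at hq; omega), map_add,
        LinearMap.map_smul_of_tower, cofContr, cofElLift_incl, cofElLift_incl, app_cofCounit_succ]
      simp only [LinearMap.comp_apply]
      rw [barContr_barD]
      push_cast
      rw [Int.negOnePow_succ (_ + 1)]
      simp only [Units.neg_smul, map_sub, map_zero, sub_zero]
      abel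

lemma isQuasiIso_cofCounit (M : A.modules.Obj) : IsQuasiIso (cofCounit M) := by
  rw [isQuasiIso_iff]
  refine ⟨isClosed_cofCounit M, fun a => ⟨fun m n hm x hx ⟨y, hy⟩ => ?_, fun m n hm y hy => ?_⟩⟩
  · refine ⟨cofContr M a hm x + app (cofIncl M 0) a (by simp) (barGen M a m y), ?_⟩
    have e := cofContr_htpy a hm rfl x
    rw [hx, map_zero, add_zero] at e
    rw [map_add, e, dEl_cofIncl_zero a _ hm (by simp), dEl_barGen a hm, hy, sub_add_cancel]
  · refine ⟨app (cofIncl M 0) a (by simp) (barGen M a n y), ?_, 0, ?_⟩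
    · rw [dEl_cofIncl_zero a _ rfl (by simp), dEl_barGen a rfl, hy, map_zero, map_zero]
    · rw [app_cofCounit_cofIncl_barGen, sub_self, map_zero]

end CofRep

end DGCat

/-! ### Cofibrancy of the cofibrant replacement -/

namespace DGCat

section Field

variable {k : Type u} [Field k] {A : DGCat.{u, u} k} {X Y M : A.modules.Obj}
  {t : A.modules.Hom X Y 0}

/-- Over a field, the kernel of a trivial fibration is contractible at every object: `τ` takes
values in the kernel and chooses primitives of its cocycles. -/
lemma exists_kernel_section (ht : IsTrivialFibration t) (a : A.Obj) {m n : ℤ} (h : m + 1 = n) :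
    ∃ τ : El X a n →ₗ[k] El X a m,
      (∀ z, dEl X a n (n + 1) z = 0 → app t a (add_zero n) z = 0 → dEl X a m n (τ z) = z) ∧
      ∀ z, app t a (add_zero m) (τ z) = 0 := by
  rw [isTrivialFibration_iff, isQuasiIso_iff] at ht
  obtain ⟨⟨htc, hq⟩, hs⟩ := ht
  let K : Submodule k (El X a m) := LinearMap.ker (app t a (add_zero m))
  let Z : Submodule k (El X a n) :=
    LinearMap.ker (dEl X a n (n + 1)) ⊓ LinearMap.ker (app t a (add_zero n))
  let δ : K →ₗ[k] Z := (dEl X a m n).restrict fun x hx => ⟨dEl_dEl X a m n (n + 1) x, by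
    change app t a (add_zero n) (dEl X a m n x) = 0
    rw [← htc.dEl_app a (add_zero m) (add_zero n) h, LinearMap.mem_ker.1 hx, map_zero]⟩
  have hδ : Function.Surjective δ := by
    rintro ⟨z, hz, hz'⟩
    replace hz' : app t a (add_zero n) z = 0 := hz'
    obtain ⟨x', hx'⟩ := (hq a).1 h z hz ⟨0, by rw [hz', map_zero]⟩
    obtain ⟨x, hx, y', hy'⟩ := (hq a).2 (sub_add_cancel m 1) (app t a (add_zero m) x') (by
      rw [htc.dEl_app a (add_zero m) (add_zero _) rfl]
      subst h
      rw [hx', hz'])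
    obtain ⟨x'', rfl⟩ := hs a _ y'
    have hx0 : dEl X a m n x = 0 := by subst h; exact hx
    refine ⟨⟨x' - x + dEl X a (m - 1) m x'', ?_⟩, Subtype.ext ?_⟩
    · change app t a (add_zero m) _ = 0
      rw [map_add, map_sub, ← htc.dEl_app a (add_zero _) (add_zero m)
        (sub_add_cancel m 1), hy']
      abel
    · change dEl X a m n (x' - x + dEl X a (m - 1) m x'') = z
      rw [map_add, map_sub, hx', dEl_dEl, hx0, sub_zero, add_zero]
  obtain ⟨s, hs⟩ := LinearMap.exists_rightInverse_of_surjective δ (LinearMap.range_eq_top.2 hδ)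
  obtain ⟨τ, hτ⟩ := LinearMap.exists_extend s
  refine ⟨K.subtype ∘ₗ τ, fun z hz hz' => ?_, fun z => (τ z).2⟩
  have e₁ := congrArg (fun g => g ⟨z, hz, hz'⟩) hτ
  have e₂ := congrArg (fun g => (g ⟨z, hz, hz'⟩).1) hs
  change τ z = s _ at e₁
  change dEl X a m n (τ z) = z
  rw [e₁]
  exact e₂

/-- Over a field, a trivial fibration has at every object a section that is a chain map, with a
contraction of the kernel. -/
lemma exists_section (ht : IsTrivialFibration t) (a : A.Obj) :
    ∃ (σ : ∀ n : ℤ, El Y a n →ₗ[k] El X a n)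
      (h : ∀ m n : ℤ, m + 1 = n → El X a n →ₗ[k] El X a m),
      (∀ n y, app t a (add_zero n) (σ n y) = y) ∧
      (∀ m n, m + 1 = n → ∀ y, dEl X a m n (σ m y) = σ n (dEl Y a m n y)) ∧
      (∀ m n e x, app t a (add_zero m) (h m n e x) = 0) ∧
      ∀ m n r (e : m + 1 = n) (e' : n + 1 = r) x,
        dEl X a m n (h m n e x) + h n r e' (dEl X a n r x) = x - σ n (app t a (add_zero n) x) := by
  choose τ hτ htτ using fun (m n : ℤ) (h : m + 1 = n) => exists_kernel_section ht a h
  rw [isTrivialFibration_iff, isQuasiIso_iff] at ht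
  obtain ⟨⟨htc, hq⟩, hs⟩ := ht
  have htd : ∀ m n (_ : m + 1 = n) x,
      app t a (add_zero n) (dEl X a m n x) = dEl Y a m n (app t a (add_zero m) x) := fun m n h x =>
    (htc.dEl_app a (add_zero m) (add_zero n) h x).symm
  choose σ₀ hσ₀ using fun n => LinearMap.exists_rightInverse_of_surjective
    (app t a (add_zero n)) (LinearMap.range_eq_top.2 (hs a n))
  have hσ₀ : ∀ n y, app t a (add_zero n) (σ₀ n y) = y := fun n y =>
    congrArg (fun g => g y) (hσ₀ n)
  have hτ : ∀ m n r (h : m + 1 = n) (_ : n + 1 = r) z, dEl X a n r z = 0 →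
      app t a (add_zero n) z = 0 → dEl X a m n (τ m n h z) = z := by
    rintro m n r h rfl
    exact hτ m n h
  -- the contraction of the kernel
  let c : ∀ m n : ℤ, m + 1 = n → El X a n →ₗ[k] El X a m := fun m n h =>
    τ m n h ∘ₗ (LinearMap.id - τ n (n + 1) rfl ∘ₗ dEl X a n (n + 1))
  have hc : ∀ m n r (h : m + 1 = n) (h' : n + 1 = r) x,
      c m n h x = τ m n h (x - τ n r h' (dEl X a n r x)) := by
    rintro m n r h rfl x
    rfl
  have htc' : ∀ m n h x, app t a (add_zero m) (c m n h x) = 0 := fun m n h x => htτ m n h _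
  have key : ∀ m n r (h : m + 1 = n) (h' : n + 1 = r) x, app t a (add_zero n) x = 0 →
      dEl X a m n (c m n h x) + c n r h' (dEl X a n r x) = x := by
    intro m n r h h' x hx
    have hdx : dEl X a n r (τ n r h' (dEl X a n r x)) = dEl X a n r x :=
      hτ n r (r + 1) h' rfl _ (dEl_dEl ..) (by rw [htd n r h', hx, map_zero])
    rw [hc m n r h h', hτ m n r h h' _ (by rw [map_sub, hdx, sub_self])
      (by rw [map_sub, htτ, hx, sub_zero]), hc n r (r + 1) h' rfl, dEl_dEl, map_zero, sub_zero,
      sub_add_cancel]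
  -- the correction of the linear section to a chain map
  let σ : ∀ n : ℤ, El Y a n →ₗ[k] El X a n := fun n =>
    σ₀ n - c n (n + 1) rfl ∘ₗ (dEl X a n (n + 1) ∘ₗ σ₀ n - σ₀ (n + 1) ∘ₗ dEl Y a n (n + 1))
  have hσ : ∀ n r (h : n + 1 = r) y, σ n y =
      σ₀ n y - c n r h (dEl X a n r (σ₀ n y) - σ₀ r (dEl Y a n r y)) := by
    rintro n r rfl y
    rfl
  have htσ : ∀ n y, app t a (add_zero n) (σ n y) = y := by
    intro n y
    rw [hσ n _ rfl, map_sub, hσ₀, htc', sub_zero]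
  have hdσ : ∀ m n, m + 1 = n → ∀ y, dEl X a m n (σ m y) = σ n (dEl Y a m n y) := by
    intro m n h y
    have e := key m n (n + 1) h rfl (dEl X a m n (σ₀ m y) - σ₀ n (dEl Y a m n y))
      (by rw [map_sub, htd m n h, hσ₀, hσ₀, sub_self])
    rw [hσ m n h, hσ n _ rfl, map_sub, dEl_dEl, map_zero, sub_zero]
    rw [map_sub (dEl X a n (n + 1)), dEl_dEl, zero_sub, map_neg] at e
    rw [← sub_eq_add_neg, sub_eq_iff_eq_add] at e
    rw [e]
    abel
  refine ⟨σ, fun m n h => c m n h ∘ₗ (LinearMap.id - σ n ∘ₗ app t a (add_zero n)), htσ, hdσ,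
    fun m n h x => htc' m n h _, fun m n r h h' x => ?_⟩
  simp only [LinearMap.comp_apply, LinearMap.sub_apply, LinearMap.id_apply]
  have e := key m n r h h' (x - σ n (app t a (add_zero n) x))
    (by rw [map_sub, htσ, sub_self])
  rwa [map_sub (dEl X a n r), hdσ n r h', ← htd n r h'] at e

/-- Lifting of a graded natural transformation out of a free module along a trivial fibration, with
prescribed differential. -/
lemma free_exists_lift (ht : IsTrivialFibration t) {m n : ℤ} (h : n + 1 = m)
    (u : A.modules.Hom M X m) (hu : A.modules.d rfl u = 0) (f : A.modules.Hom (free M) Y n)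
    (hf : A.modules.d h f = A.modules.comp (zero_add m) (freeCounit M)
      (A.modules.comp (add_zero m) u t)) :
    ∃ g : A.modules.Hom (free M) X n, A.modules.comp (add_zero n) g t = f ∧
      A.modules.d h g = A.modules.comp (zero_add m) (freeCounit M) u := by
  choose σ c hσ hdσ htc key using exists_section ht
  let γ : ∀ (a : A.Obj) (p q : ℤ), p + n = q → El M a p →ₗ[k] El X a q := fun a p q e =>
    σ a q ∘ₗ app f a e ∘ₗ gen M a p + c a q (q + 1) rfl ∘ₗ app u a (by omega)
  have hγ : ∀ a p q r (e : p + n = q) (e' : p + m = r) (e'' : q + 1 = r) x, γ a p q e x =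
      σ a q (app f a e (gen M a p x)) + c a q r e'' (app u a e' x) := by
    rintro a p q r e e' rfl x
    rfl
  refine ⟨freeDesc γ, free_hom_ext fun a p q e x => ?_, free_hom_ext fun a p q e x => ?_⟩
  · rw [app_comp _ _ _ a e e, app_freeDesc_gen, hγ a p q (q + 1) e (by omega) rfl, map_add, hσ, htc,
      add_zero]
  · have hu' := dEl_app (n := m) hu a e (rfl : p + 1 + m = _) rfl x
    have hf' := congrArg (fun s => app s a e (gen M a p x)) hf
    rw [app_d h _ a e rfl rfl, app_comp _ _ _ a e (add_zero p), app_freeCounit_gen, app_one,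
      app_comp _ _ _ a e e, dEl_gen _ _ _ rfl, sub_eq_iff_eq_add] at hf'
    rw [app_d h _ a e rfl rfl, app_comp _ _ _ a e (add_zero p), app_freeCounit_gen, app_one,
      app_freeDesc_gen, dEl_gen _ _ _ rfl, app_freeDesc_gen,
      hγ a p _ q rfl e (by omega), hγ a (p + 1) q _ (by omega) rfl (by omega), map_add,
      hdσ a _ q (by omega), hf', map_add, LinearMap.map_smul_of_tower]
    have e₁ := key a (p + n) q (p + 1 + m) (by omega) (by omega) (app u a e x)
    have hm : m.negOnePow = -n.negOnePow := by rw [← h, Int.negOnePow_succ]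
    rw [hu', LinearMap.map_smul_of_tower, hm, Units.neg_smul, eq_sub_iff_add_eq] at e₁
    refine Eq.trans ?_ e₁
    rw [smul_add]
    abel

/-- The inclusion of the kernel of the counit in the terms of the resolution. -/
noncomputable def barIncl (M : A.modules.Obj) (i : ℕ) :
    A.modules.Hom (syzygyPow M (i + 1)) (bar M i) 0 := syzygyIncl _

/-- The counit on the terms of the resolution. -/
noncomputable def barEps (M : A.modules.Obj) (i : ℕ) :
    A.modules.Hom (bar M i) (syzygyPow M i) 0 := freeCounit _

lemma barD_eq (M : A.modules.Obj) (i : ℕ) :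
    barD M i = A.modules.comp (add_zero 0) (barEps M (i + 1)) (barIncl M i) := rfl

lemma barIncl_barEps (M : A.modules.Obj) (i : ℕ) :
    A.modules.comp (add_zero 0) (barIncl M i) (barEps M i) = 0 := syzygyIncl_freeCounit _

lemma d_barIncl (M : A.modules.Obj) (i : ℕ) : A.modules.d (zero_add 1) (barIncl M i) = 0 :=
  isClosed_syzygyIncl _

lemma bar_exists_lift (ht : IsTrivialFibration t) (i : ℕ) {m n : ℤ} (h : n + 1 = m)
    (u : A.modules.Hom (syzygyPow M i) X m) (hu : A.modules.d rfl u = 0)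
    (f : A.modules.Hom (bar M i) Y n) (hf : A.modules.d h f = A.modules.comp (zero_add m)
      (barEps M i) (A.modules.comp (add_zero m) u t)) :
    ∃ g : A.modules.Hom (bar M i) X n, A.modules.comp (add_zero n) g t = f ∧
      A.modules.d h g = A.modules.comp (zero_add m) (barEps M i) u :=
  free_exists_lift ht h u hu f hf

/-- The cofibrant replacement is cofibrant. -/
theorem isCofibrant_cofRep (M : A.modules.Obj) : IsCofibrant (cofRep M) := by
  intro X Y t ht f hf
  have htc : A.modules.IsClosed t := ht.choose
  -- a closed morphism `f` out of the total module is a sequence with `d F_0 = 0` and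
  -- `d F_(i + 1) = F_i ∘ δ`; these components are lifted by induction on `i`
  let F : ∀ i : ℕ, A.modules.Hom (bar M i) Y (-i) := fun i =>
    A.modules.comp (add_zero _) (cofIncl M i) f
  have hF₀ : ∀ n (h : -((0 : ℕ) : ℤ) + 1 = n), A.modules.d h (F 0) = 0 := by
    intro n h
    rw [A.modules.d_comp (add_zero _) h (zero_add 1) h h (by omega), d_cofIncl_zero,
      show A.modules.d (zero_add 1) f = 0 from hf]
    simp
  have hF : ∀ (i : ℕ) (h : -((i + 1 : ℕ) : ℤ) + 1 = -i), A.modules.d h (F (i + 1)) =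
      A.modules.comp (zero_add _) (barD M i) (F i) := by
    intro i h
    rw [A.modules.d_comp (add_zero _) h (zero_add 1) h h (by omega), d_cofIncl_succ,
      show A.modules.d (zero_add 1) f = 0 from hf, map_zero, zero_add, Int.negOnePow_zero, one_smul,
      A.modules.assoc _ _ (add_zero _) (zero_add _)]
  -- the lifts of the components of `f`, with the condition that allows the next step
  let P : ∀ i : ℕ, A.modules.Hom (bar M i) X (-i) → Prop := fun i g =>
    A.modules.comp (add_zero _) g t = F i ∧ ∀ n (h : -(i : ℤ) + 1 = n),
      A.modules.comp (zero_add _) (barIncl M i) (A.modules.d h g) = 0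
  have start : ∃ g : A.modules.Hom (bar M 0) X (-((0 : ℕ) : ℤ)), P 0 g ∧
      ∀ n (h : -((0 : ℕ) : ℤ) + 1 = n), A.modules.d h g = 0 := by
    obtain ⟨g, hg, hg'⟩ := bar_exists_lift ht 0 (rfl : -((0 : ℕ) : ℤ) + 1 = _)
      0 (map_zero _) (F 0) (by rw [hF₀]; simp)
    rw [map_zero] at hg'
    have hg' : ∀ n (h : -((0 : ℕ) : ℤ) + 1 = n), A.modules.d h g = 0 := by
      rintro n rfl
      exact hg'
    exact ⟨g, ⟨hg, fun n h => by rw [hg', map_zero]⟩, hg'⟩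
  have step : ∀ (i : ℕ) (g : {g // P i g}), ∃ g' : {g' // P (i + 1) g'},
      ∀ h, A.modules.d h g'.1 = A.modules.comp (zero_add _) (barD M i) g.1 := by
    rintro i ⟨g, hg, hg'⟩
    have e : -((i + 1 : ℕ) : ℤ) + 1 = -i := by push_cast; ring
    obtain ⟨g', h₁, h₂⟩ := bar_exists_lift ht (i + 1) e
      (A.modules.comp (zero_add _) (barIncl M i) g) (by
        rw [A.modules.d_comp (zero_add _) (zero_add 1) rfl rfl (zero_add _) (by omega), hg',
          d_barIncl]
        simp) (F (i + 1)) (by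
        rw [hF, ← hg, A.modules.assoc (zero_add _) (add_zero _) (add_zero _) (zero_add _),
          ← A.modules.assoc (add_zero 0) (zero_add _) (zero_add _) (zero_add _), barD_eq])
    refine ⟨⟨g', h₁, fun n h => ?_⟩, fun h => ?_⟩
    · obtain rfl : -(i : ℤ) = n := by omega
      rw [h₂, ← A.modules.assoc (add_zero 0) (zero_add _) (zero_add _) (zero_add _), barIncl_barEps]
      simp
    · rw [h₂, ← A.modules.assoc (add_zero 0) (zero_add _) (zero_add _) (zero_add _), barD_eq]
  obtain ⟨g₀, hg₀, hdg₀⟩ := start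
  choose next hnext using step
  let g : ∀ i, {g : A.modules.Hom (bar M i) X (-i) // P i g} := fun i =>
    Nat.rec ⟨g₀, hg₀⟩ next i
  have hg : ∀ i, A.modules.d (by push_cast; ring) (g (i + 1)).1 =
      A.modules.comp (zero_add _) (barD M i) (g i).1 := fun i => hnext i (g i) _
  let G : A.modules.Hom (cofRep M) X 0 := cofDesc fun i =>
    A.modules.comp (by ring : -(i : ℤ) + 0 = 0 - i) (g i).1 (A.modules.one X)
  have hG : ∀ i : ℕ, A.modules.comp (add_zero (-(i : ℤ))) (cofIncl M i) G = (g i).1 := by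
    intro i
    have e : ∀ l (h : -(i : ℤ) + 0 = l), A.modules.comp h (cofIncl M i) G =
        A.modules.comp h (g i).1 (A.modules.one X) := by
      intro l h
      obtain rfl : 0 - (i : ℤ) = l := by omega
      exact cofIncl_desc _ i _
    rw [e, A.modules.comp_one]
  refine ⟨G, cofRep_hom_ext fun i l hl => ?_, cofRep_hom_ext fun i l hl => ?_⟩
  · rw [map_zero]
    have e := congrArg (A.modules.d hl) (hG i)
    cases i with
    | zero =>
      rw [A.modules.d_comp (add_zero _) hl (zero_add 1) hl hl (by omega), d_cofIncl_zero] at e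
      simpa using e.trans (hdg₀ _ hl)
    | succ i =>
      obtain rfl : -(i : ℤ) = l := by omega
      rw [A.modules.d_comp (add_zero _) hl (zero_add 1) hl hl (by omega), d_cofIncl_succ, hg,
        A.modules.assoc _ _ (add_zero _) (zero_add _), hG] at e
      simpa using e
  · obtain rfl : -(i : ℤ) = l := by omega
    rw [← A.modules.assoc (add_zero _) (add_zero _) (add_zero 0) (add_zero _), hG, (g i).2.1]

end Field

end DGCat

/-! ### Path objects in `dgcat` -/

namespace DGCat

section Path

variable {k : Type u} [CommRing k] (E : DGCat.{u, u} k)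

/-- The objects of the path object of `E`: the homotopy equivalences in `E`, without a choice of an
inverse. -/
structure PathObj where
  src : E.Obj
  tgt : E.Obj
  hom : E.Hom src tgt 0
  isHtpyEquiv : IsHtpyEquiv hom

variable {E}

/-- The morphisms of degree `n` in the path object: pairs of morphisms, with a homotopy between the
two composites of the square. -/
abbrev PathHom (X Y : PathObj E) (n : ℤ) : Type u :=
  E.Hom X.src Y.src n × E.Hom X.tgt Y.tgt n × E.Hom X.src Y.tgt (n - 1)

/-- The differential of the path object: it sends `(u, v, w)`, a morphism from `f` to `g`, to
`(d u, d v, v f - g u - d w)`. -/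
def pathD (X Y : PathObj E) {m n : ℤ} (h : m + 1 = n) : PathHom X Y m →ₗ[k] PathHom X Y n where
  toFun s := (E.d h s.1, E.d h s.2.1, -E.d (by omega) s.2.2 + E.comp (by omega) X.hom s.2.1 -
    E.comp (by omega) s.1 Y.hom)
  map_add' s t := by
    refine Prod.ext ?_ (Prod.ext ?_ ?_)
    · simp
    · simp
    · simp only [Prod.fst_add, Prod.snd_add, map_add, LinearMap.add_apply]
      abel
  map_smul' c s := by
    refine Prod.ext ?_ (Prod.ext ?_ ?_)
    · simp
    · simp
    · simp [smul_sub, smul_add]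

/-- The composition of the path object. -/
def pathComp {X Y Z : PathObj E} {p q n : ℤ} (h : p + q = n) :
    PathHom X Y p →ₗ[k] PathHom Y Z q →ₗ[k] PathHom X Z n :=
  LinearMap.mk₂ k (fun s t => (E.comp h s.1 t.1, E.comp h s.2.1 t.2.1,
      q.negOnePow • E.comp (by omega) s.2.2 t.2.1 + E.comp (by omega) s.1 t.2.2))
    (fun s s' t => by
      refine Prod.ext ?_ (Prod.ext ?_ ?_)
      · simp
      · simp
      · simp only [Prod.fst_add, Prod.snd_add, map_add, LinearMap.add_apply, smul_add]
        abel)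
    (fun c s t => by
      refine Prod.ext ?_ (Prod.ext ?_ ?_)
      · simp
      · simp
      · simp [smul_add, smul_comm c])
    (fun s t t' => by
      refine Prod.ext ?_ (Prod.ext ?_ ?_)
      · simp
      · simp
      · simp only [Prod.fst_add, Prod.snd_add, map_add, smul_add]
        abel)
    (fun c s t => by
      refine Prod.ext ?_ (Prod.ext ?_ ?_)
      · simp
      · simp
      · simp [smul_add, smul_comm c])

lemma d_comp_closed_right {B : DGCat.{v, w} k} {x y z : B.Obj} {p p' n n' : ℤ} (h : p + 0 = n)
    (hn : n + 1 = n') (hp : p + 1 = p') (f : B.Hom x y p) {g : B.Hom y z 0} (hg : B.IsClosed g) :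
    B.d hn (B.comp h f g) = B.comp (by omega) (B.d hp f) g := by
  rw [B.d_comp h hp (zero_add 1) hn (by omega) (by omega), show B.d (zero_add 1) g = 0 from hg]
  simp

lemma d_comp_closed_left {B : DGCat.{v, w} k} {x y z : B.Obj} {p p' n n' : ℤ} (h : 0 + p = n)
    (hn : n + 1 = n') (hp : p + 1 = p') {f : B.Hom x y 0} (hf : B.IsClosed f) (g : B.Hom y z p) :
    B.d hn (B.comp h f g) = B.comp (by omega) f (B.d hp g) := by
  rw [B.d_comp h (zero_add 1) hp hn (by omega) (by omega), show B.d (zero_add 1) f = 0 from hf]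
  simp

variable (E) in
/-- The path object of `E` in `dgcat`. -/
def path : DGCat.{u, u} k where
  Obj := PathObj E
  Hom X Y n := PathHom X Y n
  d h := pathD _ _ h
  d_d {X Y l m n} h h' s := by
    refine Prod.ext (E.d_d _ _ _) (Prod.ext (E.d_d _ _ _) ?_)
    change -E.d _ (-E.d _ s.2.2 + E.comp _ X.hom s.2.1 - E.comp _ s.1 Y.hom) +
      E.comp _ X.hom (E.d h s.2.1) - E.comp _ (E.d h s.1) Y.hom = 0
    rw [map_sub, map_add, map_neg, E.d_d, d_comp_closed_left _ _ h X.isHtpyEquiv.1,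
      d_comp_closed_right _ _ h _ Y.isHtpyEquiv.1]
    abel
  one X := (E.one _, E.one _, 0)
  comp h := pathComp h
  one_comp s := by
    refine Prod.ext (E.one_comp _) (Prod.ext (E.one_comp _) ?_)
    change _ • E.comp _ 0 _ + E.comp _ (E.one _) _ = _
    rw [E.one_comp]
    simp
  comp_one s := by
    refine Prod.ext (E.comp_one _) (Prod.ext (E.comp_one _) ?_)
    change Int.negOnePow 0 • E.comp _ _ (E.one _) + E.comp _ _ 0 = _
    rw [E.comp_one]
    simp
  assoc {X Y Z T p q r pq qr n} h₁ h₂ h₃ h₄ s t l := by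
    refine Prod.ext (E.assoc _ _ _ _ _ _ _) (Prod.ext (E.assoc _ _ _ _ _ _ _) ?_)
    change r.negOnePow • E.comp _ (q.negOnePow • E.comp _ s.2.2 t.2.1 + E.comp _ s.1 t.2.2) l.2.1 +
      E.comp _ (E.comp h₁ s.1 t.1) l.2.2 =
      qr.negOnePow • E.comp _ s.2.2 (E.comp h₃ t.2.1 l.2.1) +
        E.comp _ s.1 (r.negOnePow • E.comp _ t.2.2 l.2.1 + E.comp _ t.1 l.2.2)
    rw [map_add, map_add, LinearMap.add_apply, negOnePow_smul_left, negOnePow_smul_right,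
      E.assoc _ _ h₃ (by omega), E.assoc _ _ (by omega : q - 1 + r = qr - 1) (by omega),
      E.assoc h₁ _ (by omega : q + (r - 1) = qr - 1) (by omega), smul_add, smul_smul,
      ← Int.negOnePow_add, add_comm r q, h₃, add_assoc]
  d_comp {X Y Z p q n p' q' n'} h hp hq hn h₁ h₂ s t := by
    refine Prod.ext (E.d_comp _ _ _ _ _ _ _ _) (Prod.ext (E.d_comp _ _ _ _ _ _ _ _) ?_)
    change -E.d _ (q.negOnePow • E.comp _ s.2.2 t.2.1 + E.comp _ s.1 t.2.2) +
        E.comp _ X.hom (E.comp _ s.2.1 t.2.1) - E.comp _ (E.comp _ s.1 t.1) Z.hom =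
      q'.negOnePow • E.comp _ s.2.2 (E.d hq t.2.1) + E.comp _ s.1
          (-E.d _ t.2.2 + E.comp _ Y.hom t.2.1 - E.comp _ t.1 Z.hom) +
        q.negOnePow • (q.negOnePow • E.comp _
            (-E.d _ s.2.2 + E.comp _ X.hom s.2.1 - E.comp _ s.1 Y.hom) t.2.1 +
          E.comp _ (E.d hp s.1) t.2.2)
    have e : (q - 1).negOnePow = -q.negOnePow := by rw [Int.negOnePow_sub]; simp
    have e' : q'.negOnePow = -q.negOnePow := by rw [← hq, Int.negOnePow_succ]
    rw [map_add, d_negOnePow_smul,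
      E.d_comp _ (by omega : p - 1 + 1 = p' - 1) hq _ (by omega) (by omega),
      E.d_comp _ hp (by omega : q - 1 + 1 = q' - 1) _ (by omega) (by omega), e, e']
    simp only [map_add, map_sub, map_neg, LinearMap.add_apply, LinearMap.sub_apply,
      LinearMap.neg_apply, smul_add, smul_sub, smul_neg, neg_smul, smul_smul, ← Int.negOnePow_add,
      Units.neg_smul]
    have e₁ : ∀ y : E.Hom X.src Z.tgt (n' - 1), (q + q).negOnePow • y = y := fun y => by
      rw [negOnePow_smul_congr (n := 0) ⟨q, by ring⟩]; simp
    simp only [e₁]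
    rw [E.assoc (by omega : 0 + p = p' - 1) (by omega : p' - 1 + q = n' - 1) h (by omega),
      E.assoc h (by omega : n + 0 = n' - 1) (by omega : q + 0 = q' - 1) (by omega),
      E.assoc (by omega : p + 0 = p' - 1) (by omega : p' - 1 + q = n' - 1)
        (by omega : 0 + q = q' - 1) (by omega)]
    abel

/-- The first projection of the path object. -/
def pathFst : path E ⟶ E where
  obj X := X.src
  map {X Y n} := LinearMap.fst k (E.Hom X.src Y.src n) _
  map_d _ _ := rfl
  map_one _ := rfl
  map_comp _ _ _ := rfl

/-- The second projection of the path object. -/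
def pathSnd : path E ⟶ E where
  obj X := X.tgt
  map {X Y n} := LinearMap.fst k (E.Hom X.tgt Y.tgt n) _ ∘ₗ LinearMap.snd k (E.Hom X.src Y.src n) _
  map_d _ _ := rfl
  map_one _ := rfl
  map_comp _ _ _ := rfl

/-- A natural homotopy equivalence, as a DG-functor to the path object. -/
def toPath {X : DGCat.{u, u} k} {F G : DGFunctor X E} (t : (X.functors E).Hom F G 0)
    (h : ∀ x, IsHtpyEquiv (B := E) (t.1 x)) : DGFunctor X (path E) where
  obj x := ⟨F.obj x, G.obj x, t.1 x, h x⟩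
  map {x y n} := LinearMap.prod F.map (LinearMap.prod G.map 0)
  map_d {x y m n} hmn f := by
    refine Prod.ext (F.map_d _ _) (Prod.ext (G.map_d _ _) ?_)
    change 0 = -E.d _ 0 + E.comp _ (t.1 x) (G.map f) - E.comp _ (F.map f) (t.1 y)
    rw [t.2 (by omega : m + 0 = n - 1) (by omega) f]
    simp
  map_one x := Prod.ext (F.map_one _) (Prod.ext (G.map_one _) rfl)
  map_comp {x y z p q n} hpq f g := by
    refine Prod.ext (F.map_comp _ _ _) (Prod.ext (G.map_comp _ _ _) ?_)
    change 0 = q.negOnePow • E.comp _ 0 (G.map g) + E.comp _ (F.map f) 0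
    simp

variable (E) in
/-- The diagonal of the path object. -/
def pathDiag : E ⟶ path E where
  obj x := ⟨x, x, E.one x, isHtpyEquiv_one x⟩
  map {x y n} := LinearMap.prod LinearMap.id (LinearMap.prod LinearMap.id 0)
  map_d {x y m n} hmn f := by
    refine Prod.ext rfl (Prod.ext rfl ?_)
    change 0 = -E.d _ 0 + E.comp _ (E.one x) f - E.comp _ f (E.one y)
    obtain rfl : m = n - 1 := by omega
    rw [E.one_comp, E.comp_one]
    simp
  map_one x := rfl
  map_comp {x y z p q n} hpq f g := by
    refine Prod.ext rfl (Prod.ext rfl ?_)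
    change 0 = q.negOnePow • E.comp _ 0 g + E.comp _ f 0
    simp

/-- Every object `f : x → y` of the path object is homotopy equivalent to the identity of `x`, by
`(1, f, 0)` and `(1, g, h)` with `g` an inverse of `f` and `h` the homotopy from `g f` to the
identity. -/
lemma pathDiag_essSurj (X : PathObj E) : (path E).HtpyEquiv ((pathDiag E).obj X.src) X := by
  obtain ⟨x, y, f, hf, g, hg, ⟨h, e⟩, ⟨h', e'⟩⟩ := X
  -- `f h` and `h' f` differ by the cocycle `κ`; correcting `h'` by `-κ g` removes the obstruction
  -- to lifting the homotopies to the path object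
  obtain ⟨κ, eκ⟩ : ∃ κ : E.Hom x y (-1),
    E.comp (zero_add (-1)) f h' - E.comp (add_zero (-1)) h f = κ := ⟨_, rfl⟩
  have hκ : E.d (neg_add_cancel 1) κ = 0 := by
    rw [← eκ, map_sub, d_comp_closed_left _ _ (neg_add_cancel 1) hf,
      d_comp_closed_right _ _ (neg_add_cancel 1) _ hf, ← e, ← e', map_sub, map_sub,
      LinearMap.sub_apply, E.comp_one, E.one_comp, comp_assoc₀, sub_self]
  obtain ⟨z, ez⟩ : ∃ z, -E.comp (zero_add (-1)) g κ = z := ⟨_, rfl⟩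
  have hκ' : E.d (neg_add_cancel 1) (h' + z) = E.comp (add_zero 0) g f - E.one y := by
    rw [← ez, map_add, map_neg, d_comp_closed_left _ _ (neg_add_cancel 1) hg, hκ, ← e']
    simp
  have eq₁ : -E.d (neg_add_cancel 1) (0 : E.Hom x y (-1)) + E.comp (add_zero 0) (E.one x) f -
      E.comp (add_zero 0) (E.one x) f = 0 := by
    simp
  have eq₂ : -E.d (neg_add_cancel 1) h + E.comp (add_zero 0) f g -
      E.comp (add_zero 0) (E.one x) (E.one x) = 0 := by
    rw [← e, E.one_comp, neg_sub, sub_add_cancel, sub_self]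
  have eq₃ : E.comp (add_zero 0) (E.one x) (E.one x) - E.one x = E.d (neg_add_cancel 1) 0 := by
    rw [E.one_comp, sub_self, map_zero]
  have eq₄ : Int.negOnePow 0 • E.comp (add_zero (-1)) (0 : E.Hom x y (-1)) g +
      E.comp (zero_add (-1)) (E.one x) h - 0 =
        -E.d (by norm_num : (-2 : ℤ) + 1 = -1) 0 + E.comp (zero_add (-1)) (E.one x) h -
          E.comp (add_zero (-1)) (0 : E.Hom x x (-1)) (E.one x) := by
    simp
  have eq₅ : Int.negOnePow 0 • E.comp (add_zero (-1)) h f +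
      E.comp (zero_add (-1)) (E.one x) (0 : E.Hom x y (-1)) - 0 =
        -E.d (by norm_num : (-2 : ℤ) + 1 = -1) (E.comp (by norm_num) h κ) +
          E.comp (zero_add (-1)) f (h' + z) - E.comp (add_zero (-1)) (0 : E.Hom x x (-1)) f := by
    rw [E.d_comp _ (neg_add_cancel 1) (neg_add_cancel 1) _ (add_zero (-1)) (zero_add (-1)), hκ, ← e,
      ← ez, map_add (E.comp _ f), map_neg (E.comp _ f), map_sub (E.comp _), LinearMap.sub_apply,
      E.assoc (add_zero 0) (zero_add (-1)) (zero_add (-1)) (zero_add (-1)),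
      sub_eq_iff_eq_add.1 eκ]
    simp only [Int.negOnePow_zero, one_smul, map_zero, add_zero, sub_zero, zero_add, neg_neg,
      Int.negOnePow_neg, Int.negOnePow_one, neg_smul, LinearMap.zero_apply, Units.neg_smul,
      E.one_comp]
    abel
  refine ⟨((E.one x, f, 0) : PathHom _ _ 0), ((E.one x, g, h) : PathHom _ _ 0),
    ((0, h, 0) : PathHom _ _ (-1)),
    ((0, h' + z, E.comp (by norm_num : (-1 : ℤ) + (-1) = -2) h κ) : PathHom _ _ (-1)),
    ?_, ?_, ?_, ?_⟩
  · exact Prod.ext (isClosed_one E x) (Prod.ext hf eq₁)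
  · exact Prod.ext (isClosed_one E x) (Prod.ext hg eq₂)
  · exact Prod.ext eq₃ (Prod.ext e eq₄)
  · exact Prod.ext eq₃ (Prod.ext hκ'.symm eq₅)

/-- The diagonal of the path object is a quasi-equivalence. -/
lemma isQuasiEquiv_pathDiag : DGFunctor.IsQuasiEquiv (pathDiag E) where
  injective_cohomology h f hf := fun ⟨g, hg⟩ => ⟨g.1, congrArg Prod.fst hg⟩
  surjective_cohomology {x y m n} h g hg := by
    change E.Hom x y n × E.Hom x y n × E.Hom x y (n - 1) at g
    obtain ⟨u, v, w⟩ := g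
    have hu : E.d rfl u = 0 := congrArg Prod.fst hg
    have hw : ∀ (r : ℤ) (h₁ : n - 1 + 1 = r) (h₂ : 0 + n = r) (h₃ : n + 0 = r),
        -E.d h₁ w + E.comp h₂ (E.one x) v - E.comp h₃ u (E.one y) = 0 := by
      intro r h₁ h₂ h₃
      obtain rfl : n + 1 - 1 = r := by omega
      exact congrArg (fun s => s.2.2) hg
    have hw := hw n (by omega) (zero_add n) (add_zero n)
    rw [E.one_comp, E.comp_one] at hw
    obtain rfl : m = n - 1 := by omega
    have eq₁ : E.d h (-w) = u - v := by
      rw [map_neg, ← sub_eq_zero, ← hw]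
      abel
    have eq₂ : -E.d (by omega : n - 1 - 1 + 1 = n - 1) (0 : E.Hom x y (n - 1 - 1)) +
        E.comp (zero_add (n - 1)) (E.one x) (-w) - E.comp (add_zero (n - 1))
          (0 : E.Hom x y (n - 1)) (E.one y) = 0 - w := by
      rw [E.one_comp]
      simp
    have eq₃ : E.d h (0 : E.Hom x y (n - 1)) = u - u := by simp
    refine ⟨u, hu, ((0, -w, 0) : PathHom _ _ (n - 1)), ?_⟩
    exact Prod.ext eq₃ (Prod.ext eq₁ eq₂)
  essSurj X := ⟨X.src, pathDiag_essSurj X⟩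

/-- Naturally homotopy equivalent DG-functors are equal in `Hqe`: they factor through the two
projections of the path object, which have the common section `pathDiag`, a quasi-equivalence. -/
theorem toHqe_map_eq_of_htpyEquiv {X : DGCat.{u, u} k} {F G : X ⟶ E}
    (t : (X.functors E).Hom (F : DGFunctor X E) (G : DGFunctor X E) 0)
    (h : ∀ x, IsHtpyEquiv (B := E) (t.1 x)) : (toHqe k).map F = (toHqe k).map G := by
  have hd : quasiEquiv k (pathDiag E) := isQuasiEquiv_pathDiag
  have := Localization.inverts (toHqe k) (quasiEquiv k) (pathDiag E) hd
  have e₁ : pathDiag E ≫ pathFst = 𝟙 E := rfl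
  have e₂ : pathDiag E ≫ pathSnd = 𝟙 E := rfl
  have e : (toHqe k).map (pathFst (E := E)) = (toHqe k).map pathSnd := by
    rw [← cancel_epi ((toHqe k).map (pathDiag E)), ← Functor.map_comp, ← Functor.map_comp, e₁, e₂]
  have h₁ : (toPath t h : X ⟶ path E) ≫ pathFst = F := rfl
  have h₂ : (toPath t h : X ⟶ path E) ≫ pathSnd = G := rfl
  exact (congrArg _ h₁.symm).trans (((toHqe k).map_comp _ _).trans ((congrArg _ e).trans
    (((toHqe k).map_comp _ _).symm.trans (congrArg _ h₂))))

end Path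

end DGCat

/-! ### The class in `Hqe` of a DG-functor to a large DG-category with a small model -/

/-- A DG-functor that is bijective on morphisms and essentially surjective on `H⁰` is a
quasi-equivalence. -/
lemma DGFunctor.IsQuasiEquiv.of_bijective {k : Type u} [CommRing k] {A : DGCat.{v, w} k}
    {B : DGCat.{v₁, w₁} k} {F : DGFunctor A B}
    (hF : ∀ (x y : A.Obj) (n : ℤ), Function.Bijective (F.map : A.Hom x y n →ₗ[k] _))
    (h : ∀ b : B.Obj, ∃ a : A.Obj, B.HtpyEquiv (F.obj a) b) : F.IsQuasiEquiv where
  injective_cohomology {x y m n} h f _ := fun ⟨g, hg⟩ => by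
    obtain ⟨f', rfl⟩ := (hF x y m).2 g
    exact ⟨f', (hF x y n).1 (by rw [F.map_d, hg])⟩
  surjective_cohomology {x y m n} h g hg := by
    obtain ⟨f, rfl⟩ := (hF x y n).2 g
    refine ⟨f, (hF x y _).1 (by rw [F.map_d, hg, map_zero]), 0, ?_⟩
    rw [map_zero, sub_self]
  essSurj := h

namespace DGCat

namespace SmallModel

variable {k : Type u} [CommRing k] {B : DGCat.{u, u + 1} k} {B' : DGCat.{u, u + 1} k}
  {X Y : DGCat.{u, u} k}

lemma isQuasiEquiv_toExtend (S : SmallModel B) (P : DGFunctor X B) :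
    DGFunctor.IsQuasiEquiv (S.toExtend P : DGFunctor S.cat (S.extend P).cat) :=
  .of_bijective (fun _ _ _ => Function.bijective_id) fun b => S.essSurj ((S.extend P).obj b)

instance (S : SmallModel B) (P : DGFunctor X B) : IsIso ((toHqe k).map (S.toExtend P)) :=
  Localization.inverts (toHqe k) (quasiEquiv k) _ (S.isQuasiEquiv_toExtend P)

/-- The class in `Hqe` of a DG-functor `P` to the large DG-category `B`: `P` takes values in an
enlargement of the small model, and the inclusion of the small model in it is a
quasi-equivalence. -/
noncomputable def cls (S : SmallModel B) (P : DGFunctor X B) :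
    (toHqe k).obj X ⟶ (toHqe k).obj S.cat :=
  (toHqe k).map (S.lift P) ≫ inv ((toHqe k).map (S.toExtend P))

lemma eq_cls_iff (S : SmallModel B) (P : DGFunctor X B)
    (φ : (toHqe k).obj X ⟶ (toHqe k).obj S.cat) :
    φ = S.cls P ↔ φ ≫ (toHqe k).map (S.toExtend P) = (toHqe k).map (S.lift P) := by
  rw [cls, IsIso.eq_comp_inv]

/-- The small model on a smaller family of objects. -/
def restrict (T : SmallModel B) {ι : Type u} (r : ι → T.ι)
    (h : ∀ b : B.Obj, ∃ i, B.HtpyEquiv (T.obj (r i)) b) : SmallModel B := ⟨ι, T.obj ∘ r, h⟩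

/-- The inclusion of the small model on a smaller family of objects. -/
def restrictIncl (T : SmallModel B) {ι : Type u} (r : ι → T.ι)
    (h : ∀ b : B.Obj, ∃ i, B.HtpyEquiv (T.obj (r i)) b) : (T.restrict r h).cat ⟶ T.cat where
  obj := r
  map := LinearMap.id
  map_d _ _ := rfl
  map_one _ := rfl
  map_comp _ _ _ := rfl

lemma isIso_restrictIncl (T : SmallModel B) {ι : Type u} (r : ι → T.ι)
    (h : ∀ b : B.Obj, ∃ i, B.HtpyEquiv (T.obj (r i)) b) :
    IsIso ((toHqe k).map (T.restrictIncl r h)) := by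
  have : DGFunctor.IsQuasiEquiv (T.restrictIncl r h : DGFunctor (T.restrict r h).cat T.cat) :=
    .of_bijective (fun _ _ _ => Function.bijective_id) fun b => h (T.obj b)
  exact Localization.inverts (toHqe k) (quasiEquiv k) _ this

/-- The DG-functor that compares an enlargement with a small model that contains it. -/
def extendDesc (T : SmallModel B) {ι : Type u} (r : ι → T.ι)
    (h : ∀ b : B.Obj, ∃ i, B.HtpyEquiv (T.obj (r i)) b) (P : DGFunctor X T.cat) :
    ((T.restrict r h).extend (P.comp T.incl)).cat ⟶ T.cat where
  obj := Sum.elim r P.obj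
  map {x y n} := match x, y with
    | .inl x, .inl y => (LinearMap.id : B.Hom (T.obj (r x)) (T.obj (r y)) n →ₗ[k] _)
    | .inl x, .inr y => (LinearMap.id : B.Hom (T.obj (r x)) (T.obj (P.obj y)) n →ₗ[k] _)
    | .inr x, .inl y => (LinearMap.id : B.Hom (T.obj (P.obj x)) (T.obj (r y)) n →ₗ[k] _)
    | .inr x, .inr y => (LinearMap.id : B.Hom (T.obj (P.obj x)) (T.obj (P.obj y)) n →ₗ[k] _)
  map_d {x y _ _} _ _ := by rcases x with _ | _ <;> rcases y with _ | _ <;> rfl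
  map_one x := by rcases x with _ | _ <;> rfl
  map_comp {x y z _ _ _} _ _ _ := by
    rcases x with _ | _ <;> rcases y with _ | _ <;> rcases z with _ | _ <;> rfl

/-- The class, with respect to a smaller family of objects, of a DG-functor `P` to a small model is
the image of `P`. -/
lemma cls_comp_restrictIncl (T : SmallModel B) {ι : Type u} (r : ι → T.ι)
    (h : ∀ b : B.Obj, ∃ i, B.HtpyEquiv (T.obj (r i)) b) (P : X ⟶ T.cat) :
    (T.restrict r h).cls (DGFunctor.comp P T.incl) ≫ (toHqe k).map (T.restrictIncl r h) =
      (toHqe k).map P := by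
  have e₁ : (T.restrict r h).toExtend (DGFunctor.comp P T.incl) ≫ T.extendDesc r h P =
    T.restrictIncl r h := rfl
  have e₂ : (T.restrict r h).lift (DGFunctor.comp P T.incl) ≫ T.extendDesc r h P = P := rfl
  rw [cls, Category.assoc, ← e₁, Functor.map_comp, IsIso.inv_hom_id_assoc, ← Functor.map_comp, e₂]

/-- Precomposition with a DG-functor. -/
lemma cls_comp (S : SmallModel B) (G : X ⟶ Y) (P : DGFunctor Y B) :
    S.cls (DGFunctor.comp G P) = (toHqe k).map G ≫ S.cls P := by
  have e : S.cls (DGFunctor.comp G P) ≫ (toHqe k).map (S.toExtend P) =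
      (toHqe k).map (G ≫ S.lift P) :=
    (S.extend P).cls_comp_restrictIncl Sum.inl S.essSurj (G ≫ S.lift P)
  rw [← cancel_mono ((toHqe k).map (S.toExtend P)), e, Functor.map_comp, Category.assoc,
    (S.eq_cls_iff P _).1 rfl]

lemma cls_incl (S : SmallModel B) : S.cls S.incl = 𝟙 _ := by
  have e : S.cls S.incl ≫ (toHqe k).map (𝟙 _) = (toHqe k).map (𝟙 _) :=
    S.cls_comp_restrictIncl id S.essSurj (𝟙 _)
  rwa [CategoryTheory.Functor.map_id, Category.comp_id] at e

/-- Postcomposition with a DG-functor. -/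
lemma cls_comp_cls (S : SmallModel B) (S' : SmallModel B') (P : DGFunctor X B)
    (H : DGFunctor B B') : S.cls P ≫ S'.cls (S.incl.comp H) = S'.cls (P.comp H) := by
  have e₁ : S'.cls (P.comp H) = (toHqe k).map (S.lift P) ≫
      S'.cls ((S.extend P).incl.comp H) := S'.cls_comp (S.lift P) ((S.extend P).incl.comp H)
  have e₂ : S'.cls (S.incl.comp H) = (toHqe k).map (S.toExtend P) ≫
      S'.cls ((S.extend P).incl.comp H) := S'.cls_comp (S.toExtend P) ((S.extend P).incl.comp H)
  rw [e₁, e₂, cls, Category.assoc, IsIso.inv_hom_id_assoc]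

/-- The class does not change along natural homotopy equivalences. -/
lemma cls_eq_of_htpyEquiv (S : SmallModel B) {P P' : DGFunctor X B} (t : (X.functors B).Hom P P' 0)
    (h : ∀ x, IsHtpyEquiv (B := B) (t.1 x)) : S.cls P = S.cls P' := by
  let T : SmallModel B := (S.extend P).extend P'
  let r : S.ι → T.ι := fun i => Sum.inl (Sum.inl i)
  let F : X ⟶ T.cat := S.lift P ≫ (S.extend P).toExtend P'
  let G : X ⟶ T.cat := (S.extend P).lift P'
  have e₁ : S.cls P ≫ (toHqe k).map (T.restrictIncl r S.essSurj) = (toHqe k).map F :=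
    T.cls_comp_restrictIncl r S.essSurj F
  have e₂ : S.cls P' ≫ (toHqe k).map (T.restrictIncl r S.essSurj) = (toHqe k).map G :=
    T.cls_comp_restrictIncl r S.essSurj G
  have e₃ : (toHqe k).map F = (toHqe k).map G := by
    let t' : (X.functors T.cat).Hom (F : DGFunctor X T.cat) (G : DGFunctor X T.cat) 0 :=
      ⟨fun x => t.1 x, fun x y p m h h' f => t.2 h h' f⟩
    exact toHqe_map_eq_of_htpyEquiv t' h
  have := T.isIso_restrictIncl r S.essSurj
  exact (cancel_mono ((toHqe k).map (T.restrictIncl r S.essSurj))).1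
    (e₁.trans (e₃.trans e₂.symm))

end SmallModel

end DGCat

/-! ### The class in `Hqe` of a DG-functor to modules -/

namespace DGCat

section Class

variable {k : Type u} [Field k] {A B : DGCat.{u, u} k} {X : DGCat.{u, u} k} {Y : DGCat.{v, w} k}

/-- The DG-functors with cohomologically finite values. -/
def HasCohFinite (Φ : DGFunctor Y A.modules) : Prop := ∀ x, IsCohFinite (A := A) (Φ.obj x)

/-- The cofibrant replacement of a DG-functor to modules with cohomologically finite values. -/
noncomputable def cofCf (Φ : DGFunctor Y A.modules) (hΦ : HasCohFinite Φ) :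
    DGFunctor Y A.derivedCf where
  obj x := ⟨cofRep (Φ.obj x), isCofibrant_cofRep _,
    (isQuasiIso_cofCounit (Φ.obj x)).isCohFinite_source (hΦ x)⟩
  map := (Φ.comp (cofFunctor A)).map
  map_d := (Φ.comp (cofFunctor A)).map_d
  map_one := (Φ.comp (cofFunctor A)).map_one
  map_comp := (Φ.comp (cofFunctor A)).map_comp

/-- The class in `Hqe` of a DG-functor to modules with cohomologically finite values. -/
noncomputable def qcls (S : SmallModel A.derivedCf) (Φ : DGFunctor X A.modules)
    (hΦ : HasCohFinite Φ) : (toHqe k).obj X ⟶ (toHqe k).obj S.cat :=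
  S.cls (cofCf Φ hΦ)

/-- A natural quasi-isomorphism between DG-functors to modules. -/
def NatQuasiIso (Φ Ψ : DGFunctor Y A.modules) : Prop :=
  ∃ ε : (Y.functors A.modules).Hom Φ Ψ 0, ∀ x, IsQuasiIso (A := A) (ε.1 x)

lemma NatQuasiIso.hasCohFinite_target {Φ Ψ : DGFunctor Y A.modules} (h : NatQuasiIso Φ Ψ)
    (hΦ : HasCohFinite Φ) : HasCohFinite Ψ :=
  fun x => (h.choose_spec x).isCohFinite_target (hΦ x)

lemma hasCohFinite_comp_incl (P : DGFunctor Y A.derivedCf) :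
    HasCohFinite (P.comp A.derivedCfIncl) := fun x => (P.obj x).2.2

lemma IsQuasiIso.cofMap {M N : A.modules.Obj} {t : A.modules.Hom M N 0} (ht : IsQuasiIso t) :
    IsQuasiIso (cofMap t) := by
  have hc : A.modules.IsClosed (DGCat.cofMap t) := IsClosed.map ht.choose (cofFunctor A)
  refine IsQuasiIso.of_comp_right hc (isQuasiIso_cofCounit N) ?_
  rw [← cofCounit_naturality]
  exact (isQuasiIso_cofCounit M).comp ht

/-- The class of a DG-functor to modules does not change along natural quasi-isomorphisms. -/
lemma qcls_eq_of_natQuasiIso (S : SmallModel A.derivedCf) {Φ Ψ : DGFunctor X A.modules}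
    (h : NatQuasiIso Φ Ψ) (hΦ : HasCohFinite Φ) (hΨ : HasCohFinite Ψ) :
    qcls S Φ hΦ = qcls S Ψ hΨ := by
  obtain ⟨ε, hε⟩ := h
  let t : (X.functors A.derivedCf).Hom (cofCf Φ hΦ) (cofCf Ψ hΨ) 0 :=
    ⟨fun x => cofMap (ε.1 x), fun x y p m hpm hpm' f => by
      have e := congrArg (cofFunctor A).map (ε.2 hpm hpm' f)
      rw [(cofFunctor A).map_comp, mul_zero, Int.negOnePow_zero, one_smul,
        (cofFunctor A).map_comp] at e
      rw [mul_zero, Int.negOnePow_zero, one_smul]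
      exact e⟩
  refine S.cls_eq_of_htpyEquiv t fun x => ?_
  exact (hε x).cofMap.isHtpyEquiv (isCofibrant_cofRep _) (isCofibrant_cofRep _)

/-- The class of a DG-functor to cofibrant modules can be formed without replacement. -/
lemma qcls_comp_incl (S : SmallModel A.derivedCf) (P : DGFunctor X A.derivedCf) :
    qcls S (P.comp A.derivedCfIncl) (hasCohFinite_comp_incl P) = S.cls P := by
  let t : (X.functors A.derivedCf).Hom
      (cofCf (P.comp A.derivedCfIncl) (hasCohFinite_comp_incl P)) P 0 :=
    ⟨fun x => cofCounit (P.obj x).1, fun x y p m hpm hpm' f => by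
      obtain rfl : p = m := by omega
      rw [mul_zero, Int.negOnePow_zero, one_smul]
      exact (cofCounit_naturality (A := A) (P.map f)).symm⟩
  refine S.cls_eq_of_htpyEquiv t fun x => ?_
  exact (isQuasiIso_cofCounit (P.obj x).1).isHtpyEquiv (isCofibrant_cofRep _) (P.obj x).2.1

/-- The natural quasi-isomorphism from the cofibrant replacement. -/
lemma natQuasiIso_cofCf (Φ : DGFunctor Y A.modules) (hΦ : HasCohFinite Φ) :
    NatQuasiIso ((cofCf Φ hΦ).comp A.derivedCfIncl) Φ :=
  ⟨⟨fun x => cofCounit (Φ.obj x), fun x y p m hpm hpm' f => by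
      obtain rfl : p = m := by omega
      rw [mul_zero, Int.negOnePow_zero, one_smul]
      exact (cofCounit_naturality (A := A) (Φ.map f)).symm⟩,
    fun x => isQuasiIso_cofCounit (Φ.obj x)⟩

/-- The class is the only morphism that represents `Φ`. -/
lemma represents_iff (S : SmallModel A.derivedCf) (Φ : DGFunctor X A.modules)
    (hΦ : HasCohFinite Φ) (φ : (toHqe k).obj X ⟶ (toHqe k).obj S.cat) :
    Represents S Φ φ ↔ φ = qcls S Φ hΦ := by
  constructor
  · rintro ⟨P, ε, -, hε, e⟩
    rw [(S.eq_cls_iff P φ).2 e, ← qcls_comp_incl]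
    exact qcls_eq_of_natQuasiIso S ⟨ε, hε⟩ _ _
  · rintro rfl
    obtain ⟨ε, hε⟩ := natQuasiIso_cofCf Φ hΦ
    refine ⟨cofCf Φ hΦ, ε, Subtype.ext (funext fun x => (hε x).choose), hε, ?_⟩
    exact (S.eq_cls_iff _ _).1 rfl

lemma qcls_comp (S : SmallModel A.derivedCf) {Z : DGCat.{u, u} k} (G : Z ⟶ X)
    (Φ : DGFunctor X A.modules) (hΦ : HasCohFinite Φ) :
    qcls S (DGFunctor.comp G Φ) (fun z => hΦ _) = (toHqe k).map G ≫ qcls S Φ hΦ :=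
  S.cls_comp G (cofCf Φ hΦ)

lemma NatQuasiIso.comp {Φ Ψ : DGFunctor Y A.modules} (h : NatQuasiIso Φ Ψ)
    (H : DGFunctor A.modules B.modules)
    (hH : ∀ ⦃M N⦄ (t : A.modules.Hom M N 0), IsQuasiIso t → IsQuasiIso (A := B) (H.map t)) :
    NatQuasiIso (Φ.comp H) (Ψ.comp H) := by
  obtain ⟨ε, hε⟩ := h
  refine ⟨⟨fun x => H.map (ε.1 x), fun x y p m hpm hpm' f => ?_⟩, fun x => hH _ (hε x)⟩
  have e := congrArg H.map (ε.2 hpm hpm' f)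
  rw [H.map_comp, mul_zero, Int.negOnePow_zero, one_smul, H.map_comp] at e
  rw [mul_zero, Int.negOnePow_zero, one_smul]
  exact e

/-- Postcomposition with a DG-functor between module categories that preserves
quasi-isomorphisms and cohomological finiteness. -/
lemma qcls_comp_qcls (S : SmallModel A.derivedCf) (S' : SmallModel B.derivedCf)
    (Φ : DGFunctor X A.modules) (hΦ : HasCohFinite Φ) (H : DGFunctor A.modules B.modules)
    (hH : ∀ ⦃M N⦄ (t : A.modules.Hom M N 0), IsQuasiIso t → IsQuasiIso (A := B) (H.map t))
    (hH' : ∀ M, IsCohFinite M → IsCohFinite (A := B) (H.obj M)) :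
    qcls S Φ hΦ ≫ qcls S' ((S.incl.comp A.derivedCfIncl).comp H) (fun i => hH' _ (S.obj i).2.2) =
      qcls S' (Φ.comp H) (fun x => hH' _ (hΦ x)) := by
  have e := S.cls_comp_cls S' (cofCf Φ hΦ)
    (cofCf (A.derivedCfIncl.comp H) fun M => hH' _ M.2.2)
  refine e.trans ?_
  refine Eq.trans ?_ (qcls_eq_of_natQuasiIso S' ((natQuasiIso_cofCf Φ hΦ).comp H hH)
    (fun x => hH' _ ((cofCf Φ hΦ).obj x).2.2) _)
  rfl

lemma hasCohFinite_comp_res {Φ : DGFunctor Y B.modules} (hΦ : HasCohFinite Φ) (F : A ⟶ B) :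
    HasCohFinite (Φ.comp (DGFunctor.res F (complexes k))) := fun x a => hΦ x (DGFunctor.obj F a)

lemma IsQuasiIso.res {M N : B.modules.Obj} {t : B.modules.Hom M N 0} (ht : IsQuasiIso t)
    (F : A ⟶ B) : IsQuasiIso (A := A) ((DGFunctor.res F (complexes k)).map t) := by
  obtain ⟨h, h'⟩ := ht
  exact ⟨IsClosed.map h _, fun a => h' (DGFunctor.obj F a)⟩

/-- The morphism `D_cf(B) → D_cf(A)` in `Hqe` given by restriction along `F : A → B`. -/
noncomputable def dcfMap (S : ∀ A : DGCat.{u, u} k, SmallModel A.derivedCf) (F : A ⟶ B) :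
    (toHqe k).obj (S B).cat ⟶ (toHqe k).obj (S A).cat :=
  qcls (S A) (resCf F (S B)) fun i a => ((S B).obj i).2.2 (DGFunctor.obj F a)

variable (S : ∀ A : DGCat.{u, u} k, SmallModel A.derivedCf)

lemma qcls_comp_dcfMap (Φ : DGFunctor X B.modules) (hΦ : HasCohFinite Φ) (F : A ⟶ B) :
    qcls (S B) Φ hΦ ≫ dcfMap S F =
      qcls (S A) (Φ.comp (DGFunctor.res F (complexes k))) (hasCohFinite_comp_res hΦ F) :=
  qcls_comp_qcls (S B) (S A) Φ hΦ (DGFunctor.res F (complexes k)) (fun _ _ _ h => h.res F)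
    fun _ hM a => hM (DGFunctor.obj F a)

lemma dcfMap_id (A : DGCat.{u, u} k) : dcfMap S (𝟙 A) = 𝟙 _ :=
  (qcls_comp_incl (S A) (S A).incl).trans (S A).cls_incl

lemma dcfMap_comp {C : DGCat.{u, u} k} (F : A ⟶ B) (G : B ⟶ C) :
    dcfMap S (F ≫ G) = dcfMap S G ≫ dcfMap S F :=
  (qcls_comp_dcfMap S (resCf G (S C)) _ F).symm

end Class

end DGCat

/-! ### Representable modules and coinduction -/

namespace DGCat

section Repr

variable {k : Type u} [CommRing k] {B : DGCat.{u, u} k}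

/-- The data of the representable module `B(b, -)`. -/
abbrev reprData (b : B.Obj) : ModData B where
  X c n := B.Hom b c n
  d c m n h := B.d h
  d_d c l m n h h' f := B.d_d h h' f
  act h := (B.comp h).flip
  act_one f := B.comp_one f
  act_comp h h₁ h₂ h₃ f g x := (B.assoc h₂ h₃ h h₁ x f g).symm
  d_act h hp hq hn h₁ h₂ f x := B.d_comp h hq hp hn h₁ h₂ x f

/-- The representable module `B(b, -)`. -/
def repr (b : B.Obj) : B.modules.Obj := (reprData b).toModule

/-- The elements of a representable module. -/
def reprEl (b c : B.Obj) (n : ℤ) : B.Hom b c n ≃ₗ[k] El (repr b) c n := (reprData b).el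

lemma exists_reprEl {b c : B.Obj} {n : ℤ} (x : El (repr b) c n) : ∃ f, reprEl b c n f = x :=
  ⟨_, LinearEquiv.apply_symm_apply _ x⟩

lemma act_reprEl {b c c' : B.Obj} {p q n : ℤ} (h : q + p = n) (f : B.Hom c c' p)
    (g : B.Hom b c q) : act (repr b) h f (reprEl b c q g) = reprEl b c' n (B.comp h g f) := rfl

lemma dEl_reprEl {b c : B.Obj} {m n : ℤ} (h : m + 1 = n) (g : B.Hom b c m) :
    dEl (repr b) c m n (reprEl b c m g) = reprEl b c n (B.d h g) :=
  (reprData b).dEl_el h g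

lemma repr_hom_ext {b : B.Obj} {N : B.modules.Obj} {n : ℤ} {s t : B.modules.Hom (repr b) N n}
    (h : app s b (zero_add n) (reprEl b b 0 (B.one b)) =
      app t b (zero_add n) (reprEl b b 0 (B.one b))) : s = t := by
  refine hom_ext fun c p q hpq x => ?_
  obtain ⟨x, rfl⟩ := exists_reprEl x
  have e : reprEl b c p x = act (repr b) (zero_add p) x (reprEl b b 0 (B.one b)) := by
    rw [act_reprEl, B.one_comp]
  rw [e, app_act s (zero_add p) hpq (zero_add n), app_act t (zero_add p) hpq (zero_add n), h]

/-- The morphism `B(b, -) → N` given by an element `x` of `N(b)` of degree `n`, which sends `g` to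
`(-1)^(|g| n) g x`. -/
def reprDesc (N : B.modules.Obj) (b : B.Obj) {n : ℤ} :
    El N b n →ₗ[k] B.modules.Hom (repr b) N n where
  toFun x := ModData.desc (D := reprData b)
    (fun c p q h => (p * n).negOnePow • (act N (by omega : n + p = q)).flip x) (by
      intro c c' p q r s l h₁ h₂ h₃ h₄ f g
      change (r * n).negOnePow • act N _ (B.comp h₁ g f) x = (p * n).negOnePow •
        act N h₄ f ((q * n).negOnePow • act N _ g x)
      rw [act_comp N h₁ _ (by omega : n + q = l) h₄, LinearMap.map_smul_of_tower, smul_smul,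
        ← Int.negOnePow_add]
      exact negOnePow_smul_congr ⟨0, by rw [← h₁]; ring⟩ _)
  map_add' x y := hom_ext fun c p q h g => by
    change (p * n).negOnePow • act N _ g (x + y) = (p * n).negOnePow • act N _ g x +
      (p * n).negOnePow • act N _ g y
    rw [map_add, smul_add]
  map_smul' r x := hom_ext fun c p q h g => by
    change (p * n).negOnePow • act N _ g (r • x) = r • (p * n).negOnePow • act N _ g x
    rw [map_smul, smul_comm]

variable {N N' : B.modules.Obj}

lemma app_reprDesc (b c : B.Obj) {n p q : ℤ} (x : El N b n) (h : p + n = q) (h' : n + p = q)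
    (g : B.Hom b c p) :
    app (reprDesc N b x) c h (reprEl b c p g) = (p * n).negOnePow • act N h' g x := rfl

lemma app_reprDesc_one (b : B.Obj) {n : ℤ} (x : El N b n) :
    app (reprDesc N b x) b (zero_add n) (reprEl b b 0 (B.one b)) = x := by
  rw [app_reprDesc _ _ _ _ (add_zero n), act_one, zero_mul, Int.negOnePow_zero, one_smul]

lemma reprDesc_app (b : B.Obj) {n : ℤ} (t : B.modules.Hom (repr b) N n) :
    reprDesc N b (app t b (zero_add n) (reprEl b b 0 (B.one b))) = t :=
  repr_hom_ext (app_reprDesc_one _ _)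

lemma reprDesc_d (b : B.Obj) {m n : ℤ} (h : m + 1 = n) (x : El N b m) :
    reprDesc N b (dEl N b m n x) = B.modules.d h (reprDesc N b x) := by
  refine repr_hom_ext ?_
  rw [app_reprDesc_one, app_d h _ b (zero_add n) (zero_add 1) (zero_add m), app_reprDesc_one,
    dEl_reprEl (zero_add 1), d_one]
  simp

lemma reprDesc_comp (b : B.Obj) {m n l : ℤ} (h : m + n = l) (x : El N b m)
    (t : B.modules.Hom N N' n) :
    B.modules.comp h (reprDesc N b x) t = reprDesc N' b (app t b h x) := by
  refine repr_hom_ext ?_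
  rw [app_reprDesc_one, app_comp h _ _ b (zero_add l) (zero_add m), app_reprDesc_one]

/-- The morphism `B(b', -) → B(b, -)` given by precomposition with a morphism `f : b → b'`, with the
sign `(-1)^(|f| |g|)` on `g`. -/
def precomp {b b' : B.Obj} {n : ℤ} : B.Hom b b' n →ₗ[k] B.modules.Hom (repr b') (repr b) n :=
  reprDesc (repr b) b' ∘ₗ (reprEl b b' n).toLinearMap

lemma precomp_apply {b b' : B.Obj} {n : ℤ} (f : B.Hom b b' n) :
    precomp f = reprDesc (repr b) b' (reprEl b b' n f) := rfl

lemma precomp_d {b b' : B.Obj} {m n : ℤ} (h : m + 1 = n) (f : B.Hom b b' m) :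
    precomp (B.d h f) = B.modules.d h (precomp f) := by
  rw [precomp_apply, precomp_apply, ← reprDesc_d, dEl_reprEl]

lemma precomp_one (b : B.Obj) : precomp (B.one b) = B.modules.one (repr b) := by
  refine repr_hom_ext ?_
  rw [precomp_apply, app_reprDesc_one, app_one]

lemma precomp_reprDesc {b b' : B.Obj} {p q n : ℤ} (h : q + p = n) (h' : p + q = n)
    (f : B.Hom b b' p) (x : El N b q) : reprDesc N b' (act N h f x) = (p * q).negOnePow • B.modules.comp h'
      (precomp f) (reprDesc N b x) := by
  refine repr_hom_ext ?_
  rw [app_units_smul, app_reprDesc_one, app_comp h' _ _ b' (zero_add n) (zero_add p),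
    precomp_apply, app_reprDesc_one, app_reprDesc _ _ _ _ h, smul_smul, ← Int.negOnePow_add,
    negOnePow_smul_congr (n := 0) ⟨p * q, by ring⟩]
  simp

lemma precomp_comp {b b' b'' : B.Obj} {p q n : ℤ} (h : p + q = n) (h' : q + p = n)
    (f : B.Hom b b' p) (g : B.Hom b' b'' q) :
    precomp (B.comp h f g) = (q * p).negOnePow • B.modules.comp h' (precomp g) (precomp f) := by
  rw [precomp_apply, precomp_apply, precomp_apply, ← act_reprEl h]
  exact precomp_reprDesc h h' g _

end Repr

end DGCat

/-- A contravariant DG-functor, with the sign `Ψ(f ≫ g) = (-1)^(|f| |g|) Ψ(g) ≫ Ψ(f)` where `≫`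
is the composition in diagrammatic order. -/
structure DGContra {k : Type u} [CommRing k] (B : DGCat.{v, w} k) (E : DGCat.{v₁, w₁} k) where
  obj : B.Obj → E.Obj
  map : ∀ {x y : B.Obj} {n : ℤ}, B.Hom x y n →ₗ[k] E.Hom (obj y) (obj x) n
  map_d : ∀ {x y : B.Obj} {m n : ℤ} (h : m + 1 = n) (f : B.Hom x y m),
    map (B.d h f) = E.d h (map f)
  map_one : ∀ x : B.Obj, map (B.one x) = E.one (obj x)
  map_comp : ∀ {x y z : B.Obj} {p q n : ℤ} (h : p + q = n) (h' : q + p = n) (f : B.Hom x y p)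
    (g : B.Hom y z q), map (B.comp h f g) = (q * p).negOnePow • E.comp h' (map g) (map f)

namespace DGContra

variable {k : Type u} [CommRing k] {B : DGCat.{v, w} k} {E : DGCat.{v₁, w₁} k}
  {E' : DGCat.{v₂, w₂} k}

/-- Composition of a contravariant DG-functor with a DG-functor. -/
def comp (Ψ : DGContra B E) (F : DGFunctor E E') : DGContra B E' where
  obj x := F.obj (Ψ.obj x)
  map := F.map ∘ₗ Ψ.map
  map_d h f := by simp [F.map_d, Ψ.map_d]
  map_one x := by simp [F.map_one, Ψ.map_one]
  map_comp {x y z p q n} h h' f g := by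
    rw [LinearMap.comp_apply, Ψ.map_comp h h', LinearMap.map_smul_of_tower, F.map_comp]
    rfl

end DGContra

namespace DGCat

section Coind

variable {k : Type u} [CommRing k] {B : DGCat.{u, u} k} {E : DGCat.{u, w} k}

/-- The Yoneda embedding `b ↦ B(b, -)`. -/
def yoneda (B : DGCat.{u, u} k) : DGContra B B.modules where
  obj b := repr b
  map := precomp
  map_d := precomp_d
  map_one := precomp_one
  map_comp := precomp_comp

variable (Ψ : DGContra B E)

/-- The data of the module `b ↦ Hom(Ψ b, M)`, on which `f` acts by precomposition with `Ψ(f)`, with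
the sign `(-1)^(|f| |φ|)` on `φ`. -/
abbrev coindData (M : E.Obj) : ModData B where
  X b n := E.Hom (Ψ.obj b) M n
  d b m n h := E.d h
  d_d b l m n h h' f := E.d_d h h' f
  act {b b' p q n} h := LinearMap.mk₂ k
    (fun f φ => (p * q).negOnePow • E.comp (by omega : p + q = n) (Ψ.map f) φ)
    (fun f g φ => by rw [map_add, map_add, LinearMap.add_apply, smul_add])
    (fun c f φ => by rw [map_smul, map_smul, LinearMap.smul_apply, smul_comm])
    (fun f φ ψ => by rw [map_add, smul_add])
    (fun c f φ => by rw [map_smul, smul_comm])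
  act_one {b n} φ := by
    change (0 * n).negOnePow • E.comp _ (Ψ.map (B.one b)) φ = φ
    rw [Ψ.map_one, E.one_comp, zero_mul, Int.negOnePow_zero, one_smul]
  act_comp {b b' b'' p q r l m n} h h₁ h₂ h₃ f g φ := by
    change (l * r).negOnePow • E.comp _ (Ψ.map (B.comp h f g)) φ =
      (q * m).negOnePow • E.comp _ (Ψ.map g) ((p * r).negOnePow • E.comp _ (Ψ.map f) φ)
    rw [Ψ.map_comp h (by omega), negOnePow_smul_left, negOnePow_smul_right, smul_smul, smul_smul,
      ← Int.negOnePow_add, ← Int.negOnePow_add, E.assoc _ _ (by omega : p + r = m) (by omega)]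
    exact negOnePow_smul_congr ⟨0, by rw [← h, ← h₂]; ring⟩ _
  d_act {b b' p q n p' q' n'} h hp hq hn h₁ h₂ f φ := by
    change E.d hn ((p * q).negOnePow • E.comp _ (Ψ.map f) φ) =
      (p' * q).negOnePow • E.comp _ (Ψ.map (B.d hp f)) φ +
        p.negOnePow • (p * q').negOnePow • E.comp _ (Ψ.map f) (E.d hq φ)
    rw [d_negOnePow_smul, E.d_comp (by omega) hp hq hn (by omega) (by omega), smul_add, smul_smul,
      smul_smul, ← Int.negOnePow_add, ← Int.negOnePow_add, add_comm, Ψ.map_d]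
    congr 1
    · exact negOnePow_smul_congr ⟨0, by rw [← hp]; ring⟩ _
    · exact negOnePow_smul_congr ⟨-p, by rw [← hq]; ring⟩ _

/-- The module `b ↦ Hom(Ψ b, M)`. -/
def coind (M : E.Obj) : B.modules.Obj := (coindData Ψ M).toModule

/-- The elements of the module `b ↦ Hom(Ψ b, M)`. -/
def coindEl (M : E.Obj) (b : B.Obj) (n : ℤ) : E.Hom (Ψ.obj b) M n ≃ₗ[k] El (coind Ψ M) b n :=
  (coindData Ψ M).el

variable {Ψ} {M M' M'' : E.Obj}

lemma exists_coindEl {b : B.Obj} {n : ℤ} (x : El (coind Ψ M) b n) : ∃ φ, coindEl Ψ M b n φ = x :=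
  ⟨_, LinearEquiv.apply_symm_apply _ x⟩

lemma dEl_coindEl {b : B.Obj} {m n : ℤ} (h : m + 1 = n) (φ : E.Hom (Ψ.obj b) M m) :
    dEl (coind Ψ M) b m n (coindEl Ψ M b m φ) = coindEl Ψ M b n (E.d h φ) :=
  (coindData Ψ M).dEl_el h φ

variable (Ψ) in
/-- Functoriality of `M ↦ Hom(Ψ -, M)`. -/
def coindMap {n : ℤ} : E.Hom M M' n →ₗ[k] B.modules.Hom (coind Ψ M) (coind Ψ M') n where
  toFun t := ModData.desc (D := coindData Ψ M) (fun b p q h =>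
      (coindEl Ψ M' b q).toLinearMap ∘ₗ (E.comp h).flip t) (by
    intro b b' p q r s l h₁ h₂ h₃ h₄ f φ
    change coindEl Ψ M' b' s (E.comp _ ((p * q).negOnePow • E.comp _ (Ψ.map f) φ) t) =
      (p * n).negOnePow • coindEl Ψ M' b' s ((p * l).negOnePow •
        E.comp _ (Ψ.map f) (E.comp h₃ φ t))
    rw [negOnePow_smul_left, E.assoc (by omega) _ h₃ (by omega), ← LinearEquiv.coe_coe,
      LinearMap.map_smul_of_tower, LinearMap.map_smul_of_tower, smul_smul, ← Int.negOnePow_add]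
    exact negOnePow_smul_congr ⟨-(p * n), by rw [← h₃]; ring⟩ _)
  map_add' s t := hom_ext fun b p q h φ => by
    change coindEl Ψ M' b q (E.comp h φ (s + t)) = coindEl Ψ M' b q (E.comp h φ s) +
      coindEl Ψ M' b q (E.comp h φ t)
    rw [map_add, map_add]
  map_smul' c t := hom_ext fun b p q h φ => by
    change coindEl Ψ M' b q (E.comp h φ (c • t)) = c • coindEl Ψ M' b q (E.comp h φ t)
    rw [map_smul, map_smul]

lemma app_coindMap {n : ℤ} (t : E.Hom M M' n) (b : B.Obj) {p q : ℤ} (h : p + n = q)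
    (φ : E.Hom (Ψ.obj b) M p) :
    app (coindMap Ψ t) b h (coindEl Ψ M b p φ) = coindEl Ψ M' b q (E.comp h φ t) := rfl

lemma coindEl_units_smul {b : B.Obj} {n : ℤ} (e : ℤ) (φ : E.Hom (Ψ.obj b) M n) :
    coindEl Ψ M b n (e.negOnePow • φ) = e.negOnePow • coindEl Ψ M b n φ := by
  obtain h | h := Int.units_eq_one_or e.negOnePow <;> simp [h]

lemma coindMap_d {m n : ℤ} (h : m + 1 = n) (t : E.Hom M M' m) :
    coindMap Ψ (E.d h t) = B.modules.d h (coindMap Ψ t) := by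
  refine hom_ext fun b p q hpq x => ?_
  obtain ⟨φ, rfl⟩ := exists_coindEl x
  rw [app_d h _ b hpq rfl rfl, app_coindMap, app_coindMap, dEl_coindEl (by omega : p + m + 1 = q),
    dEl_coindEl rfl, app_coindMap, ← coindEl_units_smul, ← map_sub,
    E.d_comp rfl rfl h (by omega : p + m + 1 = q) hpq (by omega), add_sub_cancel_right]

lemma coindMap_one : coindMap Ψ (E.one M) = B.modules.one (coind Ψ M) := by
  refine hom_ext fun b p q hpq x => ?_
  obtain rfl : p = q := by omega
  obtain ⟨φ, rfl⟩ := exists_coindEl x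
  rw [app_coindMap, app_one, E.comp_one]

lemma coindMap_comp {p q n : ℤ} (h : p + q = n) (s : E.Hom M M' p) (t : E.Hom M' M'' q) :
    coindMap Ψ (E.comp h s t) = B.modules.comp h (coindMap Ψ s) (coindMap Ψ t) := by
  refine hom_ext fun b i j hij x => ?_
  obtain ⟨φ, rfl⟩ := exists_coindEl x
  rw [app_comp h _ _ b hij rfl, app_coindMap, app_coindMap, app_coindMap,
    E.assoc rfl (by omega) h hij]

variable (Ψ) in
/-- The DG-functor `M ↦ Hom(Ψ -, M)`. -/
def coindFunctor : DGFunctor E B.modules where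
  obj := coind Ψ
  map := coindMap Ψ
  map_d := coindMap_d
  map_one _ := coindMap_one
  map_comp := coindMap_comp

end Coind

end DGCat

/-! ### Coinduction along a DG-functor -/

namespace DGCat

section Precomposition

variable {k : Type u} [CommRing k] {E : DGCat.{v, w} k}

/-- A coboundary composed with a closed morphism is a coboundary. -/
lemma d_comp_eq_of_closed {x y z : E.Obj} {m n r : ℤ} (h : m + 1 = 0) (h' : m + n = r)
    (hr : r + 1 = n) (η : E.Hom x y m) (φ : E.Hom y z n) (hφ : E.d rfl φ = 0) :
    E.comp (zero_add n) (E.d h η) φ = E.d hr (n.negOnePow • E.comp h' η φ) := by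
  rw [d_negOnePow_smul, E.d_comp h' h rfl hr (by omega) (zero_add n), hφ, map_zero, zero_add,
    smul_smul, ← Int.negOnePow_add, negOnePow_smul_congr (n := 0) ⟨n, by ring⟩]
  simp

/-- Precomposition with a homotopy equivalence is injective on cohomology. -/
lemma IsHtpyEquiv.exists_of_comp_eq_d {x y z : E.Obj} {e : E.Hom x y 0} (he : IsHtpyEquiv e)
    {m n : ℤ} (h : m + 1 = n) (φ : E.Hom y z n) (hφ : E.d rfl φ = 0) (ψ : E.Hom x z m)
    (hψ : E.d h ψ = E.comp (zero_add n) e φ) : ∃ ψ', E.d h ψ' = φ := by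
  obtain ⟨-, g, hg, -, η, hη⟩ := he
  have e₁ := d_comp_closed_left (zero_add m) h h hg ψ
  rw [hψ, ← E.assoc (add_zero 0) (zero_add n) _ _ g e φ] at e₁
  have e₂ := d_comp_eq_of_closed (neg_add_cancel 1) (by omega : -1 + n = m) h η φ hφ
  rw [← hη, LinearMap.map_sub₂, E.one_comp] at e₂
  exact ⟨E.comp (zero_add m) g ψ - n.negOnePow • E.comp (by omega) η φ, by
    rw [map_sub, e₁, ← e₂, sub_sub_cancel]⟩

/-- Precomposition with a homotopy equivalence is surjective on cohomology. -/
lemma IsHtpyEquiv.exists_comp_sub_eq_d {x y z : E.Obj} {e : E.Hom x y 0} (he : IsHtpyEquiv e)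
    {m n : ℤ} (h : m + 1 = n) (φ : E.Hom x z n) (hφ : E.d rfl φ = 0) :
    ∃ φ' : E.Hom y z n, E.d rfl φ' = 0 ∧
      ∃ ψ : E.Hom x z m, E.d h ψ = E.comp (zero_add n) e φ' - φ := by
  obtain ⟨-, g, hg, ⟨η, hη⟩, -⟩ := he
  refine ⟨E.comp (zero_add n) g φ, ?_, n.negOnePow • E.comp (by omega) η φ, ?_⟩
  · rw [d_comp_closed_left (zero_add n) rfl rfl hg, hφ, map_zero]
  · rw [← d_comp_eq_of_closed (neg_add_cancel 1) (by omega : -1 + n = m) h η φ hφ, ← hη,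
      LinearMap.map_sub₂, E.one_comp, E.assoc _ _ (zero_add n) (zero_add n)]

end Precomposition

section Resolution

variable {k : Type u} [CommRing k] {A B : DGCat.{u, u} k}

/-- For a DG-functor `R` between categories of modules, the contravariant DG-functor sending `b`
to the cofibrant replacement of `R (B(b, -))`. -/
noncomputable def resol (R : DGFunctor B.modules A.modules) : DGContra B A.modules :=
  ((yoneda B).comp R).comp (cofFunctor A)

variable (R : DGFunctor B.modules A.modules)

/-- The augmentation of the resolution `resol R`. -/
noncomputable def resolCounit (b : B.Obj) : A.modules.Hom ((resol R).obj b) (R.obj (repr b)) 0 :=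
  cofCounit (R.obj (repr b))

lemma isClosed_resolCounit (b : B.Obj) : A.modules.IsClosed (resolCounit R b) :=
  isClosed_cofCounit _

lemma resolCounit_naturality {b b' : B.Obj} {n : ℤ} (f : B.Hom b b' n) :
    A.modules.comp (zero_add n) (resolCounit R b') (R.map (precomp f)) =
      A.modules.comp (add_zero n) ((resol R).map f) (resolCounit R b) :=
  cofCounit_naturality _

/-- The natural morphism `N → Hom(resol R -, R N)`: by the Yoneda lemma an element of `N(b)` is a
morphism `B(b, -) → N`, and `R` is applied to it. If `R` is a restriction this is the unit of the
derived adjunction between restriction and coinduction. -/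
noncomputable def coindUnit (N : B.modules.Obj) :
    B.modules.Hom N (coind (resol R) (R.obj N)) 0 :=
  ModData.lift (D := coindData (resol R) (R.obj N))
    (fun b p q h => A.modules.comp (by omega : 0 + p = q) (resolCounit R b) ∘ₗ R.map ∘ₗ
      reprDesc N b) (by
    intro b b' p q r s l h₁ h₂ h₃ h₄ f x
    obtain rfl : r = s := by omega
    obtain rfl : q = l := by omega
    change A.modules.comp _ (resolCounit R b') (R.map (reprDesc N b' (act N h₁ f x))) =
      (p * 0).negOnePow • (p * q).negOnePow • A.modules.comp (by omega) ((resol R).map f)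
        (A.modules.comp (zero_add q) (resolCounit R b) (R.map (reprDesc N b x)))
    rw [precomp_reprDesc h₁ (by omega : p + q = r), LinearMap.map_smul_of_tower, R.map_comp,
      negOnePow_smul_right, ← A.modules.assoc (zero_add p) (by omega : p + q = r),
      resolCounit_naturality, A.modules.assoc _ _ (zero_add q) (by omega), mul_zero,
      Int.negOnePow_zero, one_smul])

lemma app_coindUnit (N : B.modules.Obj) (b : B.Obj) {p : ℤ} (h : p + 0 = p) (x : El N b p) :
    app (coindUnit R N) b h x = coindEl (resol R) (R.obj N) b p
      (A.modules.comp (zero_add p) (resolCounit R b) (R.map (reprDesc N b x))) := rfl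

lemma isClosed_coindUnit (N : B.modules.Obj) : B.modules.IsClosed (coindUnit R N) := by
  rw [isClosed_iff]
  intro b p x
  rw [app_coindUnit, app_coindUnit, dEl_coindEl rfl, reprDesc_d b rfl, R.map_d,
    d_comp_closed_left (zero_add p) rfl rfl (isClosed_resolCounit R b)]

lemma coindUnit_naturality {N N' : B.modules.Obj} {n : ℤ} (t : B.modules.Hom N N' n) :
    B.modules.comp (zero_add n) (coindUnit R N) (coindMap (resol R) (R.map t)) =
      B.modules.comp (add_zero n) t (coindUnit R N') := by
  refine hom_ext fun b p q h x => ?_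
  rw [app_comp _ _ _ b h (add_zero p), app_comp _ _ _ b h h, app_coindUnit, app_coindUnit,
    app_coindMap, A.modules.assoc _ _ h (zero_add q), ← R.map_comp, reprDesc_comp]

end Resolution

section Comparison

variable {k : Type u} [CommRing k] {A B : DGCat.{u, u} k} (F : A ⟶ B)

/-- Restriction of modules along `F`. -/
abbrev resM : DGFunctor B.modules A.modules := DGFunctor.res F (complexes k)

/-- The morphism `A(a, -) → B(F a, F -)` given by `F`. -/
def reprMap (a : A.Obj) : A.modules.Hom (repr a) ((resM F).obj (repr (DGFunctor.obj F a))) 0 :=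
  reprDesc ((resM F).obj (repr (DGFunctor.obj F a))) a
    (reprEl (DGFunctor.obj F a) (DGFunctor.obj F a) 0 (B.one _))

/-- The elements of a restricted module. -/
def resEl (N : B.modules.Obj) (a : A.Obj) (n : ℤ) :
    El N (DGFunctor.obj F a) n ≃ₗ[k] El ((resM F).obj N) a n := LinearEquiv.refl k _

variable {F} {N N' : B.modules.Obj}

lemma exists_resEl {a : A.Obj} {n : ℤ} (x : El ((resM F).obj N) a n) :
    ∃ y, resEl F N a n y = x := ⟨x, rfl⟩

lemma dEl_resEl (a : A.Obj) {m n : ℤ} (x : El N (DGFunctor.obj F a) m) :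
    dEl ((resM F).obj N) a m n (resEl F N a m x) = resEl F N a n (dEl N _ m n x) := rfl

lemma act_resEl {a b : A.Obj} {p q n : ℤ} (h : q + p = n) (f : A.Hom a b p)
    (x : El N (DGFunctor.obj F a) q) :
    act ((resM F).obj N) h f (resEl F N a q x) = resEl F N b n (act N h (DGFunctor.map F f) x) := rfl

lemma app_resEl {n : ℤ} (t : B.modules.Hom N N' n) (a : A.Obj) {p q : ℤ} (h : p + n = q)
    (x : El N (DGFunctor.obj F a) p) :
    app ((resM F).map t) a h (resEl F N a p x) = resEl F N' a q (app t _ h x) := rfl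

lemma reprMap_def (a : A.Obj) : reprMap F a = reprDesc ((resM F).obj (repr (DGFunctor.obj F a))) a
    (resEl F _ a 0 (reprEl (DGFunctor.obj F a) (DGFunctor.obj F a) 0 (B.one _))) := rfl

lemma app_reprMap (a c : A.Obj) {p : ℤ} (h : p + 0 = p) (f : A.Hom a c p) :
    app (reprMap F a) c h (reprEl a c p f) =
      resEl F _ c p (reprEl (DGFunctor.obj F a) (DGFunctor.obj F c) p (DGFunctor.map F f)) := by
  rw [reprMap_def, app_reprDesc _ _ _ _ (zero_add p), mul_zero, Int.negOnePow_zero, one_smul,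
    act_resEl, act_reprEl, B.one_comp]

lemma isClosed_reprMap (a : A.Obj) : A.modules.IsClosed (reprMap F a) := by
  rw [IsClosed, reprMap_def, ← reprDesc_d, dEl_resEl, dEl_reprEl (zero_add 1), d_one, map_zero,
    map_zero, map_zero]

lemma reprMap_naturality {a a' : A.Obj} {n : ℤ} (f : A.Hom a a' n) :
    A.modules.comp (zero_add n) (reprMap F a') ((resM F).map (precomp (DGFunctor.map F f))) =
      A.modules.comp (add_zero n) (precomp f) (reprMap F a) := by
  refine repr_hom_ext ?_
  rw [app_comp _ _ _ a' (zero_add n) (zero_add 0), app_comp _ _ _ a' (zero_add n) (zero_add n),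
    app_reprMap, DGFunctor.map_one, app_resEl, precomp_apply, app_reprDesc_one, precomp_apply,
    app_reprDesc_one, app_reprMap]

lemma reprMap_reprDesc (a : A.Obj) {n : ℤ} (x : El N (DGFunctor.obj F a) n) :
    A.modules.comp (zero_add n) (reprMap F a) ((resM F).map (reprDesc N _ x)) =
      reprDesc ((resM F).obj N) a (resEl F N a n x) := by
  rw [reprMap_def, reprDesc_comp, app_resEl, app_reprDesc_one]

lemma IsQuasiIso.reprMap (hF : DGFunctor.IsQuasiEquiv F) (a : A.Obj) : IsQuasiIso (reprMap F a) := by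
  refine isQuasiIso_iff.2 ⟨isClosed_reprMap a, fun c => ⟨?_, ?_⟩⟩
  · rintro m n h x hx ⟨y, hy⟩
    obtain ⟨f, rfl⟩ := exists_reprEl x
    obtain ⟨y, rfl⟩ := exists_resEl y
    obtain ⟨y, rfl⟩ := exists_reprEl y
    rw [dEl_reprEl rfl, LinearEquiv.map_eq_zero_iff] at hx
    rw [app_reprMap, dEl_resEl, dEl_reprEl h] at hy
    obtain ⟨f', hf'⟩ := hF.injective_cohomology h f hx
      ⟨y, (reprEl _ _ _).injective ((resEl F _ _ _).injective hy)⟩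
    exact ⟨reprEl _ _ _ f', by rw [dEl_reprEl h, hf']⟩
  · intro m n h y hy
    obtain ⟨y, rfl⟩ := exists_resEl y
    obtain ⟨y, rfl⟩ := exists_reprEl y
    rw [dEl_resEl, dEl_reprEl rfl, LinearEquiv.map_eq_zero_iff, LinearEquiv.map_eq_zero_iff] at hy
    obtain ⟨f, hf, g, hg⟩ := hF.surjective_cohomology h y hy
    refine ⟨reprEl _ _ _ f, by rw [dEl_reprEl rfl, hf, map_zero], resEl F _ _ _ (reprEl _ _ _ g), ?_⟩
    rw [dEl_resEl, dEl_reprEl h, hg, map_sub, map_sub, app_reprMap]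

/-- The comparison of the resolution for the identity of `A`-modules with the one for
restriction along `F`. -/
noncomputable def resolMap (F : A ⟶ B) (a : A.Obj) :
    A.modules.Hom ((resol (DGFunctor.idFunctor A.modules)).obj a)
      ((resol (resM F)).obj (DGFunctor.obj F a)) 0 :=
  cofMap (reprMap F a)

lemma isClosed_resolMap (a : A.Obj) : A.modules.IsClosed (resolMap F a) :=
  IsClosed.map (isClosed_reprMap a) (cofFunctor A)

lemma resolMap_naturality {a a' : A.Obj} {n : ℤ} (f : A.Hom a a' n) :
    A.modules.comp (zero_add n) (resolMap F a') ((resol (resM F)).map (DGFunctor.map F f)) =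
      A.modules.comp (add_zero n) ((resol (DGFunctor.idFunctor A.modules)).map f)
        (resolMap F a) := by
  have e := congrArg cofMap (reprMap_naturality (F := F) f)
  rw [cofMap_comp, cofMap_comp] at e
  exact e

/-- The augmentation of the resolution of `A(a, -)`. -/
noncomputable def reprCounit (a : A.Obj) :
    A.modules.Hom ((resol (DGFunctor.idFunctor A.modules)).obj a) (repr a) 0 :=
  cofCounit (repr a)

/-- The natural morphism `M → Hom(resol -, M)` for the identity DG-functor. -/
noncomputable def coindUnitId (M : A.modules.Obj) :
    A.modules.Hom M (coind (resol (DGFunctor.idFunctor A.modules)) M) 0 :=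
  coindUnit (DGFunctor.idFunctor A.modules) M

lemma isClosed_coindUnitId (M : A.modules.Obj) : A.modules.IsClosed (coindUnitId M) :=
  isClosed_coindUnit (DGFunctor.idFunctor A.modules) M

lemma app_coindUnitId (M : A.modules.Obj) (a : A.Obj) {p : ℤ} (h : p + 0 = p) (x : El M a p) :
    app (coindUnitId M) a h x = coindEl (resol (DGFunctor.idFunctor A.modules)) M a p
      (A.modules.comp (zero_add p) (reprCounit a) (reprDesc M a x)) := rfl

lemma coindUnitId_naturality {M M' : A.modules.Obj} {n : ℤ} (t : A.modules.Hom M M' n) :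
    A.modules.comp (zero_add n) (coindUnitId M)
        (coindMap (resol (DGFunctor.idFunctor A.modules)) t) =
      A.modules.comp (add_zero n) t (coindUnitId M') :=
  coindUnit_naturality (DGFunctor.idFunctor A.modules) t

lemma resolMap_counit (a : A.Obj) :
    A.modules.comp (add_zero 0) (resolMap F a) (resolCounit (resM F) (DGFunctor.obj F a)) =
      A.modules.comp (zero_add 0) (reprCounit a) (reprMap F a) :=
  (cofCounit_naturality _).symm

/-- The comparison of the restriction of `Hom(resol -, M)` along `F` with its analogue for `A`. -/
noncomputable def coindComparison (F : A ⟶ B) (M : A.modules.Obj) :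
    A.modules.Hom ((resM F).obj (coind (resol (resM F)) M))
      (coind (resol (DGFunctor.idFunctor A.modules)) M) 0 :=
  ModData.lift (D := coindData (resol (DGFunctor.idFunctor A.modules)) M)
    (fun a p q h => A.modules.comp (by omega : 0 + p = q) (resolMap F a) ∘ₗ
      (coindEl (resol (resM F)) M (DGFunctor.obj F a) p).symm.toLinearMap ∘ₗ
        (resEl F _ a p).symm.toLinearMap) (by
    intro a a' p q r s l h₁ h₂ h₃ h₄ f x
    obtain rfl : r = s := by omega
    obtain rfl : q = l := by omega
    obtain ⟨x, rfl⟩ := exists_resEl x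
    obtain ⟨φ, rfl⟩ := exists_coindEl x
    change A.modules.comp _ (resolMap F a') ((p * q).negOnePow • A.modules.comp (by omega)
      ((resol (resM F)).map (DGFunctor.map F f)) φ) = (p * 0).negOnePow • (p * q).negOnePow •
        A.modules.comp (by omega) ((resol (DGFunctor.idFunctor A.modules)).map f)
          (A.modules.comp (zero_add q) (resolMap F a) φ)
    rw [negOnePow_smul_right, ← A.modules.assoc (zero_add p) (by omega : p + q = r),
      resolMap_naturality, A.modules.assoc _ _ (zero_add q) (by omega), mul_zero,
      Int.negOnePow_zero, one_smul])

lemma app_coindComparison (M : A.modules.Obj) (a : A.Obj) {p : ℤ} (h : p + 0 = p)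
    (φ : A.modules.Hom ((resol (resM F)).obj (DGFunctor.obj F a)) M p) :
    app (coindComparison F M) a h (resEl F _ a p (coindEl _ M _ p φ)) =
      coindEl _ M a p (A.modules.comp (zero_add p) (resolMap F a) φ) := rfl

lemma isClosed_coindComparison (M : A.modules.Obj) :
    A.modules.IsClosed (coindComparison F M) := by
  rw [isClosed_iff]
  intro a p x
  obtain ⟨x, rfl⟩ := exists_resEl x
  obtain ⟨φ, rfl⟩ := exists_coindEl x
  rw [app_coindComparison, dEl_coindEl rfl, dEl_resEl, dEl_coindEl rfl, app_coindComparison,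
    d_comp_closed_left (zero_add p) rfl rfl (isClosed_resolMap a)]

lemma coindComparison_naturality {M M' : A.modules.Obj} {n : ℤ} (t : A.modules.Hom M M' n) :
    A.modules.comp (zero_add n) (coindComparison F M) (coindMap _ t) =
      A.modules.comp (add_zero n) ((resM F).map (coindMap _ t)) (coindComparison F M') := by
  refine hom_ext fun a p q h x => ?_
  obtain ⟨x, rfl⟩ := exists_resEl x
  obtain ⟨φ, rfl⟩ := exists_coindEl x
  rw [app_comp _ _ _ a h (add_zero p), app_comp _ _ _ a h h, app_coindComparison, app_coindMap,
    app_resEl, app_coindMap, app_coindComparison, A.modules.assoc _ _ h (zero_add q)]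

/-- The comparison turns the unit for the restriction along `F` into the unit for the identity;
hence the former is a quasi-isomorphism if the comparison is. -/
lemma coindUnit_comp_comparison (N : B.modules.Obj) :
    A.modules.comp (add_zero 0) ((resM F).map (coindUnit (resM F) N))
        (coindComparison F ((resM F).obj N)) =
      coindUnitId ((resM F).obj N) := by
  refine hom_ext fun a p q h x => ?_
  obtain rfl : p = q := by omega
  obtain ⟨x, rfl⟩ := exists_resEl x
  rw [app_comp _ _ _ a h h, app_resEl, app_coindUnit, app_coindComparison, app_coindUnitId,
    ← A.modules.assoc (add_zero 0) (zero_add p), resolMap_counit,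
    A.modules.assoc _ _ (zero_add p) (zero_add p), reprMap_reprDesc]

end Comparison

end DGCat

/-! ### Restriction along quasi-equivalences -/

namespace DGCat

section Transport

variable {k : Type u} [CommRing k] {A B : DGCat.{u, u} k} {M N : B.modules.Obj}

/-- Homotopic morphisms act in the same way on the cohomology of a module. -/
lemma act_sub_act_eq_dEl {b b' : B.Obj} {f g : B.Hom b b' 0} {η : B.Hom b b' (-1)}
    (hη : f - g = B.d (neg_add_cancel 1) η) {m n : ℤ} (h : m + 1 = n) (x : El M b n)
    (hx : dEl M b n (n + 1) x = 0) :
    act M (add_zero n) f x - act M (add_zero n) g x =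
      dEl M b' m n (act M (by omega : n + -1 = m) η x) := by
  rw [dEl_act M _ (neg_add_cancel 1) rfl h, hx, map_zero, smul_zero, add_zero, ← hη,
    LinearMap.map_sub₂]

lemma dEl_act_closed {b b' : B.Obj} {f : B.Hom b b' 0} (hf : B.IsClosed f) {m n : ℤ}
    (h : m + 1 = n) (x : El M b m) :
    dEl M b' m n (act M (add_zero m) f x) = act M (add_zero n) f (dEl M b m n x) := by
  rw [dEl_act M _ (zero_add 1) h h, show B.d (zero_add 1) f = 0 from hf]
  simp

lemma app_act_degree_zero (t : B.modules.Hom M N 0) {b b' : B.Obj} (f : B.Hom b b' 0) {n : ℤ}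
    (x : El M b n) : app t b' (add_zero n) (act M (add_zero n) f x) =
      act N (add_zero n) f (app t b (add_zero n) x) :=
  app_act₀ t _ _ _ _ f x

lemma act_comp₀ {b b' b'' : B.Obj} (f : B.Hom b b' 0) (g : B.Hom b' b'' 0) {n : ℤ} (x : El M b n) :
    act M (add_zero n) (B.comp (add_zero 0) f g) x =
      act M (add_zero n) g (act M (add_zero n) f x) := act_comp M _ _ _ _ f g x

/-- Being bijective on cohomology at an object only depends on its homotopy equivalence class. -/
lemma QIsoAt.of_htpyEquiv {t : B.modules.Hom M N 0} (ht : B.modules.IsClosed t) {b b' : B.Obj}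
    (hb : B.HtpyEquiv b b') (h : QIsoAt t b) : QIsoAt t b' := by
  obtain ⟨f, g, -, η, hf, hg, -, hη⟩ := hb
  constructor
  · rintro m n hmn x hx ⟨y, hy⟩
    obtain ⟨x', hx'⟩ := h.1 hmn (act M (add_zero n) g x) (by
      rw [dEl_act_closed hg rfl, hx, map_zero]) ⟨act N (add_zero m) g y, by
      rw [dEl_act_closed hg hmn, hy, app_act_degree_zero]⟩
    refine ⟨act M (add_zero m) f x' - act M (by omega : n + -1 = m) η x, ?_⟩
    rw [map_sub, dEl_act_closed hf hmn, hx', ← act_sub_act_eq_dEl hη hmn x hx, act_comp₀, act_one,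
      sub_sub_cancel]
  · intro m n hmn y hy
    obtain ⟨x, hx, z, hz⟩ := h.2 hmn (act N (add_zero n) g y) (by
      rw [dEl_act_closed hg rfl, hy, map_zero])
    refine ⟨act M (add_zero n) f x, by rw [dEl_act_closed hf rfl, hx, map_zero],
      act N (add_zero m) f z + act N (by omega : n + -1 = m) η y, ?_⟩
    rw [map_add, dEl_act_closed hf hmn, hz, ← act_sub_act_eq_dEl hη hmn y hy, act_comp₀, act_one,
      app_act_degree_zero, map_sub, sub_add_sub_cancel]

/-- The morphism of complexes `M(b) → M(b')` given by a closed morphism `b → b'`. -/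
def actHom (M : B.modules.Obj) {b b' : B.Obj} (f : B.Hom b b' 0) (hf : B.IsClosed f) :
    value M b ⟶ value M b' :=
  CochainComplex.HomComplex.Cocycle.homOf
    (CochainComplex.HomComplex.Cocycle.mk (mapCochain M f) 1 (zero_add 1) (by
      rw [← mapCochain_d M (zero_add 1), show B.d (zero_add 1) f = 0 from hf]
      exact map_zero (DGFunctor.map M)))

/-- Finiteness of the cohomology of a module at an object only depends on its homotopy
equivalence class. -/
lemma finite_homology_of_htpyEquiv {b b' : B.Obj} (hb : B.HtpyEquiv b b')
    (h : Module.Finite k (DirectSum ℤ fun n => (value M b).homology n)) :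
    Module.Finite k (DirectSum ℤ fun n => (value M b').homology n) := by
  obtain ⟨f, g, -, η, hf, hg, -, hη⟩ := hb
  refine finite_homology_of_surjective (actHom M f hf) (fun n => ?_) h
  refine (homologyMap_surjective_iff _ (sub_add_cancel n 1)).2 fun (y : El M b' n) hy => ?_
  have hy' : dEl M b' n (n + 1) y = 0 := hy
  refine ⟨act M (add_zero n) g y, (dEl_act_closed hg rfl y).trans (by rw [hy', map_zero]),
    act M (by omega) η y, ?_⟩
  change dEl M b' (n - 1) n _ = act M (add_zero n) f (act M (add_zero n) g y) - y
  rw [← act_sub_act_eq_dEl hη (sub_add_cancel n 1) y hy', act_comp₀, act_one]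

end Transport

section Coind

variable {k : Type u} [Field k] {A B : DGCat.{u, u} k}

/-- Representable modules are cofibrant. -/
lemma isCofibrant_repr (b : B.Obj) : IsCofibrant (repr b) := by
  intro M N t ht f hf
  obtain ⟨hq, hs⟩ := isTrivialFibration_iff.1 ht
  obtain ⟨hc, hq⟩ := isQuasiIso_iff.1 hq
  have hf' := isClosed_iff.1 hf b 0 (reprEl b b 0 (B.one b))
  rw [dEl_reprEl rfl, d_one, map_zero, map_zero] at hf'
  obtain ⟨x, hx, y, hy⟩ := (hq b).2 (sub_add_cancel 0 1) _ hf'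
  obtain ⟨z, rfl⟩ := hs b _ y
  refine ⟨reprDesc M b (x - dEl M b _ _ z), ?_, ?_⟩
  · rw [IsClosed, ← reprDesc_d, map_sub, show dEl M b 0 1 x = 0 from hx, dEl_dEl, sub_zero,
      map_zero]
  · refine repr_hom_ext ?_
    rw [reprDesc_comp, app_reprDesc_one, map_sub, ← hc.dEl_app b (add_zero _) _ (by omega), hy,
      sub_sub_cancel]

/-- The unit for the identity DG-functor is a quasi-isomorphism, by the Yoneda lemma. -/
lemma isQuasiIso_coindUnitId (M : A.modules.Obj) :
    IsQuasiIso (coindUnitId M) := by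
  refine isQuasiIso_iff.2 ⟨isClosed_coindUnitId _, fun a => ?_⟩
  have hq : IsHtpyEquiv (reprCounit a) :=
    (isQuasiIso_cofCounit (repr a)).isHtpyEquiv (isCofibrant_cofRep _) (isCofibrant_repr a)
  constructor
  · rintro m n h x hx ⟨y, hy⟩
    obtain ⟨ψ, rfl⟩ := exists_coindEl y
    rw [app_coindUnitId, dEl_coindEl h] at hy
    obtain ⟨t, ht⟩ := hq.exists_of_comp_eq_d h (reprDesc M a x) (by
      rw [← reprDesc_d, hx, map_zero]) ψ ((coindEl _ _ _ _).injective hy)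
    refine ⟨app t a (zero_add m) (reprEl a a 0 (A.one a)), ?_⟩
    rw [← app_reprDesc_one a (dEl M a m n _), reprDesc_d a h, reprDesc_app, ht, app_reprDesc_one]
  · intro m n h y hy
    obtain ⟨φ, rfl⟩ := exists_coindEl y
    rw [dEl_coindEl rfl, LinearEquiv.map_eq_zero_iff] at hy
    obtain ⟨t, ht, ψ, hψ⟩ := hq.exists_comp_sub_eq_d h φ hy
    refine ⟨app t a (zero_add n) (reprEl a a 0 (A.one a)), ?_, coindEl _ _ _ _ ψ, ?_⟩
    · rw [← app_reprDesc_one a (dEl M a n (n + 1) _), reprDesc_d a rfl, reprDesc_app, ht, app_zero]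
    · rw [dEl_coindEl h, hψ, map_sub, app_coindUnitId, reprDesc_app]

variable {F : A ⟶ B} (hF : DGFunctor.IsQuasiEquiv F)
include hF

lemma isHtpyEquiv_resolMap (a : A.Obj) : IsHtpyEquiv (resolMap F a) :=
  (IsQuasiIso.reprMap hF a).cofMap.isHtpyEquiv (isCofibrant_cofRep _) (isCofibrant_cofRep _)

/-- Along a quasi-equivalence the resolutions of `A(a, -)` and of the restriction of `B(F a, -)` are
homotopy equivalent, so that morphisms out of them have the same cohomology. -/
lemma isQuasiIso_coindComparison (M : A.modules.Obj) : IsQuasiIso (coindComparison F M) := by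
  refine isQuasiIso_iff.2 ⟨isClosed_coindComparison _, fun a => ?_⟩
  have hq := isHtpyEquiv_resolMap hF a
  constructor
  · rintro m n h x hx ⟨y, hy⟩
    obtain ⟨x, rfl⟩ := exists_resEl x
    obtain ⟨φ, rfl⟩ := exists_coindEl x
    obtain ⟨ψ, rfl⟩ := exists_coindEl y
    rw [dEl_resEl, dEl_coindEl rfl, LinearEquiv.map_eq_zero_iff, LinearEquiv.map_eq_zero_iff] at hx
    rw [app_coindComparison, dEl_coindEl h] at hy
    obtain ⟨t, ht⟩ := hq.exists_of_comp_eq_d h φ hx ψ ((coindEl _ _ _ _).injective hy)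
    exact ⟨resEl F _ a m (coindEl _ _ _ _ t), by rw [dEl_resEl, dEl_coindEl h, ht]⟩
  · intro m n h y hy
    obtain ⟨φ, rfl⟩ := exists_coindEl y
    rw [dEl_coindEl rfl, LinearEquiv.map_eq_zero_iff] at hy
    obtain ⟨t, ht, ψ, hψ⟩ := hq.exists_comp_sub_eq_d h φ hy
    refine ⟨resEl F _ a n (coindEl _ _ _ _ t), ?_, coindEl _ _ _ _ ψ, ?_⟩
    · rw [dEl_resEl, dEl_coindEl rfl, ht, map_zero, map_zero]
    · rw [dEl_coindEl h, hψ, map_sub, app_coindComparison]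

/-- A closed morphism of `B`-modules that becomes a quasi-isomorphism by restriction along a
quasi-equivalence is one. -/
lemma IsQuasiIso.of_res {M N : B.modules.Obj} {t : B.modules.Hom M N 0}
    (ht : B.modules.IsClosed t) (h : IsQuasiIso (A := A) ((resM F).map t)) : IsQuasiIso t := by
  refine isQuasiIso_iff.2 ⟨ht, fun b => ?_⟩
  obtain ⟨a, ha⟩ := hF.essSurj b
  exact QIsoAt.of_htpyEquiv ht ha ((isQuasiIso_iff.1 h).2 a)

lemma isQuasiIso_coindUnit (N : B.modules.Obj) : IsQuasiIso (coindUnit (resM F) N) := by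
  refine IsQuasiIso.of_res hF (isClosed_coindUnit _ _) ?_
  refine IsQuasiIso.of_comp_right (IsClosed.map (isClosed_coindUnit _ _) (resM F))
    (isQuasiIso_coindComparison hF ((resM F).obj N)) ?_
  rw [coindUnit_comp_comparison]
  exact isQuasiIso_coindUnitId _

omit hF in
lemma IsQuasiIso.coindMap_id {M M' : A.modules.Obj} {t : A.modules.Hom M M' 0} (ht : IsQuasiIso t) :
    IsQuasiIso (coindMap (resol (DGFunctor.idFunctor A.modules)) t) := by
  refine IsQuasiIso.of_comp_left (isQuasiIso_coindUnitId M)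
    (IsClosed.map ht.choose (coindFunctor _)) ?_
  rw [coindUnitId_naturality]
  exact ht.comp (isQuasiIso_coindUnitId M')

lemma IsQuasiIso.coindMap {M M' : A.modules.Obj} {t : A.modules.Hom M M' 0} (ht : IsQuasiIso t) :
    IsQuasiIso (coindMap (resol (resM F)) t) := by
  have hc : B.modules.IsClosed (DGCat.coindMap (resol (resM F)) t) :=
    IsClosed.map ht.choose (coindFunctor (resol (resM F)))
  refine IsQuasiIso.of_res hF hc ?_
  refine IsQuasiIso.of_comp_right (IsClosed.map hc (resM F)) (isQuasiIso_coindComparison hF M') ?_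
  rw [← coindComparison_naturality]
  exact (isQuasiIso_coindComparison hF M).comp ht.coindMap_id

lemma IsCohFinite.coind {M : A.modules.Obj} (hM : IsCohFinite M) :
    IsCohFinite (coind (resol (resM F)) M) := by
  intro b
  obtain ⟨a, ha⟩ := hF.essSurj b
  exact finite_homology_of_htpyEquiv ha ((isQuasiIso_coindComparison hF M).isCohFinite_source
    ((isQuasiIso_coindUnitId M).isCohFinite_target hM) a)

variable {Y : DGCat.{v, w} k}

lemma natQuasiIso_coindUnit (Φ : DGFunctor Y B.modules) :
    NatQuasiIso Φ ((Φ.comp (resM F)).comp (coindFunctor (resol (resM F)))) :=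
  ⟨⟨fun i => coindUnit (resM F) (Φ.obj i), fun i j p m h h' f => by
      obtain rfl : p = m := by omega
      rw [mul_zero, Int.negOnePow_zero, one_smul]
      exact (coindUnit_naturality (resM F) (Φ.map f)).symm⟩,
    fun i => isQuasiIso_coindUnit hF (Φ.obj i)⟩

omit hF in
lemma natQuasiIso_coindUnitId (Φ : DGFunctor Y A.modules) :
    NatQuasiIso Φ (Φ.comp (coindFunctor (resol (DGFunctor.idFunctor A.modules)))) :=
  ⟨⟨fun i => coindUnitId (Φ.obj i), fun i j p m h h' f => by
      obtain rfl : p = m := by omega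
      rw [mul_zero, Int.negOnePow_zero, one_smul]
      exact (coindUnitId_naturality (Φ.map f)).symm⟩,
    fun i => isQuasiIso_coindUnitId (Φ.obj i)⟩

lemma natQuasiIso_coindComparison (Φ : DGFunctor Y A.modules) :
    NatQuasiIso ((Φ.comp (coindFunctor (resol (resM F)))).comp (resM F))
      (Φ.comp (coindFunctor (resol (DGFunctor.idFunctor A.modules)))) :=
  ⟨⟨fun i => coindComparison F (Φ.obj i), fun i j p m h h' f => by
      obtain rfl : p = m := by omega
      rw [mul_zero, Int.negOnePow_zero, one_smul]
      exact (coindComparison_naturality (Φ.map f)).symm⟩,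
    fun i => isQuasiIso_coindComparison hF (Φ.obj i)⟩

variable (S : ∀ A : DGCat.{u, u} k, SmallModel A.derivedCf)

/-- Restriction along a quasi-equivalence `F` gives an isomorphism `D_cf(B) → D_cf(A)`, the
inverse being given by the right adjoint of restriction. -/
theorem isIso_dcfMap : IsIso (dcfMap S F) := by
  have hH : ∀ ⦃M N⦄ (t : A.modules.Hom M N 0), IsQuasiIso t →
      IsQuasiIso (A := B) ((coindFunctor (resol (resM F))).map t) := fun _ _ _ h => h.coindMap hF
  have hH' : ∀ M, IsCohFinite M → IsCohFinite (A := B) ((coindFunctor (resol (resM F))).obj M) :=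
    fun _ h => IsCohFinite.coind hF h
  have hA := hasCohFinite_comp_incl (A := A) (S A).incl
  have hB := hasCohFinite_comp_incl (A := B) (S B).incl
  have h₁ := natQuasiIso_coindUnitId ((S A).incl.comp A.derivedCfIncl)
  refine ⟨qcls (S B) (((S A).incl.comp A.derivedCfIncl).comp (coindFunctor (resol (resM F))))
    fun i => hH' _ ((S A).obj i).2.2, ?_, ?_⟩
  · refine (qcls_comp_qcls (S A) (S B) _ _ _ hH hH').trans ?_
    exact (qcls_eq_of_natQuasiIso (S B) (natQuasiIso_coindUnit hF _) hB _).symm.trans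
      ((qcls_comp_incl (S B) (S B).incl).trans (S B).cls_incl)
  · refine (qcls_comp_dcfMap S _ _ F).trans ?_
    exact (qcls_eq_of_natQuasiIso (S A) (natQuasiIso_coindComparison hF _) _
      (h₁.hasCohFinite_target hA)).trans ((qcls_eq_of_natQuasiIso (S A) h₁ hA _).symm.trans
        ((qcls_comp_incl (S A) (S A).incl).trans (S A).cls_incl))

end Coind

end DGCat

/-! ### The functor `D_cf(-)` on `Hqe` and its self-adjunction -/

namespace DGCat

section Transpose

variable {k : Type u} [CommRing k] {A X : DGCat.{u, u} k}

/-- The transpose `a ↦ (x ↦ Φ(x)(a))` of a DG-functor `Φ` from `X` to `A`-modules. -/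
def transpose (Φ : DGFunctor X A.modules) : DGFunctor A X.modules :=
  (DGFunctor.eval A (complexes k)).comp (DGFunctor.res Φ (complexes k))

lemma hasCohFinite_transpose {k : Type u} [Field k] {A X : DGCat.{u, u} k}
    {Φ : DGFunctor X A.modules} (hΦ : HasCohFinite Φ) : HasCohFinite (transpose Φ) :=
  fun a x => hΦ x a

/-- The transpose of a natural transformation, at `a`. -/
def transposeApp {Φ Ψ : DGFunctor X A.modules} (ε : (X.functors A.modules).Hom Φ Ψ 0) (a : A.Obj) :
    X.modules.Hom ((transpose Φ).obj a) ((transpose Ψ).obj a) 0 :=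
  ⟨fun x => (show A.modules.Hom (Φ.obj x) (Ψ.obj x) 0 from ε.1 x).1 a, fun x y p m h h' f =>
    congrFun (congrArg Subtype.val (ε.2 h h' f)) a⟩

end Transpose

section

variable {k : Type u} [Field k] {A X : DGCat.{u, u} k}

lemma NatQuasiIso.transpose {Φ Ψ : DGFunctor X A.modules} (h : NatQuasiIso Φ Ψ) :
    NatQuasiIso (transpose Φ) (transpose Ψ) := by
  obtain ⟨ε, hε⟩ := h
  refine ⟨⟨transposeApp ε, fun a b p m hm hm' f => Subtype.ext (funext fun x => ?_)⟩,
    fun a => ⟨Subtype.ext (funext fun x => congrFun (congrArg Subtype.val (hε x).1) a),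
      fun x => (hε x).2 a⟩⟩
  exact (show A.modules.Hom (Φ.obj x) (Ψ.obj x) 0 from ε.1 x).2 hm hm' f

variable (S : ∀ A : DGCat.{u, u} k, SmallModel A.derivedCf)

/-- The functor `D_cf(-)` on `dgcat`, contravariant with values in `Hqe`. -/
noncomputable def dcfPre : DGCat.{u, u} k ⥤ (Hqe k)ᵒᵖ where
  obj A := op ((toHqe k).obj (S A).cat)
  map F := (dcfMap S F).op
  map_id A := by rw [dcfMap_id, op_id]
  map_comp F G := by rw [dcfMap_comp, op_comp]

lemma dcfPre_inverts : (quasiEquiv k).IsInvertedBy (dcfPre S) := fun A B F hF => by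
  have := isIso_dcfMap (F := F) hF S
  change IsIso (dcfMap S F).op
  infer_instance

/-- The functor `D_cf(-)` on `Hqe`. -/
noncomputable def dcf : Hqe k ⥤ (Hqe k)ᵒᵖ :=
  Localization.Construction.lift (dcfPre S) (dcfPre_inverts S)

lemma dcf_map {A B : DGCat.{u, u} k} (F : A ⟶ B) :
    (dcf S).map ((toHqe k).map F) = (dcfMap S F).op := by
  refine (Functor.congr_hom (Localization.Construction.fac (dcfPre S) (dcfPre_inverts S)) F).trans ?_
  exact (Category.id_comp ((dcfMap S F).op ≫ 𝟙 _)).trans (Category.comp_id _)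

/-- The action of `D_cf(-)` on a morphism between images of DG-categories. -/
noncomputable def dcfHom {A B : DGCat.{u, u} k} (φ : (toHqe k).obj A ⟶ (toHqe k).obj B) :
    (toHqe k).obj (S B).cat ⟶ (toHqe k).obj (S A).cat :=
  ((dcf S).map φ).unop

lemma dcfHom_map {A B : DGCat.{u, u} k} (F : A ⟶ B) :
    dcfHom S ((toHqe k).map F) = dcfMap S F :=
  congrArg Quiver.Hom.unop (dcf_map S F)

lemma dcfHom_comp {A B C : DGCat.{u, u} k} (φ : (toHqe k).obj A ⟶ (toHqe k).obj B)
    (ψ : (toHqe k).obj B ⟶ (toHqe k).obj C) :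
    dcfHom S (φ ≫ ψ) = dcfHom S ψ ≫ dcfHom S φ :=
  congrArg Quiver.Hom.unop ((dcf S).map_comp φ ψ)

lemma hasCohFinite_evalCf (A : DGCat.{u, u} k) (T : SmallModel A.derivedCf) :
    HasCohFinite (evalCf A T) :=
  hasCohFinite_transpose (hasCohFinite_comp_incl T.incl)

/-- The component of `ev` at `A`: the class of the DG-functor that evaluates modules at the objects
of `A`. -/
noncomputable def evCls (A : DGCat.{u, u} k) :
    (toHqe k).obj A ⟶ (toHqe k).obj (S (S A).cat).cat :=
  qcls _ (evalCf A (S A)) (hasCohFinite_evalCf A (S A))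

/-- Composing evaluation with the image of the class of `Φ` under `D_cf(-)` gives the class of the
transpose of `Φ`. Let `T` be the enlargement of the small model by the values of the cofibrant
replacement of `Φ`. The class of `Φ` is a fraction of two DG-functors to `T`, and restricting the
evaluation `A → C(T)` along them gives the evaluation on the small model and the transpose. -/
theorem evCls_comp_dcfHom (Φ : DGFunctor X A.modules) (hΦ : HasCohFinite Φ) :
    evCls S A ≫ dcfHom S (qcls (S A) Φ hΦ) =
      qcls (S X) (transpose Φ) (hasCohFinite_transpose hΦ) := by
  let P := cofCf Φ hΦ
  let T := (S A).extend P
  have e₁ : dcfMap S ((S A).toExtend P) ≫ dcfHom S (qcls (S A) Φ hΦ) =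
      dcfMap S ((S A).lift P) := by
    rw [← dcfHom_map, ← dcfHom_comp, ← dcfHom_map]
    exact congrArg _ (((S A).eq_cls_iff P _).1 rfl)
  have e₂ : qcls (S T.cat) (evalCf A T) (hasCohFinite_evalCf A T) ≫ dcfMap S ((S A).toExtend P) =
      evCls S A := qcls_comp_dcfMap S _ _ _
  have e₃ : qcls (S T.cat) (evalCf A T) (hasCohFinite_evalCf A T) ≫ dcfMap S ((S A).lift P) =
      qcls (S X) (transpose (P.comp A.derivedCfIncl))
        (hasCohFinite_transpose (hasCohFinite_comp_incl P)) := qcls_comp_dcfMap S _ _ _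
  rw [← e₂, Category.assoc, e₁, e₃]
  exact qcls_eq_of_natQuasiIso _ (natQuasiIso_cofCf Φ hΦ).transpose _ _

/-- Naturality of `ev` with respect to DG-functors: both sides are the class of the transpose of the
restriction along `F`. -/
lemma evCls_naturality {A B : DGCat.{u, u} k} (F : A ⟶ B) :
    (toHqe k).map F ≫ evCls S B = evCls S A ≫ dcfHom S (dcfMap S F) := by
  refine Eq.trans ?_ (evCls_comp_dcfHom S (resCf F (S B)) _).symm
  exact (qcls_comp _ F (evalCf B (S B)) _).symm

/-- The triangle identity: the transpose of evaluation is the inclusion of the small model. -/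
lemma evCls_triangle (A : DGCat.{u, u} k) :
    evCls S (S A).cat ≫ dcfHom S (evCls S A) = 𝟙 _ := by
  refine (evCls_comp_dcfHom S (evalCf A (S A)) _).trans ?_
  exact (qcls_comp_incl (S A) (S A).incl).trans (S A).cls_incl

/-- The natural transformation `ev`; naturality with respect to DG-functors suffices, since these
and the inverses of quasi-equivalences generate `Hqe`. -/
noncomputable def evTrans : 𝟭 (Hqe k) ⟶ dcf S ⋙ (dcf S).leftOp :=
  Localization.Construction.natTransExtension (W := quasiEquiv k)
    { app := fun A => evCls S A
      naturality := fun A B F => by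
        refine (evCls_naturality S F).trans ?_
        exact congrArg (evCls S A ≫ ·) ((congrArg (dcfHom S) (dcfHom_map S F)).symm) }

lemma evTrans_app (A : DGCat.{u, u} k) : (evTrans S).app ((toHqe k).obj A) = evCls S A :=
  Localization.Construction.NatTransExtension.app_eq _ A

lemma evTrans_triangle (Y : Hqe k) :
    (evTrans S).app ((dcf S).obj Y).unop ≫ ((dcf S).map ((evTrans S).app Y)).unop = 𝟙 _ := by
  obtain ⟨A, rfl⟩ := (Localization.Construction.objEquiv (quasiEquiv k)).surjective Y
  change (evTrans S).app ((toHqe k).obj (S A).cat) ≫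
    ((dcf S).map ((evTrans S).app ((toHqe k).obj A))).unop = 𝟙 _
  rw [evTrans_app, evTrans_app]
  exact evCls_triangle S A

/-- The self-adjunction of `D_cf(-)`; its unit and its counit are both given by `ev`. -/
noncomputable def dcfAdj : dcf S ⊣ (dcf S).leftOp :=
  Adjunction.mkOfUnitCounit
    { unit := evTrans S
      counit :=
        { app := fun Y => ((evTrans S).app Y.unop).op
          naturality := fun Y Z f => congrArg Quiver.Hom.op ((evTrans S).naturality f.unop).symm }
      left_triangle := by
        ext Y
        refine Eq.trans ?_ (congrArg Quiver.Hom.op (evTrans_triangle S Y))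
        simp
        rfl
      right_triangle := by
        ext Y
        refine Eq.trans ?_ (evTrans_triangle S Y.unop)
        simp }

end

end DGCat

/-! ### Existence of small models -/

namespace DGCat

section SmallModels

variable {k : Type u} [Field k]

/-- Formal terms for the elements of an `A`-module with generators indexed by the sequences in `k`,
closed under the module operations, the differential and the choice of primitives. Sequences in `k`
are enough to index the cohomology classes, since the cohomology at every object is
finite-dimensional; the type of terms does not depend on a module. -/
inductive Term (A : DGCat.{u, u} k) : A.Obj → ℤ → Type u
  | gen (a : A.Obj) (n : ℤ) (v : ℕ → k) : Term A a n
  | zero (a : A.Obj) (n : ℤ) : Term A a n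
  | add {a : A.Obj} {n : ℤ} (s t : Term A a n) : Term A a n
  | smul {a : A.Obj} {n : ℤ} (c : k) (s : Term A a n) : Term A a n
  | act {a b : A.Obj} {p q n : ℤ} (h : q + p = n) (f : A.Hom a b p) (s : Term A a q) : Term A b n
  | d {a : A.Obj} {m n : ℤ} (h : m + 1 = n) (s : Term A a m) : Term A a n
  | prim {a : A.Obj} {m n : ℤ} (h : m + 1 = n) (s : Term A a n) : Term A a m

variable {A : DGCat.{u, u} k}

/-- A primitive of an exact element; the value is `0` if the element is not exact. -/
noncomputable def primitive (M : A.modules.Obj) (a : A.Obj) (m n : ℤ) (x : El M a n) : El M a m :=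
  open Classical in if h : ∃ y, dEl M a m n y = x then h.choose else 0

lemma dEl_primitive {M : A.modules.Obj} {a : A.Obj} {m n : ℤ} {y : El M a m} {x : El M a n}
    (h : dEl M a m n y = x) : dEl M a m n (primitive M a m n x) = x := by
  have h' : ∃ y, dEl M a m n y = x := ⟨y, h⟩
  rw [primitive, dif_pos h']
  exact h'.choose_spec

/-- The cohomology classes of a cohomologically finite module at an object are represented by
cocycles indexed by the sequences in `k`. -/
lemma IsCohFinite.exists_generators {M : A.modules.Obj} (hM : IsCohFinite M) (a : A.Obj) (n : ℤ) :
    ∃ g : (ℕ → k) → El M a n, (∀ v, dEl M a n (n + 1) (g v) = 0) ∧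
      ∀ (m : ℤ) (_ : m + 1 = n) (y : El M a n), dEl M a n (n + 1) y = 0 →
        ∃ v z, dEl M a m n z = g v - y := by
  have := finite_homology_apply (hM a) n
  obtain ⟨r, f, hf⟩ := Module.Finite.exists_fin' k ((value M a).homology n)
  choose g hg using fun v : ℕ → k => IsClass.exists_cocycle n (f fun i => v i)
  refine ⟨g, fun v => (hg v).d_eq_zero _, fun m hm y hy => ?_⟩
  obtain ⟨z, hz⟩ := IsClass.exists_class (K := value M a) hy
  obtain ⟨w, rfl⟩ := hf z
  refine ⟨fun i => if h : i < r then w ⟨i, h⟩ else 0, ?_⟩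
  refine (((hg _).sub hz).eq_zero_iff hm).1 (sub_eq_zero.2 (congrArg f (funext fun i => ?_)))
  simp

/-- Cocycles that represent all cohomology classes of a cohomologically finite module. -/
noncomputable def generator {M : A.modules.Obj} (hM : IsCohFinite M) (a : A.Obj) (n : ℤ) :
    (ℕ → k) → El M a n :=
  (hM.exists_generators a n).choose

/-- The value of a term in a cohomologically finite module. -/
noncomputable def Term.eval {M : A.modules.Obj} (hM : IsCohFinite M) :
    ∀ {a : A.Obj} {n : ℤ}, Term A a n → El M a n
  | _, _, gen a n v => generator hM a n v
  | _, _, zero _ _ => 0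
  | _, _, add s t => eval hM s + eval hM t
  | _, _, smul c s => c • eval hM s
  | _, _, act h f s => DGCat.act M h f (eval hM s)
  | _, _, d (m := m) (n := n) _ s => dEl M _ m n (eval hM s)
  | _, _, prim (m := m) (n := n) _ s => primitive M _ m n (eval hM s)

/-- The relations between the values of terms in a cohomologically finite module. -/
def termRel {M : A.modules.Obj} (hM : IsCohFinite M) :
    ∀ (a : A.Obj) (n : ℤ), Term A a n → Term A a n → Prop :=
  fun _ _ s t => s.eval hM = t.eval hM

variable {M N : A.modules.Obj} (hM : IsCohFinite M) (hN : IsCohFinite N)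

/-- The pairs of values of the same term in two modules; they are the elements of a module since the
terms are closed under the operations. -/
noncomputable def termGraph (a : A.Obj) (n : ℤ) : Submodule k (El M a n × El N a n) where
  carrier := {x | ∃ t : Term A a n, (t.eval hM, t.eval hN) = x}
  zero_mem' := ⟨Term.zero a n, by simp only [Term.eval]; rfl⟩
  add_mem' := by
    rintro _ _ ⟨s, rfl⟩ ⟨t, rfl⟩
    exact ⟨s.add t, by simp only [Term.eval]; rfl⟩
  smul_mem' := by
    rintro c _ ⟨s, rfl⟩
    exact ⟨s.smul c, by simp only [Term.eval]; rfl⟩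

variable {hM hN} in
lemma termGraph_units_smul {a : A.Obj} {n : ℤ} (c : ℤ) (x : termGraph hM hN a n) :
    (c.negOnePow • x).1.1 = c.negOnePow • x.1.1 ∧ (c.negOnePow • x).1.2 = c.negOnePow • x.1.2 := by
  obtain e | e := Int.units_eq_one_or c.negOnePow <;> simp [e]

/-- The differential on pairs of values. -/
noncomputable def termGraphD (a : A.Obj) {m n : ℤ} (h : m + 1 = n) :
    termGraph hM hN a m →ₗ[k] termGraph hM hN a n :=
  LinearMap.restrict (LinearMap.prodMap (dEl M a m n) (dEl N a m n)) (by
    rintro _ ⟨s, rfl⟩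
    exact ⟨s.d h, by simp only [Term.eval]; rfl⟩)

/-- The action on pairs of values. -/
noncomputable def termGraphAct {a b : A.Obj} {p q n : ℤ} (h : q + p = n) :
    A.Hom a b p →ₗ[k] termGraph hM hN a q →ₗ[k] termGraph hM hN b n :=
  LinearMap.mk₂ k
    (fun f x => ⟨(act M h f x.1.1, act N h f x.1.2), by
      obtain ⟨_, s, rfl⟩ := x
      exact ⟨Term.act h f s, by simp only [Term.eval]⟩⟩)
    (fun f g x => Subtype.ext (Prod.ext (by simp) (by simp)))
    (fun c f x => Subtype.ext (Prod.ext (by simp) (by simp)))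
    (fun f x y => Subtype.ext (Prod.ext (by simp) (by simp)))
    (fun c f x => Subtype.ext (Prod.ext (by simp) (by simp)))

lemma termGraphD_act {a b : A.Obj} {p q n p' q' n' : ℤ} (h : q + p = n) (hp : p + 1 = p')
    (hq : q + 1 = q') (hn : n + 1 = n') (h₁ : q + p' = n') (h₂ : q' + p = n')
    (f : A.Hom a b p) (x : termGraph hM hN a q) :
    termGraphD hM hN b hn (termGraphAct hM hN h f x) = termGraphAct hM hN h₁ (A.d hp f) x +
      p.negOnePow • termGraphAct hM hN h₂ f (termGraphD hM hN a hq x) := by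
  refine Subtype.ext (Prod.ext ((dEl_act M h hp hq hn f x.1.1).trans ?_)
    ((dEl_act N h hp hq hn f x.1.2).trans ?_))
  · exact congrArg _ (termGraph_units_smul p
      (termGraphAct hM hN h₂ f (termGraphD hM hN a hq x))).1.symm
  · exact congrArg _ (termGraph_units_smul p
      (termGraphAct hM hN h₂ f (termGraphD hM hN a hq x))).2.symm

/-- The data of the module of pairs of values of the same term in two modules. -/
noncomputable abbrev termGraphData : ModData A where
  X a n := termGraph hM hN a n
  d a m n h := termGraphD hM hN a h
  d_d a l m n h h' x := Subtype.ext (Prod.ext (dEl_dEl M a l m n _) (dEl_dEl N a l m n _))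
  act h := termGraphAct hM hN h
  act_one x := Subtype.ext (Prod.ext (act_one M _) (act_one N _))
  act_comp h h₁ h₂ h₃ f g x :=
    Subtype.ext (Prod.ext (act_comp M h h₁ h₂ h₃ f g _) (act_comp N h h₁ h₂ h₃ f g _))
  d_act := termGraphD_act hM hN

/-- The projection of the module of pairs of values to `M`. -/
noncomputable def termGraphFst : A.modules.Hom (termGraphData hM hN).toModule M 0 :=
  ModData.desc (fun a p q h => app (A.modules.one M) a h ∘ₗ LinearMap.fst k _ _ ∘ₗ
    (termGraph hM hN a p).subtype) (by
      intro a b p q r s l h₁ h₂ h₃ h₄ f x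
      rw [mul_zero, Int.negOnePow_zero, one_smul]
      exact app_act₀ (A.modules.one M) h₁ h₂ h₃ h₄ f x.1.1)

/-- The projection of the module of pairs of values to `N`. -/
noncomputable def termGraphSnd : A.modules.Hom (termGraphData hM hN).toModule N 0 :=
  ModData.desc (fun a p q h => app (A.modules.one N) a h ∘ₗ LinearMap.snd k _ _ ∘ₗ
    (termGraph hM hN a p).subtype) (by
      intro a b p q r s l h₁ h₂ h₃ h₄ f x
      rw [mul_zero, Int.negOnePow_zero, one_smul]
      exact app_act₀ (A.modules.one N) h₁ h₂ h₃ h₄ f x.1.2)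

/-- The pair of values of a term. -/
noncomputable def termPair {a : A.Obj} {n : ℤ} (t : Term A a n) :
    El (termGraphData hM hN).toModule a n :=
  (termGraphData hM hN).el ⟨(t.eval hM, t.eval hN), t, rfl⟩

variable {hM hN}

lemma exists_termPair {a : A.Obj} {n : ℤ} (x : El (termGraphData hM hN).toModule a n) :
    ∃ t, termPair hM hN t = x := by
  obtain ⟨⟨_, t, rfl⟩, rfl⟩ := ModData.exists_el x
  exact ⟨t, rfl⟩

lemma termPair_eq_iff {a : A.Obj} {n : ℤ} {s t : Term A a n} :
    termPair hM hN s = termPair hM hN t ↔ s.eval hM = t.eval hM ∧ s.eval hN = t.eval hN := by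
  rw [termPair, termPair, EmbeddingLike.apply_eq_iff_eq]
  exact Subtype.ext_iff.trans Prod.ext_iff

lemma dEl_termPair {a : A.Obj} {m n : ℤ} (h : m + 1 = n) (t : Term A a m) :
    dEl (termGraphData hM hN).toModule a m n (termPair hM hN t) = termPair hM hN (t.d h) := by
  refine ((termGraphData hM hN).dEl_el h _).trans (congrArg _ (Subtype.ext (Prod.ext ?_ ?_))) <;>
  · simp only [Term.eval]
    rfl

lemma termPair_zero (a : A.Obj) (n : ℤ) : termPair hM hN (Term.zero a n) = 0 := by
  refine (LinearEquiv.map_eq_zero_iff _).2 (Subtype.ext (Prod.ext ?_ ?_)) <;>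
  · simp only [Term.eval]
    rfl

lemma app_termGraphFst {a : A.Obj} {n : ℤ} (h : n + 0 = n) (t : Term A a n) :
    app (termGraphFst hM hN) a h (termPair hM hN t) = t.eval hM :=
  app_one a h _

lemma app_termGraphSnd {a : A.Obj} {n : ℤ} (h : n + 0 = n) (t : Term A a n) :
    app (termGraphSnd hM hN) a h (termPair hM hN t) = t.eval hN :=
  app_one a h _

lemma isClosed_termGraphFst : A.modules.IsClosed (termGraphFst hM hN) := by
  rw [isClosed_iff]
  intro a p x
  obtain ⟨t, rfl⟩ := exists_termPair x
  rw [app_termGraphFst, dEl_termPair rfl, app_termGraphFst]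
  simp only [Term.eval]

lemma isClosed_termGraphSnd : A.modules.IsClosed (termGraphSnd hM hN) := by
  rw [isClosed_iff]
  intro a p x
  obtain ⟨t, rfl⟩ := exists_termPair x
  rw [app_termGraphSnd, dEl_termPair rfl, app_termGraphSnd]
  simp only [Term.eval]

variable (h : termRel hM = termRel hN)
include h

lemma eval_eq_iff {a : A.Obj} {n : ℤ} {s t : Term A a n} :
    s.eval hM = t.eval hM ↔ s.eval hN = t.eval hN :=
  iff_of_eq (congrFun (congrFun (congrFun (congrFun h a) n) s) t)

/-- If the same relations hold between the values of terms in `M` and in `N`, then the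
differential of the chosen primitive recovers a term as soon as it is exact in `M`. -/
lemma dEl_termPair_prim {a : A.Obj} {m n : ℤ} (hmn : m + 1 = n) {t : Term A a n} {y : El M a m}
    (hy : dEl M a m n y = t.eval hM) :
    dEl (termGraphData hM hN).toModule a m n (termPair hM hN (t.prim hmn)) = termPair hM hN t := by
  have e : ((t.prim hmn).d hmn).eval hM = t.eval hM := by
    simp only [Term.eval]
    exact dEl_primitive hy
  rw [dEl_termPair hmn, termPair_eq_iff]
  exact ⟨e, (eval_eq_iff h).1 e⟩

/-- If the same relations hold in `M` and in `N`, a term that is a cocycle in `M` gives a cocycle of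
pairs. -/
lemma dEl_termPair_eq_zero {a : A.Obj} {m n : ℤ} (hmn : m + 1 = n) {t : Term A a m}
    (ht : dEl M a m n (t.eval hM) = 0) :
    dEl (termGraphData hM hN).toModule a m n (termPair hM hN t) = 0 := by
  have e : (t.d hmn).eval hM = (Term.zero a n).eval hM := by
    simp only [Term.eval]
    exact ht
  rw [dEl_termPair hmn, ← termPair_zero, termPair_eq_iff]
  exact ⟨e, (eval_eq_iff h).1 e⟩

lemma isQuasiIso_termGraphFst : IsQuasiIso (termGraphFst hM hN) := by
  refine isQuasiIso_iff.2 ⟨isClosed_termGraphFst, fun a => ⟨?_, ?_⟩⟩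
  · rintro m n hmn x hx ⟨y, hy⟩
    obtain ⟨t, rfl⟩ := exists_termPair x
    rw [app_termGraphFst] at hy
    exact ⟨_, dEl_termPair_prim h hmn hy⟩
  · intro m n hmn y hy
    obtain ⟨hg, hg'⟩ := (hM.exists_generators a n).choose_spec
    obtain ⟨v, z, hz⟩ := hg' m hmn y hy
    have e : (Term.gen a n v : Term A a n).eval hM = (hM.exists_generators a n).choose v := by
      simp only [Term.eval]
      rfl
    refine ⟨termPair hM hN (Term.gen a n v), ?_, z, ?_⟩
    · refine dEl_termPair_eq_zero h rfl ?_
      rw [e, hg]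
    · rw [app_termGraphFst, e, hz]

lemma isQuasiIso_termGraphSnd : IsQuasiIso (termGraphSnd hM hN) := by
  refine isQuasiIso_iff.2 ⟨isClosed_termGraphSnd, fun a => ⟨?_, ?_⟩⟩
  · rintro m n hmn x hx ⟨y, hy⟩
    obtain ⟨t, rfl⟩ := exists_termPair x
    rw [app_termGraphSnd] at hy
    have e := dEl_termPair_prim h.symm hmn hy
    rw [dEl_termPair hmn, termPair_eq_iff] at e
    exact ⟨termPair hM hN (t.prim hmn), by rw [dEl_termPair hmn, termPair_eq_iff]; exact e.symm⟩
  · intro m n hmn y hy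
    obtain ⟨hg, hg'⟩ := (hN.exists_generators a n).choose_spec
    obtain ⟨v, z, hz⟩ := hg' m hmn y hy
    have e : (Term.gen a n v : Term A a n).eval hN = (hN.exists_generators a n).choose v := by
      simp only [Term.eval]
      rfl
    refine ⟨termPair hM hN (Term.gen a n v), ?_, z, ?_⟩
    · have e' := dEl_termPair_eq_zero h.symm rfl ((congrArg _ e).trans (hg v))
      rw [dEl_termPair rfl, ← termPair_zero, termPair_eq_iff] at e'
      rw [dEl_termPair rfl, ← termPair_zero, termPair_eq_iff]
      exact e'.symm
    · rw [app_termGraphSnd, e, hz]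

/-- Cofibrant modules in which the same relations hold between the values of terms are homotopy
equivalent. -/
lemma htpyEquiv_of_termRel_eq (hM' : IsCofibrant M) (hN' : IsCofibrant N) :
    A.modules.HtpyEquiv M N := by
  have hq := isQuasiIso_cofCounit (termGraphData hM hN).toModule
  have h₁ := (hq.comp (isQuasiIso_termGraphFst h)).isHtpyEquiv (isCofibrant_cofRep _) hM'
  have h₂ := (hq.comp (isQuasiIso_termGraphSnd h)).isHtpyEquiv (isCofibrant_cofRep _) hN'
  exact (htpyEquiv_iff.2 ⟨_, h₁⟩).symm.trans (htpyEquiv_iff.2 ⟨_, h₂⟩)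

omit h in
/-- There is a small set of objects of `D_cf(A)` that meets every homotopy equivalence class: the
relations between the values of terms determine the class, and they form a small set. -/
theorem nonempty_smallModel (A : DGCat.{u, u} k) : Nonempty (SmallModel A.derivedCf) := by
  let κ : A.derivedCf.Obj → ∀ (a : A.Obj) (n : ℤ), Term A a n → Term A a n → Prop :=
    fun M => termRel M.2.2
  exact ⟨{
    ι := Set.range κ
    obj := fun i => i.2.choose
    essSurj := fun M => by
      have hM : ∃ M', κ M' = κ M := ⟨M, rfl⟩
      exact ⟨⟨κ M, hM⟩, htpyEquiv_of_termRel_eq hM.choose_spec hM.choose.2.1 M.2.1⟩ }⟩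

end SmallModels

end DGCat

/-! ### The main result -/

theorem proposition6p6 (k : Type u) [Field k] :
    (∀ A : DGCat.{u, u} k, Nonempty (DGCat.SmallModel A.derivedCf)) ∧
    ∀ S : (A : DGCat.{u, u} k) → DGCat.SmallModel A.derivedCf,
      ∃ (D : Hqe k ⥤ (Hqe k)ᵒᵖ)
        (e : ∀ A : DGCat.{u, u} k,
          (toHqe k).obj (S A).cat ≅ (D.obj ((toHqe k).obj A)).unop),
        (∀ (A B : DGCat.{u, u} k) (F : A ⟶ B)
          (φ : (toHqe k).obj (S B).cat ⟶ (toHqe k).obj (S A).cat),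
          DGCat.Represents (S A) (DGCat.resCf F (S B)) φ ↔
            φ = (e B).hom ≫ (D.map ((toHqe k).map F)).unop ≫ (e A).inv) ∧
        ∃ ev : 𝟭 (Hqe k) ⟶ D ⋙ D.leftOp,
          (∀ (A : DGCat.{u, u} k)
            (φ : (toHqe k).obj A ⟶ (toHqe k).obj (S (S A).cat).cat),
            DGCat.Represents (S (S A).cat) (DGCat.evalCf A (S A)) φ ↔
              φ = ev.app ((toHqe k).obj A) ≫ (D.map (e A).hom).unop ≫ (e (S A).cat).inv) ∧
          ∃ adj : D ⊣ D.leftOp,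
            adj.unit = ev ∧ ∀ X : Hqe k, adj.counit.app (op X) = (ev.app X).op := by
  refine ⟨DGCat.nonempty_smallModel, fun S => ?_⟩
  refine ⟨DGCat.dcf S, fun A => Iso.refl ((toHqe k).obj (S A).cat), fun A B F φ => ?_,
    DGCat.evTrans S, fun A φ => ?_, DGCat.dcfAdj S, rfl, fun X => rfl⟩
  · rw [DGCat.represents_iff _ _ (fun i a => ((S B).obj i).2.2 (DGFunctor.obj F a))]
    refine Eq.congr_right ?_
    refine Eq.trans (DGCat.dcfHom_map S F).symm ?_
    exact ((Category.id_comp _).trans (Category.comp_id _)).symm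
  · rw [DGCat.represents_iff _ _ (DGCat.hasCohFinite_evalCf A (S A))]
    refine Eq.congr_right ?_
    refine Eq.trans (DGCat.evTrans_app S A).symm ?_
    have : ((DGCat.dcf S).map (𝟙 ((toHqe k).obj (S A).cat))).unop = 𝟙 _ :=
      congrArg Quiver.Hom.unop ((DGCat.dcf S).map_id _)
    refine Eq.trans ?_ (congrArg (fun z => (DGCat.evTrans S).app ((toHqe k).obj A) ≫ z ≫ 𝟙 _)
      this.symm)
    exact ((congrArg _ (Category.comp_id _)).trans (Category.comp_id _)).symm
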